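/- Let $d\ge 1$, $\alpha\in(0,2)$, and let $\phi:[0,\infty)\to(0,1]$ be a Borel function such that, for some positive constants $c_1,c_2,c_3$: (a) $\phi=1$ on $[0,1]$, and $\phi(a)\le c_1\phi(b)$ for all $a,b\ge 0$ with $|a-b|\le 1$; (b) $\phi\in C^2(1,\infty)$ and $\max(|\phi'(a)|,|\phi''(a)|)\le c_2\phi(a)$ for all $a>1$; (c) for all $x,y\in\mathbb R^d$ with $|x-y|>2$, $$\int_{|x-z|\ge 1,\ |y-z|\ge 1}\frac{\phi(|y-z|)}{|y-z|^{\alpha+d}}\,\frac{\phi(|z-x|)}{|z-x|^{\alpha+d}}\,dz\le c_3\frac{\phi(|y-x|)}{|y-x|^{\alpha+d}}.$$ Let $M,c_4>0$. Then there are constants $C_1,C_2>0$, depending only on $d,\alpha,\phi,M,c_4$, such that the following holds. Let $f:\mathbb R^d\times\mathbb R^d\to[0,\infty]$ be a Borel function such that: (A.1) $f(x,y)\le M\,\phi(|y-x|)/|y-x|^{\alpha+d}$ for all $x\ne y$; (A.2) $f(x,x+h)=f(x,x-h)$ for all $x,h\in\mathbb R^d$, or $\alpha<1$; (A.3) $f(x,y)=f(y,x)$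 for all $x,y\in\mathbb R^d$; (A.4) $\inf_{x\in\mathbb R^d}\int_{|y-x|>\varepsilon}\frac{f(x,y)}{\phi(|y-x|)}\,dy\ge c_4\varepsilon^{-\alpha}$ for all $\varepsilon>0$; (A.5) for every $y$, the function $x\mapsto f(x,y)$ is continuous on $\mathbb R^d\setminus\{y\}$; (A.6) the operator $$\mathcal A\varphi(x)=\lim_{\varepsilon\downarrow 0}\int_{|y-x|>\varepsilon}(\varphi(y)-\varphi(x))f(x,y)\,dy,\qquad \varphi\in C_c^2(\mathbb R^d),$$ regarded as an operator in the space $C_0(\mathbb R^d)$ of real continuous functions vanishing at infinity (with the supremum norm), is closable, and its closure is the generator of a strongly continuous contraction semigroup $\{P_t,\ t\ge 0\}$ on $C_0(\mathbb R^d)$. Then there is a function $p:(0,\infty)\times\mathbb R^d\times\mathbb R^d\to[0,\infty)$, with $p(t,x,\cdot)$ Borel and integrable for all $t>0$ and $x\in\mathbb R^d$, such that $$P_t\varphi(x)=\int_{\mathbb R^d}\varphi(y)\,p(t,x,y)\,dy,\qquad x\in\mathbb R^d,\ t>0,\ \varphi\in C_0(\mathbb R^d),$$ and $$p(t,x,y)\le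 C_1e^{C_2t}\min\left(t^{-d/\alpha},\frac{t\,\phi(|y-x|)}{|y-x|^{\alpha+d}}\right),\qquad x,y\in\mathbb R^d,\ t>0,$$ where the minimum is read as $t^{-d/\alpha}$ when $x=y$. -/

import Mathlib

open Set Filter Topology MeasureTheory
open scoped ENNReal ZeroAtInfty

noncomputable section

namespace StableDominated

/-- The space `ℝ^d` with its Euclidean norm and Lebesgue measure. -/
abbrev Rd (d : ℕ) : Type := EuclideanSpace ℝ (Fin d)

/-- The conditions on the dominating function `φ : [0,∞) → (0,1]`.  Only the values of `φ` on
`[0,∞)` matter. -/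
structure IsProfile (d : ℕ) (α : ℝ) (φ : ℝ → ℝ) : Prop where
  measurable : Measurable ((Ici (0 : ℝ)).domRestrict φ)
  pos : ∀ a, 0 ≤ a → 0 < φ a
  le_one : ∀ a, 0 ≤ a → φ a ≤ 1
  eq_one : ∀ a ∈ Icc (0 : ℝ) 1, φ a = 1
  comparable : ∃ c₁ : ℝ, 0 < c₁ ∧
    ∀ a b, 0 ≤ a → 0 ≤ b → |a - b| ≤ 1 → φ a ≤ c₁ * φ b
  contDiffOn : ContDiffOn ℝ 2 φ (Ioi 1)
  deriv_bound : ∃ c₂ : ℝ, 0 < c₂ ∧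
    ∀ a, 1 < a → max |deriv φ a| |deriv (deriv φ) a| ≤ c₂ * φ a
  convolution_bound : ∃ c₃ : ℝ, 0 < c₃ ∧ ∀ x y : Rd d, 2 < ‖x - y‖ →
    ∫⁻ z in {z : Rd d | 1 ≤ ‖x - z‖ ∧ 1 ≤ ‖y - z‖},
        ENNReal.ofReal (φ ‖y - z‖ / ‖y - z‖ ^ (α + d))
          * ENNReal.ofReal (φ ‖z - x‖ / ‖z - x‖ ^ (α + d))
      ≤ ENNReal.ofReal (c₃ * (φ ‖y - x‖ / ‖y - x‖ ^ (α + d)))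

/-- The conditions on the jump intensity `f : ℝ^d × ℝ^d → [0,∞]`, with upper constant `M` and
lower constant `c₄`. -/
structure IsJumpKernel (d : ℕ) (α : ℝ) (φ : ℝ → ℝ) (M c₄ : ℝ) (f : Rd d → Rd d → ℝ≥0∞) :
    Prop where
  measurable : Measurable (Function.uncurry f)
  upper : ∀ x y, y ≠ x → f x y ≤ ENNReal.ofReal (M * (φ ‖y - x‖ / ‖y - x‖ ^ (α + d)))
  balanced : (∀ x h, f x (x + h) = f x (x - h)) ∨ α < 1
  symm : ∀ x y, f x y = f y x
  lower : ∀ ε : ℝ, 0 < ε →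
    ENNReal.ofReal (c₄ * ε ^ (-α)) ≤
      ⨅ x : Rd d, ∫⁻ y in {y : Rd d | ε < ‖y - x‖}, f x y / ENNReal.ofReal (φ ‖y - x‖)
  continuousOn : ∀ y, ContinuousOn (fun x => f x y) {y}ᶜ

/-- The integrand `(u(y) - u(x)) f(x,y)`. -/
def jumpIntegrand {d : ℕ} (f : Rd d → Rd d → ℝ≥0∞) (u : C₀(Rd d, ℝ)) (x y : Rd d) : ℝ :=
  (u y - u x) * (f x y).toReal

/-- The graph of the nonlocal operator on `C²_c(ℝ^d)`, as an operator in `C₀(ℝ^d)`: all pairs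
`(u, v)` with `u ∈ C²_c`, `v ∈ C₀` and
`v(x) = lim_{ε ↓ 0} ∫_{|y-x|>ε} (u(y) - u(x)) f(x,y) dy` for every `x`, where the truncated
integrals converge absolutely. -/
def nonlocalGraph {d : ℕ} (f : Rd d → Rd d → ℝ≥0∞) :
    Submodule ℝ (C₀(Rd d, ℝ) × C₀(Rd d, ℝ)) where
  carrier := {w | ContDiff ℝ 2 (w.1 : Rd d → ℝ) ∧ HasCompactSupport (w.1 : Rd d → ℝ) ∧
    ∀ x, (∀ ε : ℝ, 0 < ε → IntegrableOn (jumpIntegrand f w.1 x) {y | ε < ‖y - x‖}) ∧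
      Tendsto (fun ε : ℝ => ∫ y in {y | ε < ‖y - x‖}, jumpIntegrand f w.1 x y)
        (𝓝[>] 0) (𝓝 (w.2 x))}
  zero_mem' := by
    have h0 : ∀ x : Rd d, jumpIntegrand f (0 : C₀(Rd d, ℝ)) x = fun _ => 0 := by
      intro x; funext y; simp [jumpIntegrand]
    refine ⟨?_, ?_, fun x => ⟨fun ε _ => ?_, ?_⟩⟩
    · exact contDiff_const
    · exact HasCompactSupport.zero
    · simp [h0]
    · simp [h0]
  add_mem' := by
    rintro ⟨u, v⟩ ⟨u', v'⟩ ⟨h1, h2, h3⟩ ⟨h1', h2', h3'⟩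
    have hadd : ∀ x : Rd d, jumpIntegrand f (u + u') x
        = jumpIntegrand f u x + jumpIntegrand f u' x := by
      intro x; funext y; simp [jumpIntegrand]; ring
    refine ⟨h1.add h1', h2.add h2', fun x => ⟨fun ε hε => ?_, ?_⟩⟩
    · change IntegrableOn (jumpIntegrand f (u + u') x) _
      rw [hadd]
      exact ((h3 x).1 ε hε).add ((h3' x).1 ε hε)
    · refine ((h3 x).2.add (h3' x).2).congr' ?_
      filter_upwards [self_mem_nhdsWithin] with ε hε
      change _ = ∫ y in _, jumpIntegrand f (u + u') x y
      rw [hadd]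
      exact (integral_add ((h3 x).1 ε hε) ((h3' x).1 ε hε)).symm
  smul_mem' := by
    rintro c ⟨u, v⟩ ⟨h1, h2, h3⟩
    have hsmul : ∀ x : Rd d, jumpIntegrand f (c • u) x = c • jumpIntegrand f u x := by
      intro x; funext y; simp [jumpIntegrand]; ring
    refine ⟨h1.const_smul c, h2.smul_left (f := fun _ => c), fun x => ⟨fun ε hε => ?_, ?_⟩⟩
    · change IntegrableOn (jumpIntegrand f (c • u) x) _
      rw [hsmul]
      exact ((h3 x).1 ε hε).smul c
    · refine ((h3 x).2.const_smul c).congr' ?_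
      filter_upwards [self_mem_nhdsWithin] with ε hε
      change _ = ∫ y in _, jumpIntegrand f (c • u) x y
      rw [hsmul]
      exact (integral_smul c _).symm

/-- The nonlocal operator with jump intensity `f`, as an unbounded operator in `C₀(ℝ^d)`. -/
def nonlocalOp {d : ℕ} (f : Rd d → Rd d → ℝ≥0∞) : C₀(Rd d, ℝ) →ₗ.[ℝ] C₀(Rd d, ℝ) :=
  (nonlocalGraph f).toLinearPMap

theorem nonlocalOp_graph {d : ℕ} (f : Rd d → Rd d → ℝ≥0∞) :
    (nonlocalOp f).graph = nonlocalGraph f := by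
  refine Submodule.toLinearPMap_graph_eq _ ?_
  rintro ⟨u, v⟩ ⟨_, _, h⟩ (rfl : u = 0)
  ext x
  refine tendsto_nhds_unique (h x).2 ?_
  simp [jumpIntegrand]

variable {X : Type*} [NormedAddCommGroup X] [NormedSpace ℝ X]

/-- Strongly continuous contraction semigroups `(P t)_{t ≥ 0}` on a Banach space; the values at
`t < 0` are irrelevant. -/
structure IsContractionSemigroup (P : ℝ → X →L[ℝ] X) : Prop where
  zero : P 0 = ContinuousLinearMap.id ℝ X
  add : ∀ s t, 0 ≤ s → 0 ≤ t → P (s + t) = (P s).comp (P t)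
  contraction : ∀ t, 0 ≤ t → ‖P t‖ ≤ 1
  strongly_continuous : ∀ u, Tendsto (fun t => P t u) (𝓝[>] 0) (𝓝 u)

/-- The graph of the infinitesimal generator: all `(u, v)` with
`v = lim_{t ↓ 0} (P t u - u) / t` in norm. -/
def generatorGraph (P : ℝ → X →L[ℝ] X) : Submodule ℝ (X × X) where
  carrier := {w | Tendsto (fun t : ℝ => t⁻¹ • (P t w.1 - w.1)) (𝓝[>] 0) (𝓝 w.2)}
  zero_mem' := by simp
  add_mem' := by
    rintro ⟨u, v⟩ ⟨u', v'⟩ h h'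
    refine (Tendsto.add h h').congr fun t => ?_
    simp only [Prod.mk_add_mk, map_add, ← smul_add]
    congr 1
    abel
  smul_mem' := by
    rintro c ⟨u, v⟩ h
    refine (Tendsto.const_smul h c).congr fun t => ?_
    simp only [Prod.smul_mk, map_smul, ← smul_sub]
    exact smul_comm _ _ _

/-- The infinitesimal generator of a semigroup, as an unbounded operator. -/
def generator (P : ℝ → X →L[ℝ] X) : X →ₗ.[ℝ] X := (generatorGraph P).toLinearPMap

theorem generator_graph (P : ℝ → X →L[ℝ] X) : (generator P).graph = generatorGraph P := by
  refine Submodule.toLinearPMap_graph_eq _ ?_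
  rintro ⟨u, v⟩ h (rfl : u = 0)
  refine tendsto_nhds_unique h ?_
  simp

/-- The function `min (t^{-d/α}, t φ(r) / r^{α+d})`, where the second entry is `+∞` for `r = 0`. -/
def heatBound (d : ℕ) (α : ℝ) (φ : ℝ → ℝ) (t r : ℝ) : ℝ :=
  if r = 0 then t ^ (-(d : ℝ) / α)
  else min (t ^ (-(d : ℝ) / α)) (t * φ r / r ^ (α + d))

end StableDominated

end

/-!
# Heat kernel bounds for jump processes dominated by isotropic stable processes

The bound rests on positive kernel operators alone. Write `s = t^{1/α}` and let `W s` be a smoothed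
version (`regBound`) of the claimed bound at a small time `t`, regarded as a function of the
difference of the two points. It is comparable to `s^α φ(r) / max(s, r)^{α+d}`; its first and second
differences over steps `h` are controlled by `‖h‖/s` and `(‖h‖/s)²` times `W s` itself; and it is
almost idempotent under convolution, which is where the convolution condition on `φ` enters.

For small `ε` the jumps longer than `ε` have a bounded generator `T - Λ`, with `T` a positive
operator. Split off the jumps longer than `κ s`. The shorter ones act on `W s` as on a constant, up
to a multiple `s^{-α}` of `W s`, by the difference bounds and cancellation of the first order term
(if `α < 1`, none is needed). The lower bound on `f` makes the total rate of the longer ones at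
least any prescribed multiple `b s^{-α}` once `κ` is small. Hence (`exists_superharmonic`) the full
operator maps `W s` to at most `(Λ + D s^{-α}) W s`, while without the long jumps it maps both `W s`
and the constant `1` to at most `Λ - b s^{-α}` times themselves. The long jumps have intensity at
most `D s^{-α} W s`.

Expanding the exponential series at one long jump sandwiches that jump between operators for which
`W s` is superharmonic (`expSum_add_kernel_le`). If the truncated semigroup `S` satisfies
`S_τ u ≤ B (W s * u) + m` at time `τ = t / 2`, then
`S_t u ≤ e^{-b/2} (B (W s * u) + m) + K (W s * u)`, where `K` does not depend on `B` and `m`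
(`expSum_doubling_le`). With `b` large, the constant in front of `W s * u` is reproduced from one
scale to the next and the constant `m` is halved, so that, starting from the trivial bound
`S_t u ≤ ‖u‖` at a tiny time, `n` doublings give `S_t u ≤ K (W s * u) + 2^{-n} ‖u‖`
(`exists_truncated_bound`). Beyond a fixed time, superharmonicity alone yields exponential growth.

All constants are independent of `ε`. As `ε → 0`, the truncated generators converge on `C²_c`, a
core for the generator, so that the truncated semigroups converge strongly (the Trotter–Kato
theorem, `IsContractionSemigroup.tendsto_expSemigroup`); then `n → ∞` removes the last term. The
resulting inequality `P_t u ≤ K (W s * u)` for `u ≥ 0` makes the measures that represent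
`u ↦ P_t u x` absolutely continuous, with densities below the bound (`exists_density`).
-/

noncomputable section

namespace StableDominated

/-! ### Radial integrals -/

lemma lintegral_norm_eq_scale {d : ℕ} (g : ℝ → ℝ≥0∞) {η : ℝ} (hη : 0 < η) :
    ∫⁻ h : Rd d, g ‖h‖ = ENNReal.ofReal (η ^ (d : ℝ)) * ∫⁻ h : Rd d, g (η * ‖h‖) := by
  have h1 : ∫⁻ h : Rd d, g ‖h‖ ∂(Measure.map (fun h : Rd d => η • h) volume)
      = ∫⁻ h : Rd d, g (η * ‖h‖) := by
    have := MeasureTheory.lintegral_map_equiv (μ := (volume : Measure (Rd d)))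
      (fun h : Rd d => g ‖h‖) (Homeomorph.smulOfNeZero η hη.ne').toMeasurableEquiv
    simpa [norm_smul, abs_of_pos hη] using this
  have h2 : Measure.map (fun h : Rd d => η • h) volume
      = ENNReal.ofReal |(η ^ d)⁻¹| • (volume : Measure (Rd d)) := by
    simpa using Measure.map_addHaar_smul (volume : Measure (Rd d)) hη.ne'
  rw [← h1, h2, lintegral_smul_measure, smul_eq_mul, ← mul_assoc,
    ← ENNReal.ofReal_mul (by positivity),
    abs_of_pos (by positivity), Real.rpow_natCast, mul_inv_cancel₀ (by positivity)]
  simp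

lemma lintegral_tail_lt_top {d : ℕ} {α : ℝ} (hα : 0 < α) :
    ∫⁻ h in {h : Rd d | 1 < ‖h‖}, ENNReal.ofReal (1 / ‖h‖ ^ (α + d)) < ∞ := by
  have h1 : Integrable (fun h : Rd d => (2 : ℝ) ^ (α + d) * (1 + ‖h‖) ^ (-(α + d))) :=
    (integrable_one_add_norm (by simp [hα])).const_mul _
  refine lt_of_le_of_lt ?_ h1.lintegral_lt_top
  refine (setLIntegral_mono_ae (by fun_prop) (ae_of_all _ ?_)).trans (setLIntegral_le_lintegral _ _)
  intro h (hh : 1 < ‖h‖)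
  refine ENNReal.ofReal_le_ofReal ?_
  have h0 : 0 < ‖h‖ := by linarith
  rw [Real.rpow_neg (by positivity), ← div_eq_mul_inv,
    div_le_div_iff₀ (by positivity) (by positivity),
    one_mul, ← Real.mul_rpow (by norm_num) (by positivity)]
  exact Real.rpow_le_rpow (by positivity) (by linarith) (by positivity)

lemma lintegral_small_lt_top {d : ℕ} (hd : 1 ≤ d) {α p : ℝ} (hp : α < p) :
    ∫⁻ h in {h : Rd d | ‖h‖ ≤ 1}, ENNReal.ofReal (‖h‖ ^ p / ‖h‖ ^ (α + d)) < ∞ := by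
  have hm : Measurable fun h : Rd d => ‖h‖ ^ p / ‖h‖ ^ (α + d) := by fun_prop
  have h1 : IntegrableOn (fun h : Rd d => ‖h‖ ^ p / ‖h‖ ^ (α + d)) (Metric.ball 0 2) := by
    refine integrableOn_ball_of_norm_le_rpow (C := 1) (α := α + d - p) (by simpa using hd) ?_ ?_
      hm.aestronglyMeasurable
    · simp; linarith
    · refine ae_restrict_of_ae ?_
      have : Nontrivial (Rd d) := by
        have : NeZero d := ⟨by omega⟩
        infer_instance
      have h0 : ∀ᵐ h : Rd d, h ≠ 0 := by simp [ae_iff]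
      filter_upwards [h0] with h hh
      have : 0 < ‖h‖ := norm_pos_iff.2 hh
      rw [Real.norm_of_nonneg (by positivity), one_mul, ← Real.rpow_sub this]
      exact le_of_eq (by congr 1; ring)
  refine lt_of_le_of_lt (lintegral_mono_set ?_) h1.lintegral_lt_top
  intro h (hh : ‖h‖ ≤ 1)
  simp; linarith

/-- Jumps longer than `η` of the isotropic `α`-stable intensity have total rate `O(η^{-α})`. -/
lemma exists_tail_bound {d : ℕ} {α : ℝ} (hα : 0 < α) :
    ∃ C : ℝ, 0 < C ∧ ∀ η : ℝ, 0 < η →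
      ∫⁻ h in {h : Rd d | η < ‖h‖}, ENNReal.ofReal (1 / ‖h‖ ^ (α + d))
        ≤ ENNReal.ofReal (C * η ^ (-α)) := by
  have hfin := lintegral_tail_lt_top (d := d) hα
  set I := ∫⁻ h in {h : Rd d | 1 < ‖h‖}, ENNReal.ofReal (1 / ‖h‖ ^ (α + d)) with hI
  obtain ⟨c, hc0, hc⟩ : ∃ c : ℝ, 0 ≤ c ∧ I = ENNReal.ofReal c :=
    ⟨I.toReal, by positivity, (ENNReal.ofReal_toReal hfin.ne).symm⟩
  refine ⟨c + 1, by positivity, fun η hη => ?_⟩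
  have hS : ∀ η : ℝ, MeasurableSet {h : Rd d | η < ‖h‖} := fun η =>
    measurableSet_lt measurable_const measurable_norm
  have key := lintegral_norm_eq_scale (d := d)
    (fun r => (Ioi η).indicator (fun r => ENNReal.ofReal (1 / r ^ (α + d))) r) hη
  have e1 : ∫⁻ h in {h : Rd d | η < ‖h‖}, ENNReal.ofReal (1 / ‖h‖ ^ (α + d))
      = ∫⁻ h : Rd d, (Ioi η).indicator (fun r => ENNReal.ofReal (1 / r ^ (α + d))) ‖h‖ := by
    rw [← lintegral_indicator (hS η)]
    rfl
  have e2 : ∫⁻ h : Rd d, (Ioi η).indicator (fun r => ENNReal.ofReal (1 / r ^ (α + d))) (η * ‖h‖)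
      = ENNReal.ofReal (η ^ (-(α + d))) * I := by
    rw [hI, ← lintegral_indicator (hS 1), ← lintegral_const_mul' _ _ ENNReal.ofReal_ne_top]
    refine lintegral_congr fun h => ?_
    by_cases hh : 1 < ‖h‖
    · have h1 : η * ‖h‖ ∈ Ioi η := by simp only [mem_Ioi]; nlinarith
      rw [indicator_of_mem h1, indicator_of_mem (by exact hh), ← ENNReal.ofReal_mul (by positivity),
        Real.mul_rpow hη.le (by positivity), Real.rpow_neg hη.le]
      congr 1
      rw [one_div, one_div, mul_inv]
    · have h1 : η * ‖h‖ ∉ Ioi η := by simp only [mem_Ioi, not_lt] at *; nlinarith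
      rw [indicator_of_notMem h1, indicator_of_notMem (by exact hh), mul_zero]
  rw [e1, key, e2, ← mul_assoc, ← ENNReal.ofReal_mul (by positivity), ← Real.rpow_add hη,
    hc, ← ENNReal.ofReal_mul (by positivity)]
  refine ENNReal.ofReal_le_ofReal ?_
  rw [show (d : ℝ) + -(α + d) = -α by ring]
  nlinarith [Real.rpow_pos_of_pos hη (-α)]

/-- For `p > α`, the jumps of length at most `η` of the isotropic `α`-stable intensity have `p`-th
moment `O(η^{p-α})`. -/
lemma exists_small_bound {d : ℕ} (hd : 1 ≤ d) {α p : ℝ} (hp : α < p) :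
    ∃ C : ℝ, 0 < C ∧ ∀ η : ℝ, 0 < η →
      ∫⁻ h in {h : Rd d | ‖h‖ ≤ η}, ENNReal.ofReal (‖h‖ ^ p / ‖h‖ ^ (α + d))
        ≤ ENNReal.ofReal (C * η ^ (p - α)) := by
  have hfin := lintegral_small_lt_top hd hp
  set I := ∫⁻ h in {h : Rd d | ‖h‖ ≤ 1}, ENNReal.ofReal (‖h‖ ^ p / ‖h‖ ^ (α + d)) with hI
  obtain ⟨c, hc0, hc⟩ : ∃ c : ℝ, 0 ≤ c ∧ I = ENNReal.ofReal c :=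
    ⟨I.toReal, by positivity, (ENNReal.ofReal_toReal hfin.ne).symm⟩
  refine ⟨c + 1, by positivity, fun η hη => ?_⟩
  have hS : ∀ η : ℝ, MeasurableSet {h : Rd d | ‖h‖ ≤ η} := fun η =>
    measurableSet_le measurable_norm measurable_const
  have key := lintegral_norm_eq_scale (d := d)
    (fun r => (Iic η).indicator (fun r => ENNReal.ofReal (r ^ p / r ^ (α + d))) r) hη
  have e1 : ∫⁻ h in {h : Rd d | ‖h‖ ≤ η}, ENNReal.ofReal (‖h‖ ^ p / ‖h‖ ^ (α + d))
      = ∫⁻ h : Rd d, (Iic η).indicator (fun r => ENNReal.ofReal (r ^ p / r ^ (α + d))) ‖h‖ := by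
    rw [← lintegral_indicator (hS η)]
    rfl
  have e2 : ∫⁻ h : Rd d, (Iic η).indicator (fun r => ENNReal.ofReal (r ^ p / r ^ (α + d)))
      (η * ‖h‖) = ENNReal.ofReal (η ^ (p - (α + d))) * I := by
    rw [hI, ← lintegral_indicator (hS 1), ← lintegral_const_mul' _ _ ENNReal.ofReal_ne_top]
    refine lintegral_congr fun h => ?_
    by_cases hh : ‖h‖ ≤ 1
    · have h1 : η * ‖h‖ ∈ Iic η := by simp only [mem_Iic]; nlinarith
      rw [indicator_of_mem h1, indicator_of_mem (by exact hh), ← ENNReal.ofReal_mul (by positivity),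
        Real.mul_rpow hη.le (by positivity), Real.mul_rpow hη.le (by positivity), Real.rpow_sub hη]
      congr 1
      rw [mul_div_mul_comm]
    · have h1 : η * ‖h‖ ∉ Iic η := by simp only [mem_Iic, not_le] at *; nlinarith
      rw [indicator_of_notMem h1, indicator_of_notMem (by exact hh), mul_zero]
  rw [e1, key, e2, ← mul_assoc, ← ENNReal.ofReal_mul (by positivity), ← Real.rpow_add hη,
    hc, ← ENNReal.ofReal_mul (by positivity)]
  refine ENNReal.ofReal_le_ofReal ?_
  rw [show (d : ℝ) + (p - (α + d)) = p - α by ring]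
  nlinarith [Real.rpow_pos_of_pos hη (p - α)]

/-! ### Second differences -/

section SecondDifference

variable {V : Type*} [NormedAddCommGroup V] [NormedSpace ℝ V]

/-- First and second differences of a compactly supported `C²` function. -/
lemma exists_difference_bound {u : V → ℝ} (hu : ContDiff ℝ 2 u) (hc : HasCompactSupport u) :
    ∃ K : ℝ, 0 < K ∧ (∀ x h, |u (x + h) - u x| ≤ K * ‖h‖) ∧
      ∀ x h, |u (x + h) + u (x - h) - 2 * u x| ≤ K * ‖h‖ ^ 2 := by
  obtain ⟨K₁, hK₁⟩ := hu.lipschitzWith_of_hasCompactSupport hc (by simp)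
  have hd : ContDiff ℝ 1 (fderiv ℝ u) := hu.fderiv_right (by norm_num)
  obtain ⟨K₂, hK₂⟩ := hd.lipschitzWith_of_hasCompactSupport (hc.fderiv ℝ) (by simp)
  have hdiff : Differentiable ℝ u := hu.differentiable (by simp)
  refine ⟨K₁ + 2 * K₂ + 1, by positivity, fun x h => ?_, fun x h => ?_⟩
  · have := hK₁.dist_le_mul (x + h) x
    rw [Real.dist_eq, dist_eq_norm, add_sub_cancel_left] at this
    refine this.trans ?_
    gcongr
    linarith [K₂.coe_nonneg]
  -- `g τ = u (x + τ h) + u (x - τ h)` has derivative `O(τ ‖h‖²)`, as `fderiv u` is Lipschitz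
  · set g : ℝ → ℝ := fun τ => u (x + τ • h) + u (x - τ • h) with hg
    have hg' : ∀ τ, HasDerivAt g (fderiv ℝ u (x + τ • h) h + -fderiv ℝ u (x - τ • h) h) τ := by
      intro τ
      have l1 : HasDerivAt (fun τ : ℝ => x + τ • h) h τ := by
        simpa using ((hasDerivAt_id τ).smul_const h).const_add x
      have l2 : HasDerivAt (fun τ : ℝ => x - τ • h) (-h) τ := by
        simpa using ((hasDerivAt_id τ).smul_const h).const_sub x
      have d1 := (hdiff (x + τ • h)).hasFDerivAt.comp_hasDerivAt τ l1
      have d2 := (hdiff (x - τ • h)).hasFDerivAt.comp_hasDerivAt τ l2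
      rw [map_neg] at d2
      exact d1.add d2
    have hb : ∀ τ ∈ Icc (0 : ℝ) 1,
        ‖fderiv ℝ u (x + τ • h) h + -fderiv ℝ u (x - τ • h) h‖ ≤ 2 * K₂ * ‖h‖ ^ 2 := by
      intro τ hτ
      have e := hK₂.dist_le_mul (x + τ • h) (x - τ • h)
      rw [dist_eq_norm, dist_eq_norm, show x + τ • h - (x - τ • h) = (2 * τ) • h by
        rw [mul_smul, two_smul]; abel, norm_smul, Real.norm_of_nonneg (by linarith [hτ.1])] at e
      rw [← sub_eq_add_neg, ← sub_apply]
      refine (ContinuousLinearMap.le_opNorm _ _).trans ?_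
      have : ‖fderiv ℝ u (x + τ • h) - fderiv ℝ u (x - τ • h)‖ ≤ K₂ * (2 * ‖h‖) := by
        refine e.trans ?_
        gcongr
        linarith [hτ.2]
      nlinarith [norm_nonneg h]
    have := (convex_Icc (0 : ℝ) 1).norm_image_sub_le_of_norm_hasDerivWithin_le
      (fun τ _ => (hg' τ).hasDerivWithinAt) hb (left_mem_Icc.2 zero_le_one)
      (right_mem_Icc.2 zero_le_one)
    simp only [hg, one_smul, zero_smul, add_zero, sub_zero, norm_one, mul_one] at this
    rw [Real.norm_eq_abs, ← two_mul] at this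
    refine this.trans ?_
    gcongr
    linarith [K₁.coe_nonneg]

end SecondDifference

/-! ### The dominating kernel at scale `s` -/

/-- The bound `min (t^{-d/α}, t φ(r) / r^{α+d})` in terms of the spatial scale `s = t^{1/α} ≤ 1`,
written as `s^α φ(r) / max(s, r)^{α+d}`. -/
def scaledBound (d : ℕ) (α : ℝ) (φ : ℝ → ℝ) (s r : ℝ) : ℝ :=
  s ^ α * φ r / max s r ^ (α + d)

section ScaledBound

variable {d : ℕ} {α : ℝ} {φ : ℝ → ℝ} {s r : ℝ}

lemma scaledBound_pos (hφ : IsProfile d α φ) (hs : 0 < s) (hr : 0 ≤ r) :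
    0 < scaledBound d α φ s r := by
  have := hφ.pos r hr
  have : 0 < max s r := lt_max_of_lt_left hs
  unfold scaledBound
  positivity

lemma IsProfile.measurable_comp_norm (hφ : IsProfile d α φ) {X : Type*} [MeasurableSpace X]
    {g : X → Rd d} (hg : Measurable g) : Measurable fun x => φ ‖g x‖ :=
  hφ.measurable.comp (hg.norm.subtype_mk (h := fun x => norm_nonneg (g x)))

lemma measurable_scaledBound (hφ : IsProfile d α φ) {X : Type*} [MeasurableSpace X]
    {g : X → Rd d} (hg : Measurable g) : Measurable fun x => scaledBound d α φ s ‖g x‖ := by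
  unfold scaledBound
  exact ((hφ.measurable_comp_norm hg).const_mul _).div
    ((measurable_const.max hg.norm).pow_const _)

lemma rpow_max_le {a b c n : ℝ} (ha : 0 < a) (hc : 0 < c) (hn : 0 ≤ n) (h : b ≤ c * a)
    (hb : 0 < b) : 1 / a ^ n ≤ c ^ n * (1 / b ^ n) := by
  rw [mul_one_div, div_le_div_iff₀ (by positivity) (by positivity), one_mul,
    ← Real.mul_rpow hc.le ha.le]
  exact Real.rpow_le_rpow hb.le h hn

lemma exists_scaledBound_comparable (hα : 0 < α) (hφ : IsProfile d α φ) :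
    ∃ C : ℝ, 1 ≤ C ∧ ∀ s, 0 < s → s ≤ 1 → ∀ r r', 0 ≤ r → 0 ≤ r' → |r - r'| ≤ s →
      scaledBound d α φ s r ≤ C * scaledBound d α φ s r' := by
  obtain ⟨c, hc, hcomp⟩ := hφ.comparable
  have hc1 : 1 ≤ c := by
    have := hcomp 0 0 le_rfl le_rfl (by simp)
    nlinarith [hφ.pos 0 le_rfl]
  refine ⟨c * 2 ^ (α + d), ?_, fun s hs hs1 r r' hr hr' h => ?_⟩
  · have : (1 : ℝ) ≤ 2 ^ (α + d) := Real.one_le_rpow (by norm_num) (by positivity)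
    nlinarith
  have h1 := hcomp r r' hr hr' (h.trans hs1)
  have hm : 0 < max s r := lt_max_of_lt_left hs
  have hm' : 0 < max s r' := lt_max_of_lt_left hs
  have h2 : max s r' ≤ 2 * max s r := by
    have := (abs_le.1 h).1
    refine max_le (by linarith [le_max_left s r]) ?_
    linarith [le_max_left s r, le_max_right s r]
  have h3 := rpow_max_le (n := α + d) hm two_pos (by positivity) h2 hm'
  unfold scaledBound
  have hp := hφ.pos r hr
  have hp' := hφ.pos r' hr'
  calc s ^ α * φ r / max s r ^ (α + d) = s ^ α * φ r * (1 / max s r ^ (α + d)) := by ring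
    _ ≤ s ^ α * (c * φ r') * (2 ^ (α + d) * (1 / max s r' ^ (α + d))) := by gcongr
    _ = _ := by ring

/-- The total mass of the dominating kernel is bounded uniformly in the scale. -/
lemma exists_lintegral_scaledBound_le (hα : 0 < α) (hφ : IsProfile d α φ) :
    ∃ C : ℝ, 0 < C ∧ ∀ s, 0 < s → ∀ x : Rd d,
      ∫⁻ z, ENNReal.ofReal (scaledBound d α φ s ‖z - x‖) ≤ ENNReal.ofReal C := by
  have h1 : Integrable (fun h : Rd d => (2 : ℝ) ^ (α + d) * (1 + ‖h‖) ^ (-(α + d))) :=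
    (integrable_one_add_norm (by simp [hα])).const_mul _
  set I := ∫⁻ h : Rd d, ENNReal.ofReal ((2 : ℝ) ^ (α + d) * (1 + ‖h‖) ^ (-(α + d))) with hI
  refine ⟨I.toReal + 1, by positivity, fun s hs x => ?_⟩
  have hfin : I < ∞ := h1.lintegral_lt_top
  have h2 : ∫⁻ z : Rd d, ENNReal.ofReal (scaledBound d α φ s ‖z - x‖) ≤ I := by
    rw [lintegral_sub_right_eq_self (fun z : Rd d => ENNReal.ofReal (scaledBound d α φ s ‖z‖)) x]
    have := lintegral_norm_eq_scale (d := d)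
      (fun r => ENNReal.ofReal (s ^ α * (1 / max s r ^ (α + d)))) hs
    calc ∫⁻ z : Rd d, ENNReal.ofReal (scaledBound d α φ s ‖z‖)
        ≤ ∫⁻ z : Rd d, ENNReal.ofReal (s ^ α * (1 / max s ‖z‖ ^ (α + d))) := by
          refine lintegral_mono fun z => ENNReal.ofReal_le_ofReal ?_
          have := hφ.le_one _ (norm_nonneg z)
          have hm : 0 < max s ‖z‖ := lt_max_of_lt_left hs
          unfold scaledBound
          rw [mul_div_assoc]
          gcongr
      _ = _ := this
      _ = ∫⁻ z : Rd d, ENNReal.ofReal (s ^ (d : ℝ))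
            * ENNReal.ofReal (s ^ α * (1 / max s (s * ‖z‖) ^ (α + d))) := by
          rw [lintegral_const_mul' _ _ ENNReal.ofReal_ne_top]
      _ ≤ I := by
          refine lintegral_mono fun z => ?_
          rw [← ENNReal.ofReal_mul (by positivity)]
          refine ENNReal.ofReal_le_ofReal ?_
          have hm : 0 < max 1 ‖z‖ := lt_max_of_lt_left one_pos
          have e : max s (s * ‖z‖) = s * max 1 ‖z‖ := by
            rw [mul_max_of_nonneg _ _ hs.le, mul_one]
          rw [e, Real.mul_rpow hs.le hm.le, ← mul_assoc, ← Real.rpow_add hs,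
            add_comm (d : ℝ) α, Real.rpow_neg (by positivity)]
          have : 0 < s ^ (α + d) := by positivity
          have h3 := rpow_max_le (n := α + d) (b := 1 + ‖z‖) (c := 2) hm two_pos (by positivity)
            (by linarith [le_max_left 1 ‖z‖, le_max_right 1 ‖z‖]) (by positivity)
          calc s ^ (α + d) * (1 / (s ^ (α + d) * max 1 ‖z‖ ^ (α + d)))
              = 1 / max 1 ‖z‖ ^ (α + d) := by field_simp
            _ ≤ _ := by rw [← one_div]; exact h3
  refine h2.trans ((ENNReal.ofReal_toReal hfin.ne).symm.le.trans ?_)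
  exact ENNReal.ofReal_le_ofReal (by linarith)

/-- The pointwise inequality behind the subconvolution property: two of the three distances in
a triangle control the third, except when both jumps are longer than `1`. -/
lemma exists_scaledBound_mul_le (hα : 0 < α) (hφ : IsProfile d α φ) :
    ∃ C : ℝ, 0 < C ∧ ∀ s, 0 < s → s ≤ 1 → ∀ a b r, 0 ≤ a → 0 ≤ b → 0 ≤ r →
      r ≤ a + b → |a - b| ≤ r → (2 < r → a < 1 ∨ b < 1) →
      scaledBound d α φ s a * scaledBound d α φ s b
        ≤ C * scaledBound d α φ s r * (scaledBound d α φ s a + scaledBound d α φ s b) := by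
  obtain ⟨c, hc, hcomp⟩ := hφ.comparable
  have key : ∃ C : ℝ, 0 < C ∧ ∀ s, 0 < s → s ≤ 1 → ∀ a r, 0 ≤ a → 0 ≤ r →
      r / 2 ≤ a → (2 < r → |a - r| ≤ 1) →
      scaledBound d α φ s a ≤ C * scaledBound d α φ s r := by
    refine ⟨c * 2 ^ (α + d), by positivity, fun s hs hs1 a r ha hr h1 h2 => ?_⟩
    have hp : φ a ≤ c * φ r := by
      by_cases h : 2 < r
      · exact hcomp a r ha hr (h2 h)
      · have h3 := hcomp 1 r zero_le_one hr (abs_le.2 ⟨by linarith, by linarith⟩)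
        rw [hφ.eq_one 1 ⟨zero_le_one, le_rfl⟩] at h3
        exact (hφ.le_one a ha).trans h3
    have hm : 0 < max s a := lt_max_of_lt_left hs
    have hm' : 0 < max s r := lt_max_of_lt_left hs
    have h2 : max s r ≤ 2 * max s a :=
      max_le (by linarith [le_max_left s a]) (by linarith [le_max_right s a])
    have h3 := rpow_max_le (n := α + d) hm two_pos (by positivity) h2 hm'
    have := hφ.pos a ha
    have := hφ.pos r hr
    unfold scaledBound
    calc s ^ α * φ a / max s a ^ (α + d) = s ^ α * φ a * (1 / max s a ^ (α + d)) := by ring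
      _ ≤ s ^ α * (c * φ r) * (2 ^ (α + d) * (1 / max s r ^ (α + d))) := by gcongr
      _ = _ := by ring
  obtain ⟨C, hC, key⟩ := key
  refine ⟨C, hC, fun s hs hs1 a b r ha hb hr h1 h2 h3 => ?_⟩
  have pa := scaledBound_pos hφ hs ha
  have pb := scaledBound_pos hφ hs hb
  have pr := scaledBound_pos hφ hs hr
  obtain ⟨h21, h22⟩ := abs_le.1 h2
  -- For `r ≤ 2` the larger of `a` and `b` qualifies; for `r > 2` one of them is less than `1`, so
  -- the other one is within `1` of `r`.
  have hor : (r / 2 ≤ a ∧ (2 < r → |a - r| ≤ 1)) ∨ (r / 2 ≤ b ∧ (2 < r → |b - r| ≤ 1)) := by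
    by_cases h : 2 < r
    · rcases h3 h with h4 | h4
      · exact Or.inr ⟨by linarith, fun _ => abs_le.2 ⟨by linarith, by linarith⟩⟩
      · exact Or.inl ⟨by linarith, fun _ => abs_le.2 ⟨by linarith, by linarith⟩⟩
    · rcases le_total (r / 2) a with h4 | h4
      · exact Or.inl ⟨h4, fun h5 => absurd h5 h⟩
      · exact Or.inr ⟨by linarith, fun h5 => absurd h5 h⟩
  rcases hor with ⟨h4, h5⟩ | ⟨h4, h5⟩
  · have := key s hs hs1 a r ha hr h4 h5
    have hpos : 0 ≤ C * scaledBound d α φ s r * scaledBound d α φ s a := by positivity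
    nlinarith
  · have := key s hs hs1 b r hb hr h4 h5
    have hpos : 0 ≤ C * scaledBound d α φ s r * scaledBound d α φ s b := by positivity
    nlinarith

/-- The subconvolution property of the dominating kernel, uniformly in the scale. -/
lemma exists_scaledBound_convolution_le (hα : 0 < α) (hφ : IsProfile d α φ) :
    ∃ C : ℝ, 0 < C ∧ ∀ s, 0 < s → s ≤ 1 → ∀ x y : Rd d,
      ∫⁻ z, ENNReal.ofReal (scaledBound d α φ s ‖z - x‖)
          * ENNReal.ofReal (scaledBound d α φ s ‖z - y‖)
        ≤ ENNReal.ofReal (C * scaledBound d α φ s ‖x - y‖) := by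
  obtain ⟨C₁, hC₁, h1⟩ := exists_scaledBound_mul_le hα hφ
  obtain ⟨C₂, hC₂, h2⟩ := exists_lintegral_scaledBound_le hα hφ
  obtain ⟨C₃, hC₃, h3⟩ := hφ.convolution_bound
  refine ⟨C₁ * (C₂ + C₂) + C₃, by positivity, fun s hs hs1 x y => ?_⟩
  set G := scaledBound d α φ s with hG
  have pos : ∀ z : Rd d, 0 ≤ G ‖z‖ := fun z => (scaledBound_pos hφ hs (norm_nonneg z)).le
  have mG : ∀ x : Rd d, Measurable fun z => ENNReal.ofReal (G ‖z - x‖) := fun x =>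
    (measurable_scaledBound hφ (measurable_id.sub_const x)).ennreal_ofReal
  -- On `F` the condition on `φ` applies, elsewhere the pointwise inequality does.
  set F : Set (Rd d) := {z | 2 < ‖x - y‖ ∧ 1 ≤ ‖x - z‖ ∧ 1 ≤ ‖y - z‖} with hF
  have mF : MeasurableSet F := by
    refine MeasurableSet.inter (MeasurableSet.const _) (MeasurableSet.inter ?_ ?_)
    · exact measurableSet_le measurable_const (measurable_const.sub measurable_id).norm
    · exact measurableSet_le measurable_const (measurable_const.sub measurable_id).norm
  have near : ∫⁻ z in Fᶜ, ENNReal.ofReal (G ‖z - x‖) * ENNReal.ofReal (G ‖z - y‖)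
      ≤ ENNReal.ofReal (C₁ * (C₂ + C₂) * G ‖x - y‖) := by
    calc ∫⁻ z in Fᶜ, ENNReal.ofReal (G ‖z - x‖) * ENNReal.ofReal (G ‖z - y‖)
        ≤ ∫⁻ z in Fᶜ, ENNReal.ofReal (C₁ * G ‖x - y‖)
            * (ENNReal.ofReal (G ‖z - x‖) + ENNReal.ofReal (G ‖z - y‖)) := by
          refine setLIntegral_mono_ae' mF.compl (ae_of_all _ fun z hz => ?_)
          rw [← ENNReal.ofReal_mul (pos _), ← ENNReal.ofReal_add (pos _) (pos _),
            ← ENNReal.ofReal_mul (by have := pos (x - y); positivity)]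
          refine ENNReal.ofReal_le_ofReal (h1 s hs hs1 _ _ _ (norm_nonneg _) (norm_nonneg _)
            (norm_nonneg _) ?_ ?_ fun h => ?_)
          · calc ‖x - y‖ = ‖(z - y) - (z - x)‖ := by congr 1; abel
              _ ≤ _ := by rw [add_comm]; exact norm_sub_le _ _
          · calc |‖z - x‖ - ‖z - y‖| ≤ ‖(z - x) - (z - y)‖ := abs_norm_sub_norm_le _ _
              _ = ‖x - y‖ := by rw [norm_sub_rev]; congr 1; abel
          · by_contra! hcon
            exact hz ⟨h, by rw [norm_sub_rev]; exact hcon.1, by rw [norm_sub_rev]; exact hcon.2⟩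
      _ ≤ ∫⁻ z, ENNReal.ofReal (C₁ * G ‖x - y‖)
            * (ENNReal.ofReal (G ‖z - x‖) + ENNReal.ofReal (G ‖z - y‖)) :=
          setLIntegral_le_lintegral _ _
      _ ≤ ENNReal.ofReal (C₁ * G ‖x - y‖) * (ENNReal.ofReal C₂ + ENNReal.ofReal C₂) := by
          rw [lintegral_const_mul' _ _ ENNReal.ofReal_ne_top, lintegral_add_left (mG x)]
          gcongr
          · exact h2 s hs x
          · exact h2 s hs y
      _ = ENNReal.ofReal (C₁ * (C₂ + C₂) * G ‖x - y‖) := by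
          rw [← ENNReal.ofReal_add hC₂.le hC₂.le,
            ← ENNReal.ofReal_mul (by have := pos (x - y); positivity)]
          congr 1; ring
  have far : ∫⁻ z in F, ENNReal.ofReal (G ‖z - x‖) * ENNReal.ofReal (G ‖z - y‖)
      ≤ ENNReal.ofReal (C₃ * G ‖x - y‖) := by
    by_cases h : 2 < ‖x - y‖
    -- For lengths at least `1` the kernel is `s^α` times the one in the condition on `φ`; one of the
    -- two factors `s^α ≤ 1` in the product can be dropped.
    · have hsα : s ^ α ≤ 1 := Real.rpow_le_one hs.le hs1 hα.le
      have hsα0 : 0 < s ^ α := by positivity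
      have hbig : ∀ r, 1 ≤ r → G r = s ^ α * (φ r / r ^ (α + d)) := by
        intro r hr
        rw [hG, scaledBound, max_eq_right (hs1.trans hr), mul_div_assoc]
      have e1 : F = {z | 1 ≤ ‖x - z‖ ∧ 1 ≤ ‖y - z‖} := by
        ext z; simp [hF, h]
      have mF' := mF
      rw [e1] at mF' ⊢
      calc ∫⁻ z in {z | 1 ≤ ‖x - z‖ ∧ 1 ≤ ‖y - z‖},
            ENNReal.ofReal (G ‖z - x‖) * ENNReal.ofReal (G ‖z - y‖)
          ≤ ∫⁻ z in {z | 1 ≤ ‖x - z‖ ∧ 1 ≤ ‖y - z‖}, ENNReal.ofReal (s ^ α) *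
            (ENNReal.ofReal (φ ‖y - z‖ / ‖y - z‖ ^ (α + d))
              * ENNReal.ofReal (φ ‖z - x‖ / ‖z - x‖ ^ (α + d))) := by
            refine setLIntegral_mono_ae' mF' (ae_of_all _ fun z hz => ?_)
            rw [norm_sub_rev z y, hbig _ hz.2, hbig _ (by rw [norm_sub_rev]; exact hz.1),
              ENNReal.ofReal_mul hsα0.le, ENNReal.ofReal_mul hsα0.le, mul_comm (_ * _), mul_assoc]
            gcongr
            exact mul_le_of_le_one_left zero_le (by simpa using hsα)
        _ ≤ ENNReal.ofReal (s ^ α) * ENNReal.ofReal (C₃ * (φ ‖y - x‖ / ‖y - x‖ ^ (α + d))) := by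
            rw [lintegral_const_mul' _ _ ENNReal.ofReal_ne_top]
            gcongr
            exact h3 x y h
        _ = _ := by
            rw [← ENNReal.ofReal_mul hsα0.le, norm_sub_rev x y,
              hbig _ (by rw [norm_sub_rev]; linarith)]
            congr 1; ring
    · have e1 : F = ∅ := by ext z; simp [hF, h]
      rw [e1]; simp
  rw [← lintegral_add_compl _ mF]
  calc _ ≤ ENNReal.ofReal (C₃ * G ‖x - y‖) + ENNReal.ofReal (C₁ * (C₂ + C₂) * G ‖x - y‖) :=
        add_le_add far near
    _ = _ := by
        have := pos (x - y)
        rw [← ENNReal.ofReal_add (by positivity) (by positivity)]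
        congr 1; ring

end ScaledBound

/-! ### A regular version of the dominating kernel -/

section Regularization

variable {d : ℕ} {α : ℝ} {φ : ℝ → ℝ} {s : ℝ}

/-- The smooth bump used to regularize the dominating kernel: supported in the ball of radius
`1/2` and equal to `1` on the ball of radius `1/4`. -/
def mollifier (d : ℕ) : ContDiffBump (0 : Rd d) where
  rIn := 1 / 4
  rOut := 1 / 2
  rIn_pos := by norm_num
  rIn_lt_rOut := by norm_num

/-- The average of the dominating kernel at scale `s` over balls of radius comparable to `s`. It is
comparable to the kernel itself, and its differences over a step `h` are controlled by `‖h‖ / s`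
times its value. -/
def regBound (d : ℕ) (α : ℝ) (φ : ℝ → ℝ) (s : ℝ) (x : Rd d) : ℝ≥0∞ :=
  ∫⁻ z, ENNReal.ofReal (scaledBound d α φ s ‖z‖)
    * ENNReal.ofReal (s ^ (-(d : ℝ)) * mollifier d (s⁻¹ • (x - z)))

lemma measurable_regBound (hφ : IsProfile d α φ) : Measurable (regBound d α φ s) := by
  refine Measurable.lintegral_prod_right' (f := fun p : Rd d × Rd d =>
    ENNReal.ofReal (scaledBound d α φ s ‖p.2‖)
      * ENNReal.ofReal (s ^ (-(d : ℝ)) * mollifier d (s⁻¹ • (p.1 - p.2)))) ?_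
  refine (measurable_scaledBound hφ measurable_snd).ennreal_ofReal.mul
    (Measurable.ennreal_ofReal (Measurable.const_mul ?_ _))
  exact (mollifier d).continuous.measurable.comp
    ((measurable_fst.sub measurable_snd).const_smul s⁻¹)

lemma regBound_neg (x : Rd d) : regBound d α φ s (-x) = regBound d α φ s x := by
  unfold regBound
  rw [← lintegral_neg_eq_self]
  refine lintegral_congr fun z => ?_
  rw [norm_neg, show s⁻¹ • (-x - -z) = -(s⁻¹ • (x - z)) by rw [← smul_neg]; congr 1; abel,
    (mollifier d).neg]

lemma volume_closedBall_mul (hs : 0 < s) (c : ℝ) (hc : 0 < c) (x : Rd d) :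
    ENNReal.ofReal (s ^ (-(d : ℝ))) * volume (Metric.closedBall x (c * s))
      = ENNReal.ofReal (c ^ (d : ℝ)) * volume (Metric.ball (0 : Rd d) 1) := by
  rw [Measure.addHaar_closedBall _ _ (by positivity), ← mul_assoc,
    ← ENNReal.ofReal_mul (by positivity)]
  congr 2
  rw [finrank_euclideanSpace, Fintype.card_fin, mul_pow, Real.rpow_neg hs.le, Real.rpow_natCast,
    Real.rpow_natCast]
  field_simp

lemma exists_scaledBound_average_le (hα : 0 < α) (hφ : IsProfile d α φ) :
    ∃ C : ℝ, 0 < C ∧ ∀ s, 0 < s → s ≤ 1 → ∀ x : Rd d,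
      ∫⁻ z in Metric.closedBall x s,
          ENNReal.ofReal (scaledBound d α φ s ‖z‖) * ENNReal.ofReal (s ^ (-(d : ℝ)))
        ≤ ENNReal.ofReal (C * scaledBound d α φ s ‖x‖) := by
  obtain ⟨C, hC, h⟩ := exists_scaledBound_comparable hα hφ
  set v := (volume (Metric.ball (0 : Rd d) 1)).toReal with hv
  have hv' : volume (Metric.ball (0 : Rd d) 1) = ENNReal.ofReal v :=
    (ENNReal.ofReal_toReal measure_ball_lt_top.ne).symm
  have hv0 : 0 < v := ENNReal.toReal_pos (Metric.measure_ball_pos _ _ one_pos).ne'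
    measure_ball_lt_top.ne
  refine ⟨v * C, by positivity, fun s hs hs1 x => ?_⟩
  have hx := scaledBound_pos hφ hs (norm_nonneg x)
  calc ∫⁻ z in Metric.closedBall x s,
          ENNReal.ofReal (scaledBound d α φ s ‖z‖) * ENNReal.ofReal (s ^ (-(d : ℝ)))
      ≤ ∫⁻ z in Metric.closedBall x s, ENNReal.ofReal (C * scaledBound d α φ s ‖x‖)
          * ENNReal.ofReal (s ^ (-(d : ℝ))) := by
        refine setLIntegral_mono_ae' measurableSet_closedBall (ae_of_all _ fun z hz => ?_)
        gcongr
        refine h s hs hs1 _ _ (norm_nonneg _) (norm_nonneg _) ?_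
        exact (abs_norm_sub_norm_le _ _).trans (by simpa [dist_eq_norm] using hz)
    _ = ENNReal.ofReal (C * scaledBound d α φ s ‖x‖) * (ENNReal.ofReal (s ^ (-(d : ℝ)))
          * volume (Metric.closedBall x (1 * s))) := by
        rw [setLIntegral_const, mul_assoc, one_mul]
    _ = ENNReal.ofReal (v * C * scaledBound d α φ s ‖x‖) := by
        rw [volume_closedBall_mul hs 1 one_pos, hv', ← ENNReal.ofReal_mul (by positivity),
          ← ENNReal.ofReal_mul (by positivity)]
        congr 1
        rw [Real.one_rpow]
        ring

lemma norm_le_of_mollifier_ne_zero {a : Rd d} (h : mollifier d a ≠ 0) : ‖a‖ < 1 / 2 := by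
  have : a ∈ Function.support (mollifier d) := h
  rw [(mollifier d).support_eq] at this
  simpa [mollifier] using this

lemma norm_inv_smul_le {a : Rd d} {c : ℝ} (hs : 0 < s) : ‖s⁻¹ • a‖ ≤ c ↔ ‖a‖ ≤ c * s := by
  rw [norm_smul, norm_inv, Real.norm_of_nonneg hs.le, inv_mul_le_iff₀ hs, mul_comm]

lemma exists_regBound_le (hα : 0 < α) (hφ : IsProfile d α φ) :
    ∃ C : ℝ, 0 < C ∧ ∀ s, 0 < s → s ≤ 1 → ∀ x : Rd d,
      regBound d α φ s x ≤ ENNReal.ofReal (C * scaledBound d α φ s ‖x‖) := by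
  obtain ⟨C, hC, h⟩ := exists_scaledBound_average_le hα hφ
  refine ⟨C, hC, fun s hs hs1 x => le_trans ?_ (h s hs hs1 x)⟩
  rw [regBound, ← lintegral_indicator measurableSet_closedBall]
  refine lintegral_mono fun z => ?_
  by_cases hz : mollifier d (s⁻¹ • (x - z)) = 0
  · simp [hz]
  · have hz' : z ∈ Metric.closedBall x s := by
      have := (norm_inv_smul_le hs).1 (norm_le_of_mollifier_ne_zero hz).le
      rw [Metric.mem_closedBall, dist_eq_norm, norm_sub_rev]
      linarith
    rw [indicator_of_mem hz']
    gcongr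
    exact mul_le_of_le_one_right (by positivity) (mollifier d).le_one

lemma exists_le_regBound (hα : 0 < α) (hφ : IsProfile d α φ) :
    ∃ C : ℝ, 0 < C ∧ ∀ s, 0 < s → s ≤ 1 → ∀ x : Rd d,
      ENNReal.ofReal (scaledBound d α φ s ‖x‖) ≤ ENNReal.ofReal C * regBound d α φ s x := by
  obtain ⟨C, hC, h⟩ := exists_scaledBound_comparable hα hφ
  have hC0 : 0 < C := by linarith
  set v := (volume (Metric.ball (0 : Rd d) 1)).toReal with hv
  have hv' : volume (Metric.ball (0 : Rd d) 1) = ENNReal.ofReal v :=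
    (ENNReal.ofReal_toReal measure_ball_lt_top.ne).symm
  have hv0 : 0 < v := ENNReal.toReal_pos (Metric.measure_ball_pos _ _ one_pos).ne'
    measure_ball_lt_top.ne
  set w : ℝ := (1 / 4 : ℝ) ^ (d : ℝ) * v with hw
  have hw0 : 0 < w := by positivity
  refine ⟨C * w⁻¹, by positivity, fun s hs hs1 x => ?_⟩
  have hx := scaledBound_pos hφ hs (norm_nonneg x)
  have hsd : 0 < s ^ (-(d : ℝ)) := by positivity
  have key : ENNReal.ofReal (C⁻¹ * scaledBound d α φ s ‖x‖) * ENNReal.ofReal w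
      ≤ regBound d α φ s x := by
    calc ENNReal.ofReal (C⁻¹ * scaledBound d α φ s ‖x‖) * ENNReal.ofReal w
        = ∫⁻ z in Metric.closedBall x (1 / 4 * s), ENNReal.ofReal (C⁻¹ * scaledBound d α φ s ‖x‖)
          * ENNReal.ofReal (s ^ (-(d : ℝ))) := by
          rw [setLIntegral_const, mul_assoc, volume_closedBall_mul hs _ (by norm_num), hv',
            ← ENNReal.ofReal_mul (p := (1 / 4 : ℝ) ^ (d : ℝ)) (by positivity)]
      _ ≤ ∫⁻ z in Metric.closedBall x (1 / 4 * s), ENNReal.ofReal (scaledBound d α φ s ‖z‖)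
          * ENNReal.ofReal (s ^ (-(d : ℝ)) * mollifier d (s⁻¹ • (x - z))) := by
          refine setLIntegral_mono_ae' measurableSet_closedBall (ae_of_all _ fun z hz => ?_)
          have hz1 : ‖x - z‖ ≤ 1 / 4 * s := by
            rwa [Metric.mem_closedBall, dist_eq_norm, norm_sub_rev] at hz
          have hz2 : s⁻¹ • (x - z) ∈ Metric.closedBall (0 : Rd d) (mollifier d).rIn := by
            rw [Metric.mem_closedBall, dist_zero_right]
            exact (norm_inv_smul_le hs).2 hz1
          rw [(mollifier d).one_of_mem_closedBall hz2, mul_one]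
          gcongr
          rw [inv_mul_le_iff₀ hC0]
          refine h s hs hs1 _ _ (norm_nonneg _) (norm_nonneg _) ?_
          exact (abs_norm_sub_norm_le _ _).trans (by linarith)
      _ ≤ _ := setLIntegral_le_lintegral _ _
  calc ENNReal.ofReal (scaledBound d α φ s ‖x‖)
      = ENNReal.ofReal (C * w⁻¹)
        * (ENNReal.ofReal (C⁻¹ * scaledBound d α φ s ‖x‖) * ENNReal.ofReal w) := by
        rw [← ENNReal.ofReal_mul (by positivity), ← ENNReal.ofReal_mul (by positivity)]
        congr 1
        field_simp
    _ ≤ _ := by gcongr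

/-- Integrating a pointwise inequality for translates of the mollifier gives the corresponding
inequality for the regularized kernel. -/
lemma exists_regBound_difference (hα : 0 < α) (hφ : IsProfile d α φ) :
    ∃ K : ℝ, 0 < K ∧ ∀ s, 0 < s → s ≤ 1 → ∀ x h : Rd d, ‖h‖ ≤ 1 / 2 * s →
      regBound d α φ s (x + h) + regBound d α φ s (x - h)
          ≤ 2 * regBound d α φ s x + ENNReal.ofReal (K * (‖h‖ / s) ^ 2) * regBound d α φ s x ∧
      regBound d α φ s (x + h)
          ≤ regBound d α φ s x + ENNReal.ofReal (K * (‖h‖ / s)) * regBound d α φ s x := by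
  obtain ⟨C₁, hC₁, h1⟩ := exists_scaledBound_average_le hα hφ
  obtain ⟨C₂, hC₂, h2⟩ := exists_le_regBound hα hφ
  obtain ⟨K, hK, hK1, hK2⟩ := exists_difference_bound
    ((mollifier d).contDiff (n := 2)) (mollifier d).hasCompactSupport
  refine ⟨K * C₁ * C₂, by positivity, fun s hs hs1 x h hh => ?_⟩
  set G : Rd d → ℝ≥0∞ := fun z => ENNReal.ofReal (scaledBound d α φ s ‖z‖) with hG
  set ρ : Rd d → ℝ := fun a => mollifier d a with hρ
  have ρ0 : ∀ a, 0 ≤ ρ a := fun a => (mollifier d).nonneg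
  have mG : Measurable G := (measurable_scaledBound hφ measurable_id).ennreal_ofReal
  have hsd : 0 < s ^ (-(d : ℝ)) := by positivity
  have mρ : ∀ y : Rd d, Measurable fun z => G z
      * ENNReal.ofReal (s ^ (-(d : ℝ)) * ρ (s⁻¹ • (y - z))) := fun y =>
    mG.mul (Measurable.ennreal_ofReal (Measurable.const_mul
      ((mollifier d).continuous.measurable.comp
      ((measurable_const.sub measurable_id).const_smul s⁻¹)) _))
  -- Far from the support both sides vanish, so the error may be localized to a ball of radius `s`.
  have err : ∀ c : ℝ, 0 ≤ c → ∫⁻ z in Metric.closedBall x s,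
      G z * ENNReal.ofReal (s ^ (-(d : ℝ)) * (K * c))
        ≤ ENNReal.ofReal (K * C₁ * C₂ * c) * regBound d α φ s x := by
    intro c hc
    calc ∫⁻ z in Metric.closedBall x s, G z * ENNReal.ofReal (s ^ (-(d : ℝ)) * (K * c))
        = ENNReal.ofReal (K * c) * ∫⁻ z in Metric.closedBall x s,
            G z * ENNReal.ofReal (s ^ (-(d : ℝ))) := by
          rw [← lintegral_const_mul' _ _ ENNReal.ofReal_ne_top]
          refine lintegral_congr fun z => ?_
          rw [ENNReal.ofReal_mul hsd.le]
          ring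
      _ ≤ ENNReal.ofReal (K * c)
            * (ENNReal.ofReal C₁ * (ENNReal.ofReal C₂ * regBound d α φ s x)) := by
          gcongr
          refine (h1 s hs hs1 x).trans ?_
          rw [ENNReal.ofReal_mul hC₁.le]
          gcongr
          exact h2 s hs hs1 x
      _ = _ := by
          rw [← mul_assoc, ← mul_assoc, ← ENNReal.ofReal_mul (by positivity),
            ← ENNReal.ofReal_mul (by positivity)]
          congr 2
          ring
  have e1 : ∀ z : Rd d, s⁻¹ • (x + h - z) = s⁻¹ • (x - z) + s⁻¹ • h := fun z => by
    rw [← smul_add]; congr 1; abel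
  have e2 : ∀ z : Rd d, s⁻¹ • (x - h - z) = s⁻¹ • (x - z) - s⁻¹ • h := fun z => by
    rw [← smul_sub]; congr 1; abel
  have hn : ‖s⁻¹ • h‖ = ‖h‖ / s := by
    rw [norm_smul, norm_inv, Real.norm_of_nonneg hs.le, inv_mul_eq_div]
  have hn2 : ‖s⁻¹ • h‖ ≤ 1 / 2 := (norm_inv_smul_le hs).2 hh
  have far : ∀ z, z ∉ Metric.closedBall x s → ρ (s⁻¹ • (x - z) + s⁻¹ • h) = 0 ∧
      ρ (s⁻¹ • (x - z) - s⁻¹ • h) = 0 := by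
    intro z hz
    have hz1 : ¬ ‖s⁻¹ • (x - z)‖ ≤ 1 := by
      rw [norm_inv_smul_le hs, one_mul, norm_sub_rev, ← dist_eq_norm]
      exact hz
    constructor
    · by_contra hcon
      have := norm_le_of_mollifier_ne_zero hcon
      have h3 := norm_sub_le (s⁻¹ • (x - z) + s⁻¹ • h) (s⁻¹ • h)
      rw [add_sub_cancel_right] at h3
      linarith
    · by_contra hcon
      have := norm_le_of_mollifier_ne_zero hcon
      have h3 := norm_add_le (s⁻¹ • (x - z) - s⁻¹ • h) (s⁻¹ • h)
      rw [sub_add_cancel] at h3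
      linarith
  have q0 : 0 ≤ ‖h‖ / s := by positivity
  have hreg : ∀ y, regBound d α φ s y
      = ∫⁻ z, G z * ENNReal.ofReal (s ^ (-(d : ℝ)) * ρ (s⁻¹ • (y - z))) := fun y => rfl
  constructor
  · refine le_trans ?_ (add_le_add_right (err ((‖h‖ / s) ^ 2) (by positivity)) _)
    rw [← lintegral_indicator measurableSet_closedBall]
    simp only [hreg]
    have m2 : Measurable fun z => G z * ENNReal.ofReal (s ^ (-(d : ℝ)) * ρ (s⁻¹ • (x - z)))
        + G z * ENNReal.ofReal (s ^ (-(d : ℝ)) * ρ (s⁻¹ • (x - z))) := (mρ _).add (mρ _)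
    rw [← lintegral_add_left (mρ _), two_mul, ← lintegral_add_left (mρ _),
      ← lintegral_add_left m2]
    refine lintegral_mono fun z => ?_
    simp only []
    rw [e1, e2]
    by_cases hz : z ∈ Metric.closedBall x s
    · rw [indicator_of_mem hz, ← mul_add, ← mul_add, ← mul_add]
      refine mul_le_mul' le_rfl ?_
      have p0 := ρ0 (s⁻¹ • (x - z))
      have p1 := ρ0 (s⁻¹ • (x - z) + s⁻¹ • h)
      have p2 := ρ0 (s⁻¹ • (x - z) - s⁻¹ • h)
      rw [← ENNReal.ofReal_add (by positivity) (by positivity),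
        ← ENNReal.ofReal_add (by positivity) (by positivity),
        ← ENNReal.ofReal_add (by positivity) (by positivity)]
      refine ENNReal.ofReal_le_ofReal ?_
      rw [← mul_add, ← mul_add, ← mul_add]
      refine mul_le_mul_of_nonneg_left ?_ hsd.le
      have := (abs_le.1 (hK2 (s⁻¹ • (x - z)) (s⁻¹ • h))).2
      rw [hn] at this
      linarith
    · obtain ⟨f1, f2⟩ := far z hz
      simp [f1, f2]
  · refine le_trans ?_ (add_le_add_right (err (‖h‖ / s) (by positivity)) _)
    rw [← lintegral_indicator measurableSet_closedBall]
    simp only [hreg]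
    rw [← lintegral_add_left (mρ _)]
    refine lintegral_mono fun z => ?_
    simp only []
    rw [e1]
    by_cases hz : z ∈ Metric.closedBall x s
    · rw [indicator_of_mem hz, ← mul_add]
      refine mul_le_mul' le_rfl ?_
      have p0 := ρ0 (s⁻¹ • (x - z))
      rw [← ENNReal.ofReal_add (by positivity) (by positivity)]
      refine ENNReal.ofReal_le_ofReal ?_
      rw [← mul_add]
      refine mul_le_mul_of_nonneg_left ?_ hsd.le
      have := (abs_le.1 (hK1 (s⁻¹ • (x - z)) (s⁻¹ • h))).2
      rw [hn] at this
      linarith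
    · obtain ⟨f1, f2⟩ := far z hz
      simp only [f1, mul_zero, ENNReal.ofReal_zero, zero_le]

end Regularization

/-! ### Positive kernel operators -/

section KernelOperator

variable {X : Type*} [MeasurableSpace X] {μ : Measure X}

/-- The positive operator `u ↦ ∫ k(·,y) u(y) μ(dy) + a u` on functions with values in `[0,∞]`. -/
def kernelOp (μ : Measure X) (k : X → X → ℝ≥0∞) (a : X → ℝ≥0∞) (u : X → ℝ≥0∞) (x : X) : ℝ≥0∞ :=
  ∫⁻ y, k x y * u y ∂μ + a x * u x

variable {k j W : X → X → ℝ≥0∞} {a u v : X → ℝ≥0∞} {c : ℝ≥0∞}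

lemma kernelOp_mono (h : ∀ x, u x ≤ v x) (x : X) :
    kernelOp μ k a u x ≤ kernelOp μ k a v x := by
  unfold kernelOp
  gcongr with y
  · exact h y
  · exact h x

lemma measurable_kernelOp [SFinite μ] (hk : Measurable (Function.uncurry k)) (ha : Measurable a)
    (hu : Measurable u) : Measurable (kernelOp μ k a u) := by
  refine Measurable.add ?_ (ha.fun_mul hu)
  exact Measurable.lintegral_prod_right' (f := fun p : X × X => k p.1 p.2 * u p.2)
    (hk.fun_mul (hu.comp measurable_snd))

lemma measurable_iterate_kernelOp [SFinite μ] (hk : Measurable (Function.uncurry k))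
    (ha : Measurable a) (hu : Measurable u) (n : ℕ) : Measurable ((kernelOp μ k a)^[n] u) := by
  induction n with
  | zero => simpa using hu
  | succ n ih => rw [Function.iterate_succ_apply']; exact measurable_kernelOp hk ha ih

lemma kernelOp_add (hk : Measurable (Function.uncurry k)) (hu : Measurable u) (x : X) :
    kernelOp μ k a (fun y => u y + v y) x = kernelOp μ k a u x + kernelOp μ k a v x := by
  unfold kernelOp
  simp only [mul_add]
  rw [lintegral_add_left ((hk.of_uncurry_left (x := x)).fun_mul hu)]
  ring

lemma kernelOp_const_mul (hk : Measurable (Function.uncurry k)) (hu : Measurable u) (x : X) :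
    kernelOp μ k a (fun y => c * u y) x = c * kernelOp μ k a u x := by
  unfold kernelOp
  rw [mul_add, ← lintegral_const_mul c ((hk.of_uncurry_left (x := x)).fun_mul hu)]
  congr 1
  · exact lintegral_congr fun y => by ring
  · ring

lemma kernelOp_add_kernel (hk : Measurable (Function.uncurry k)) (hu : Measurable u) (x : X) :
    kernelOp μ (fun x y => k x y + j x y) a u x
      = kernelOp μ k a u x + ∫⁻ y, j x y * u y ∂μ := by
  unfold kernelOp
  simp only [add_mul]
  rw [lintegral_add_left ((hk.of_uncurry_left (x := x)).fun_mul hu)]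
  ring

lemma iterate_kernelOp_mono (h : ∀ x, u x ≤ v x) (n : ℕ) (x : X) :
    (kernelOp μ k a)^[n] u x ≤ (kernelOp μ k a)^[n] v x := by
  induction n generalizing x with
  | zero => simpa using h x
  | succ n ih => rw [Function.iterate_succ_apply', Function.iterate_succ_apply']
                 exact kernelOp_mono ih x

lemma iterate_kernelOp_le (hk : Measurable (Function.uncurry k)) (hu : Measurable u)
    (h : ∀ x, kernelOp μ k a u x ≤ c * u x) (n : ℕ) (x : X) :
    (kernelOp μ k a)^[n] u x ≤ c ^ n * u x := by
  induction n generalizing x with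
  | zero => simp
  | succ n ih =>
    rw [Function.iterate_succ_apply']
    calc _ ≤ kernelOp μ k a (fun y => c ^ n * u y) x := kernelOp_mono ih x
      _ = c ^ n * kernelOp μ k a u x := kernelOp_const_mul hk hu x
      _ ≤ c ^ n * (c * u x) := by gcongr; exact h x
      _ = _ := by ring

/-- If every column of `W` is `c`-superharmonic for an operator, so is the function `W v`. -/
lemma kernelOp_potential_le [SFinite μ] (hk : Measurable (Function.uncurry k))
    (hW : Measurable (Function.uncurry W)) (hv : Measurable v)
    (h : ∀ x y, kernelOp μ k a (fun z => W z y) x ≤ c * W x y) (x : X) :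
    kernelOp μ k a (fun z => ∫⁻ y, W z y * v y ∂μ) x ≤ c * ∫⁻ y, W x y * v y ∂μ := by
  have hWx : ∀ x, Measurable fun y => W x y := fun x => hW.comp measurable_prodMk_left
  have hWy : ∀ y, Measurable fun x => W x y := fun y => hW.comp measurable_prodMk_right
  have hkx : ∀ x, Measurable fun y => k x y := fun x => hk.comp measurable_prodMk_left
  have e : kernelOp μ k a (fun z => ∫⁻ y, W z y * v y ∂μ) x
      = ∫⁻ y, kernelOp μ k a (fun z => W z y) x * v y ∂μ := by
    unfold kernelOp
    simp only [add_mul]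
    have m1 : Measurable fun p : X × X => k x p.1 * (W p.1 p.2 * v p.2) :=
      ((hkx x).comp measurable_fst).fun_mul (hW.fun_mul (hv.comp measurable_snd))
    rw [lintegral_add_right _ (((hWx x).const_mul _).fun_mul hv)]
    congr 1
    · calc ∫⁻ z, k x z * ∫⁻ y, W z y * v y ∂μ ∂μ
          = ∫⁻ z, ∫⁻ y, k x z * (W z y * v y) ∂μ ∂μ :=
            lintegral_congr fun z => (lintegral_const_mul _ ((hWx z).fun_mul hv)).symm
        _ = ∫⁻ y, ∫⁻ z, k x z * (W z y * v y) ∂μ ∂μ :=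
            lintegral_lintegral_swap m1.aemeasurable
        _ = _ := lintegral_congr fun y => by
            rw [← lintegral_mul_const _ ((hkx x).fun_mul (hWy y))]
            exact lintegral_congr fun z => by ring
    · rw [← lintegral_const_mul _ ((hWx x).fun_mul hv)]
      exact lintegral_congr fun y => by ring
  rw [e, ← lintegral_const_mul _ ((hWx x).fun_mul hv)]
  refine lintegral_mono fun y => ?_
  rw [← mul_assoc]
  gcongr
  exact h x y

lemma lintegral_kernelOp_mul [SFinite μ] (hk : Measurable (Function.uncurry k))
    (hsymm : ∀ x y, k x y = k y x) (ha : Measurable a) (hu : Measurable u) (hv : Measurable v) :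
    ∫⁻ x, kernelOp μ k a u x * v x ∂μ = ∫⁻ x, u x * kernelOp μ k a v x ∂μ := by
  unfold kernelOp
  simp only [add_mul, mul_add]
  rw [lintegral_add_right _ ((ha.fun_mul hu).fun_mul hv),
    lintegral_add_right _ (hu.fun_mul (ha.fun_mul hv))]
  have hkx : ∀ x, Measurable fun y => k x y := fun x => hk.comp measurable_prodMk_left
  congr 1
  · calc ∫⁻ x, (∫⁻ y, k x y * u y ∂μ) * v x ∂μ
        = ∫⁻ x, ∫⁻ y, k x y * u y * v x ∂μ ∂μ :=
          lintegral_congr fun x => (lintegral_mul_const _ ((hkx x).fun_mul hu)).symm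
      _ = ∫⁻ y, ∫⁻ x, k x y * u y * v x ∂μ ∂μ := by
          refine lintegral_lintegral_swap (Measurable.aemeasurable ?_)
          exact (hk.fun_mul (hu.comp measurable_snd)).fun_mul (hv.comp measurable_fst)
      _ = _ := lintegral_congr fun y => by
          rw [← lintegral_const_mul _ ((hkx y).fun_mul hv)]
          exact lintegral_congr fun x => by rw [hsymm x y]; ring
  · exact lintegral_congr fun x => by ring

/-- For a symmetric operator and a symmetric kernel `W` with `c`-superharmonic columns, applying
the operator before integrating against `W` costs at most the factor `c`. -/
lemma potential_iterate_kernelOp_le [SFinite μ] (hk : Measurable (Function.uncurry k))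
    (hsymm : ∀ x y, k x y = k y x) (ha : Measurable a)
    (hW : Measurable (Function.uncurry W)) (hWsymm : ∀ x y, W x y = W y x) (hv : Measurable v)
    (h : ∀ x y, kernelOp μ k a (fun z => W z y) x ≤ c * W x y) (n : ℕ) (x : X) :
    ∫⁻ y, W x y * (kernelOp μ k a)^[n] v y ∂μ ≤ c ^ n * ∫⁻ y, W x y * v y ∂μ := by
  have hWx : ∀ x, Measurable fun y => W x y := fun x => hW.comp measurable_prodMk_left
  induction n with
  | zero => simp
  | succ n ih =>
    have hm := measurable_iterate_kernelOp (μ := μ) hk ha hv n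
    rw [Function.iterate_succ_apply', ← lintegral_kernelOp_mul hk hsymm ha (hWx x) hm, pow_succ',
      mul_assoc]
    refine le_trans ?_ (mul_le_mul' le_rfl ih)
    rw [← lintegral_const_mul _ ((hWx x).fun_mul hm)]
    refine lintegral_mono fun y => ?_
    rw [← mul_assoc]
    refine mul_le_mul' ?_ le_rfl
    have := h y x
    rw [hWsymm y x] at this
    simpa only [hWsymm _ x] using this

/-- Expansion of the iterates with respect to the last use of the kernel `j`, where
`j ≤ D W`. -/
lemma iterate_kernelOp_add_kernel_le [SFinite μ] (hk : Measurable (Function.uncurry k))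
    (hj : Measurable (Function.uncurry j)) (hsymm : ∀ x y, k x y = k y x) (ha : Measurable a)
    (hW : Measurable (Function.uncurry W)) (hWsymm : ∀ x y, W x y = W y x)
    {D : ℝ≥0∞} (hjW : ∀ x y, j x y ≤ D * W x y)
    (h : ∀ x y, kernelOp μ (fun x y => k x y + j x y) a (fun z => W z y) x ≤ c * W x y)
    (hv : Measurable v) (n : ℕ) (x : X) :
    (kernelOp μ (fun x y => k x y + j x y) a)^[n] v x
      ≤ (kernelOp μ k a)^[n] v x + n * c ^ (n - 1) * D * ∫⁻ y, W x y * v y ∂μ := by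
  have hWx : ∀ x, Measurable fun y => W x y := fun x => hW.comp measurable_prodMk_left
  have hkj : Measurable (Function.uncurry fun x y => k x y + j x y) := hk.add hj
  have h' : ∀ x y, kernelOp μ k a (fun z => W z y) x ≤ c * W x y := by
    intro x y
    refine le_trans ?_ (h x y)
    unfold kernelOp
    gcongr
    exact le_self_add
  set Q : X → ℝ≥0∞ := fun x => ∫⁻ y, W x y * v y ∂μ with hQ
  have mQ : Measurable Q := Measurable.lintegral_prod_right'
    (f := fun p : X × X => W p.1 p.2 * v p.2) (hW.fun_mul (hv.comp measurable_snd))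
  induction n generalizing x with
  | zero => simp
  | succ n ih =>
    have hm := measurable_iterate_kernelOp (μ := μ) hk ha hv n
    rw [Function.iterate_succ_apply', Function.iterate_succ_apply']
    calc kernelOp μ (fun x y => k x y + j x y) a
          ((kernelOp μ (fun x y => k x y + j x y) a)^[n] v) x
        ≤ kernelOp μ (fun x y => k x y + j x y) a
          (fun y => (kernelOp μ k a)^[n] v y + n * c ^ (n - 1) * D * Q y) x := kernelOp_mono ih x
      _ = kernelOp μ k a ((kernelOp μ k a)^[n] v) x
          + ∫⁻ y, j x y * (kernelOp μ k a)^[n] v y ∂μ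
          + n * c ^ (n - 1) * D * kernelOp μ (fun x y => k x y + j x y) a Q x := by
          rw [kernelOp_add hkj hm, kernelOp_const_mul hkj mQ, kernelOp_add_kernel hk hm]
      _ ≤ kernelOp μ k a ((kernelOp μ k a)^[n] v) x + D * (c ^ n * Q x)
          + n * c ^ (n - 1) * D * (c * Q x) := by
          gcongr
          · calc ∫⁻ y, j x y * (kernelOp μ k a)^[n] v y ∂μ
                ≤ ∫⁻ y, D * (W x y * (kernelOp μ k a)^[n] v y) ∂μ := by
                  refine lintegral_mono fun y => ?_
                  rw [← mul_assoc]
                  exact mul_le_mul' (hjW x y) le_rfl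
              _ = D * ∫⁻ y, W x y * (kernelOp μ k a)^[n] v y ∂μ :=
                  lintegral_const_mul _ ((hWx x).fun_mul hm)
              _ ≤ _ := by
                  gcongr
                  exact potential_iterate_kernelOp_le hk hsymm ha hW hWsymm hv h' n x
          · exact kernelOp_potential_le hkj hW hv h x
      _ = _ := by
          rcases n with _ | n
          · simp [hQ]
          · simp only [Nat.add_sub_cancel, Nat.cast_add, Nat.cast_one]
            ring

/-- The exponential `e^{t (T - Λ)}` of a positive operator `T`, as a power series. -/
def expSum (T : (X → ℝ≥0∞) → X → ℝ≥0∞) (Λ t : ℝ) (u : X → ℝ≥0∞) (x : X) : ℝ≥0∞ :=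
  ENNReal.ofReal (Real.exp (-(Λ * t))) * ∑' n : ℕ, ENNReal.ofReal (t ^ n / n.factorial) * T^[n] u x

lemma tsum_ofReal_exp {t c : ℝ} (ht : 0 ≤ t) (hc : 0 ≤ c) :
    ∑' n : ℕ, ENNReal.ofReal (t ^ n / n.factorial) * ENNReal.ofReal c ^ n
      = ENNReal.ofReal (Real.exp (t * c)) := by
  have h : HasSum (fun n : ℕ => (t * c) ^ n / n.factorial) (Real.exp (t * c)) := by
    have := NormedSpace.expSeries_div_hasSum_exp (t * c)
    rwa [← Real.exp_eq_exp_ℝ] at this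
  rw [← h.tsum_eq, ENNReal.ofReal_tsum_of_nonneg (fun n => by positivity) h.summable]
  refine tsum_congr fun n => ?_
  rw [← ENNReal.ofReal_pow hc, ← ENNReal.ofReal_mul (by positivity), mul_pow]
  congr 1
  ring

lemma tsum_ofReal_deriv_exp {t c : ℝ} (ht : 0 ≤ t) (hc : 0 ≤ c) :
    ∑' n : ℕ, ENNReal.ofReal (t ^ n / n.factorial) * (n * ENNReal.ofReal c ^ (n - 1))
      = ENNReal.ofReal (t * Real.exp (t * c)) := by
  rw [tsum_eq_zero_add' ENNReal.summable, ENNReal.ofReal_mul ht, ← tsum_ofReal_exp ht hc,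
    ← ENNReal.tsum_mul_left]
  simp only [Nat.cast_zero, zero_mul, mul_zero, zero_add, Nat.add_sub_cancel]
  refine tsum_congr fun n => ?_
  rw [← mul_assoc, ← mul_assoc, ← ENNReal.ofReal_natCast (n + 1),
    ← ENNReal.ofReal_mul (by positivity), ← ENNReal.ofReal_mul ht]
  congr 2
  rw [Nat.factorial_succ]
  push_cast
  field_simp
  ring

lemma expSum_le {t Λ c : ℝ} (ht : 0 ≤ t) (hc : 0 ≤ c) (hk : Measurable (Function.uncurry k))
    (hu : Measurable u) (h : ∀ x, kernelOp μ k a u x ≤ ENNReal.ofReal c * u x)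
    (hvu : ∀ x, v x ≤ u x)
    (x : X) :
    expSum (kernelOp μ k a) Λ t v x ≤ ENNReal.ofReal (Real.exp ((c - Λ) * t)) * u x := by
  unfold expSum
  calc _ ≤ ENNReal.ofReal (Real.exp (-(Λ * t)))
          * ∑' n : ℕ, ENNReal.ofReal (t ^ n / n.factorial) * (ENNReal.ofReal c ^ n * u x) := by
        gcongr with n
        exact (iterate_kernelOp_mono hvu n x).trans (iterate_kernelOp_le hk hu h n x)
    _ = _ := by
        simp only [← mul_assoc]
        rw [ENNReal.tsum_mul_right, tsum_ofReal_exp ht hc, ← mul_assoc,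
          ← ENNReal.ofReal_mul (by positivity), ← Real.exp_add]
        congr 3
        ring

/-- Splitting the jumps into those governed by `k` and those governed by `j ≤ D W`: either no jump
of the second kind occurs, or the last one of them spreads the mass according to `W`. -/
lemma expSum_add_kernel_le [SFinite μ] (hk : Measurable (Function.uncurry k))
    (hj : Measurable (Function.uncurry j)) (hsymm : ∀ x y, k x y = k y x) (ha : Measurable a)
    (hW : Measurable (Function.uncurry W)) (hWsymm : ∀ x y, W x y = W y x)
    {D t Λ c b : ℝ} (ht : 0 ≤ t) (hc : 0 ≤ c) (hb : 0 ≤ b)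
    (hjW : ∀ x y, j x y ≤ ENNReal.ofReal D * W x y)
    (h : ∀ x y, kernelOp μ (fun x y => k x y + j x y) a (fun z => W z y) x
      ≤ ENNReal.ofReal c * W x y)
    (hv : Measurable v) (hu : Measurable u) (hvu : ∀ x, v x ≤ u x)
    (hbu : ∀ x, kernelOp μ k a u x ≤ ENNReal.ofReal b * u x) (x : X) :
    expSum (kernelOp μ (fun x y => k x y + j x y) a) Λ t v x
      ≤ ENNReal.ofReal (Real.exp ((b - Λ) * t)) * u x
        + ENNReal.ofReal (t * Real.exp ((c - Λ) * t)) * ENNReal.ofReal D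
          * ∫⁻ y, W x y * v y ∂μ := by
  refine le_trans ?_ (add_le_add_left (expSum_le ht hb hk hu hbu hvu x) _)
  unfold expSum
  set Q := ∫⁻ y, W x y * v y ∂μ
  calc _ ≤ ENNReal.ofReal (Real.exp (-(Λ * t)))
          * ∑' n : ℕ, ENNReal.ofReal (t ^ n / n.factorial) * ((kernelOp μ k a)^[n] v x
            + n * ENNReal.ofReal c ^ (n - 1) * ENNReal.ofReal D * Q) := by
        gcongr with n
        exact iterate_kernelOp_add_kernel_le hk hj hsymm ha hW hWsymm hjW h hv n x
    _ = _ := by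
        simp only [mul_add]
        rw [ENNReal.tsum_add, mul_add]
        congr 1
        simp only [← mul_assoc]
        rw [ENNReal.tsum_mul_right, ENNReal.tsum_mul_right]
        simp only [mul_assoc]
        rw [tsum_ofReal_deriv_exp ht hc, ← mul_assoc, ← ENNReal.ofReal_mul (by positivity)]
        congr 2
        rw [mul_left_comm, ← Real.exp_add]
        congr 2
        ring

end KernelOperator

/-! ### Jumps of a dominated intensity -/

section Jumps

variable {d : ℕ} {α : ℝ} {φ : ℝ → ℝ} {M c₄ : ℝ} {f : Rd d → Rd d → ℝ≥0∞} {s ε η : ℝ}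

/-- The part of the jump intensity with jumps longer than `ε`. -/
def longJumps (f : Rd d → Rd d → ℝ≥0∞) (ε : ℝ) (x y : Rd d) : ℝ≥0∞ :=
  {y : Rd d | ε < ‖y - x‖}.indicator (f x) y

/-- The part of the jump intensity with jumps of length in `(ε, η]`. -/
def midJumps (f : Rd d → Rd d → ℝ≥0∞) (ε η : ℝ) (x y : Rd d) : ℝ≥0∞ :=
  {y : Rd d | ε < ‖y - x‖ ∧ ‖y - x‖ ≤ η}.indicator (f x) y

/-- The total rate of the jumps longer than `ε`. -/
def longRate (f : Rd d → Rd d → ℝ≥0∞) (ε : ℝ) (x : Rd d) : ℝ≥0∞ :=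
  ∫⁻ y, longJumps f ε x y

lemma measurable_longJumps (hf : Measurable (Function.uncurry f)) :
    Measurable (Function.uncurry (longJumps f ε)) :=
  hf.indicator (measurableSet_lt measurable_const (measurable_snd.sub measurable_fst).norm)

lemma measurable_midJumps (hf : Measurable (Function.uncurry f)) :
    Measurable (Function.uncurry (midJumps f ε η)) :=
  hf.indicator ((measurableSet_lt measurable_const (measurable_snd.sub measurable_fst).norm).inter
    (measurableSet_le (measurable_snd.sub measurable_fst).norm measurable_const))

lemma measurable_longRate (hf : Measurable (Function.uncurry f)) : Measurable (longRate f ε) :=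
  (measurable_longJumps hf).lintegral_prod_right'

lemma midJumps_symm (hf : ∀ x y, f x y = f y x) (x y : Rd d) :
    midJumps f ε η x y = midJumps f ε η y x := by
  simp only [midJumps, indicator_apply, mem_ofPred_eq, norm_sub_rev x y, hf x y]

lemma midJumps_add_longJumps (h : ε ≤ η) :
    (fun x y => midJumps f ε η x y + longJumps f η x y) = longJumps f ε := by
  funext x y
  simp only [midJumps, longJumps, indicator_apply, mem_ofPred_eq]
  by_cases h1 : η < ‖y - x‖
  · simp [h1, h.trans_lt h1, not_le.2 h1]
  · simp [h1, not_lt.1 h1]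

lemma IsJumpKernel.le_stable (hf : IsJumpKernel d α φ M c₄ f) (hφ : IsProfile d α φ) (hM : 0 < M)
    {x y : Rd d} (h : y ≠ x) : f x y ≤ ENNReal.ofReal (M * (1 / ‖y - x‖ ^ (α + d))) := by
  refine (hf.upper x y h).trans (ENNReal.ofReal_le_ofReal ?_)
  gcongr
  exact hφ.le_one _ (norm_nonneg _)

lemma ne_of_lt_norm_sub {x y : Rd d} (hε : 0 < ε) (h : ε < ‖y - x‖) : y ≠ x := by
  rintro rfl
  simp at h
  linarith

lemma exists_longRate_le (hα : 0 < α) (hφ : IsProfile d α φ) (hM : 0 < M) (c₄ : ℝ) :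
    ∃ C : ℝ, 0 < C ∧ ∀ f : Rd d → Rd d → ℝ≥0∞, IsJumpKernel d α φ M c₄ f → ∀ ε, 0 < ε → ∀ x,
      longRate f ε x ≤ ENNReal.ofReal (C * ε ^ (-α)) := by
  obtain ⟨C, hC, h⟩ := exists_tail_bound (d := d) hα
  refine ⟨M * C, by positivity, fun f hf ε hε x => ?_⟩
  have hS : MeasurableSet {h : Rd d | ε < ‖h‖} := measurableSet_lt measurable_const measurable_norm
  calc longRate f ε x
      ≤ ∫⁻ y, (fun h : Rd d => ENNReal.ofReal M * {h : Rd d | ε < ‖h‖}.indicator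
          (fun h => ENNReal.ofReal (1 / ‖h‖ ^ (α + d))) h) (y - x) := by
        refine lintegral_mono fun y => ?_
        by_cases hy : ε < ‖y - x‖
        · simp only [longJumps]
          rw [indicator_of_mem (by exact hy), indicator_of_mem (by exact hy),
            ← ENNReal.ofReal_mul hM.le]
          exact hf.le_stable hφ hM (ne_of_lt_norm_sub hε hy)
        · simp only [longJumps]
          rw [indicator_of_notMem (by exact hy)]
          exact zero_le
    _ = ENNReal.ofReal M * ∫⁻ h in {h : Rd d | ε < ‖h‖}, ENNReal.ofReal (1 / ‖h‖ ^ (α + d)) := by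
        rw [lintegral_sub_right_eq_self (fun h : Rd d => ENNReal.ofReal M *
          {h : Rd d | ε < ‖h‖}.indicator (fun h => ENNReal.ofReal (1 / ‖h‖ ^ (α + d))) h) x,
          lintegral_const_mul' _ _ ENNReal.ofReal_ne_top, lintegral_indicator hS]
    _ ≤ _ := by
        rw [mul_assoc M, ENNReal.ofReal_mul hM.le]
        gcongr
        exact h ε hε

/-- The lower bound on the rate of jumps. The weight `1/φ` only matters for jumps longer than `1`,
whose rate is bounded. -/
lemma exists_le_longRate (hα : 0 < α) (hφ : IsProfile d α φ) (hM : 0 < M) (hc₄ : 0 < c₄) :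
    ∃ η₀ : ℝ, 0 < η₀ ∧ ∀ f : Rd d → Rd d → ℝ≥0∞, IsJumpKernel d α φ M c₄ f →
      ∀ η, 0 < η → η ≤ η₀ → ∀ x, ENNReal.ofReal (c₄ / 2 * η ^ (-α)) ≤ longRate f η x := by
  obtain ⟨C, hC, h⟩ := exists_tail_bound (d := d) hα
  -- The jumps longer than `1` contribute at most `M C`, at most half of the bound if `η^{-α} ≥ c`.
  set c : ℝ := 2 * (M * C) / c₄ with hc
  have hc0 : 0 < c := by positivity
  refine ⟨c ^ (-α⁻¹), by positivity, fun f hf η hη hη₀ x => ?_⟩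
  have hηα : c ≤ η ^ (-α) := by
    have := Real.rpow_le_rpow_of_nonpos hη hη₀ (by linarith : -α ≤ 0)
    rwa [← Real.rpow_mul hc0.le, neg_mul_neg, inv_mul_cancel₀ hα.ne', Real.rpow_one] at this
  have hMC : M * C ≤ c₄ / 2 * η ^ (-α) := by
    rw [hc, div_le_iff₀ hc₄] at hηα
    linarith
  have hS : ∀ η : ℝ, MeasurableSet {h : Rd d | η < ‖h‖} :=
    fun η => measurableSet_lt measurable_const measurable_norm
  have hSx : MeasurableSet {y : Rd d | η < ‖y - x‖} :=
    measurableSet_lt measurable_const (measurable_id.sub_const x).norm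
  set F : Rd d → ℝ≥0∞ := {h : Rd d | 1 < ‖h‖}.indicator
    (fun h => ENNReal.ofReal M * ENNReal.ofReal (1 / ‖h‖ ^ (α + d))) with hF
  have mF : Measurable fun y => F (y - x) := by
    refine Measurable.comp (g := F) ?_ (measurable_id.sub_const x)
    refine Measurable.indicator ?_ (hS 1)
    fun_prop
  have key : ENNReal.ofReal (c₄ * η ^ (-α)) ≤ longRate f η x + ENNReal.ofReal (M * C) := by
    calc ENNReal.ofReal (c₄ * η ^ (-α))
        ≤ ∫⁻ y in {y : Rd d | η < ‖y - x‖}, f x y / ENNReal.ofReal (φ ‖y - x‖) :=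
          (hf.lower η hη).trans (iInf_le _ x)
      _ ≤ ∫⁻ y in {y : Rd d | η < ‖y - x‖}, (f x y + F (y - x)) := by
          refine setLIntegral_mono_ae' hSx (ae_of_all _ fun y hy => ?_)
          by_cases hy1 : 1 < ‖y - x‖
          · refine le_trans ?_ le_add_self
            have hp := hφ.pos _ (norm_nonneg (y - x))
            rw [hF, indicator_of_mem (by exact hy1), ← ENNReal.ofReal_mul hM.le]
            refine ENNReal.div_le_of_le_mul ?_
            rw [← ENNReal.ofReal_mul (by positivity)]
            refine (hf.upper x y (ne_of_lt_norm_sub one_pos hy1)).trans_eq ?_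
            congr 1
            ring
          · rw [hφ.eq_one _ ⟨norm_nonneg _, not_lt.1 hy1⟩, ENNReal.ofReal_one, div_one]
            exact le_self_add
      _ ≤ longRate f η x + ∫⁻ y, F (y - x) := by
          rw [lintegral_add_right _ mF]
          refine add_le_add (le_of_eq ?_) (setLIntegral_le_lintegral _ _)
          rw [← lintegral_indicator hSx]
          rfl
      _ ≤ _ := by
          gcongr
          rw [lintegral_sub_right_eq_self F x, hF, lintegral_indicator (hS 1),
            lintegral_const_mul' _ _ ENNReal.ofReal_ne_top, ENNReal.ofReal_mul hM.le]
          gcongr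
          simpa using h 1 one_pos
  have hpos : 0 < η ^ (-α) := by positivity
  refine (ENNReal.add_le_add_iff_right (a := ENNReal.ofReal (c₄ / 2 * η ^ (-α)))
    ENNReal.ofReal_ne_top).1 ?_
  rw [← ENNReal.ofReal_add (by positivity) (by positivity)]
  refine le_trans (le_of_eq ?_) (key.trans ?_)
  · congr 1; ring
  · gcongr

lemma exists_midJumps_moment_le (hd : 1 ≤ d) (hφ : IsProfile d α φ) (hM : 0 < M)
    (c₄ : ℝ) {p : ℕ} (hp : α < p) {K : ℝ} (hK : 0 < K) :
    ∃ D : ℝ, 0 < D ∧ ∀ f : Rd d → Rd d → ℝ≥0∞, IsJumpKernel d α φ M c₄ f → ∀ s ε η, 0 < s →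
      0 < ε → 0 < η → η ≤ s → ∀ x,
      ∫⁻ h, midJumps f ε η x (x + h) * ENNReal.ofReal (K * (‖h‖ / s) ^ p)
        ≤ ENNReal.ofReal (D * s ^ (-α)) := by
  obtain ⟨C, hC, h⟩ := exists_small_bound hd hp
  refine ⟨M * K * C, by positivity, fun f hf s ε η hs hε hη hηs x => ?_⟩
  have hS : MeasurableSet {h : Rd d | ‖h‖ ≤ η} := measurableSet_le measurable_norm measurable_const
  calc ∫⁻ h, midJumps f ε η x (x + h) * ENNReal.ofReal (K * (‖h‖ / s) ^ p)
      ≤ ∫⁻ h, {h : Rd d | ‖h‖ ≤ η}.indicator (fun h => ENNReal.ofReal (M * K * (s ^ p)⁻¹)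
          * ENNReal.ofReal (‖h‖ ^ (p : ℝ) / ‖h‖ ^ (α + d))) h := by
        refine lintegral_mono fun h => ?_
        simp only [midJumps, indicator_apply, mem_ofPred_eq, add_sub_cancel_left]
        by_cases h1 : ε < ‖h‖ ∧ ‖h‖ ≤ η
        · rw [if_pos h1, if_pos h1.2]
          have hne : x + h ≠ x := ne_of_lt_norm_sub hε (by simpa using h1.1)
          have := hf.le_stable hφ hM hne
          rw [add_sub_cancel_left] at this
          refine (mul_le_mul' this le_rfl).trans (le_of_eq ?_)
          rw [← ENNReal.ofReal_mul (by positivity), ← ENNReal.ofReal_mul (by positivity)]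
          congr 1
          rw [Real.rpow_natCast, div_pow]
          ring
        · rw [if_neg h1, zero_mul]
          exact zero_le
    _ = ENNReal.ofReal (M * K * (s ^ p)⁻¹) * ∫⁻ h in {h : Rd d | ‖h‖ ≤ η},
          ENNReal.ofReal (‖h‖ ^ (p : ℝ) / ‖h‖ ^ (α + d)) := by
        rw [lintegral_indicator hS, lintegral_const_mul' _ _ ENNReal.ofReal_ne_top]
    _ ≤ ENNReal.ofReal (M * K * (s ^ p)⁻¹) * ENNReal.ofReal (C * η ^ (p - α)) := by
        gcongr
        exact h η hη
    _ ≤ _ := by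
        rw [← ENNReal.ofReal_mul (by positivity)]
        refine ENNReal.ofReal_le_ofReal ?_
        have h1 : η ^ (p - α) ≤ s ^ (p - α) := Real.rpow_le_rpow hη.le hηs (by linarith)
        calc M * K * (s ^ p)⁻¹ * (C * η ^ (p - α))
            ≤ M * K * (s ^ p)⁻¹ * (C * s ^ (p - α)) := by gcongr
          _ = M * K * C * s ^ (-α) := by
            rw [sub_eq_add_neg, Real.rpow_add hs, Real.rpow_natCast]
            field_simp

/-- Jumps no longer than `s/2` change the regularized kernel at scale `s` by at most `O(s^{-α})`
times its value: the first order terms cancel if the intensity is balanced, and are integrable if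
`α < 1`. -/
lemma exists_midJumps_regBound_le (hd : 1 ≤ d) (hα : α ∈ Ioo (0 : ℝ) 2) (hφ : IsProfile d α φ)
    (hM : 0 < M) (c₄ : ℝ) :
    ∃ D : ℝ, 0 < D ∧ ∀ f : Rd d → Rd d → ℝ≥0∞, IsJumpKernel d α φ M c₄ f → ∀ s ε η, 0 < s →
      s ≤ 1 → 0 < ε → 0 < η → η ≤ 1 / 2 * s → ∀ x y,
      ∫⁻ z, midJumps f ε η x z * regBound d α φ s (z - y)
        ≤ ((∫⁻ z, midJumps f ε η x z) + ENNReal.ofReal (D * s ^ (-α)))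
          * regBound d α φ s (x - y) := by
  obtain ⟨K, hK, hdiff⟩ := exists_regBound_difference hα.1 hφ
  obtain ⟨D₂, hD₂, h2⟩ := exists_midJumps_moment_le hd hφ hM c₄ (p := 2)
    (by simpa using hα.2) hK
  have h1 : ∃ D₁ : ℝ, 0 < D₁ ∧ (α < 1 → ∀ f : Rd d → Rd d → ℝ≥0∞, IsJumpKernel d α φ M c₄ f →
      ∀ s ε η, 0 < s → 0 < ε → 0 < η → η ≤ s → ∀ x,
      ∫⁻ h, midJumps f ε η x (x + h) * ENNReal.ofReal (K * (‖h‖ / s))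
        ≤ ENNReal.ofReal (D₁ * s ^ (-α))) := by
    by_cases hα1 : α < 1
    · obtain ⟨D₁, hD₁, h1⟩ := exists_midJumps_moment_le hd hφ hM c₄ (p := 1)
        (by simpa using hα1) hK
      exact ⟨D₁, hD₁, fun _ => by simpa using h1⟩
    · exact ⟨1, one_pos, fun h => absurd h hα1⟩
  obtain ⟨D₁, hD₁, h1⟩ := h1
  refine ⟨D₁ + D₂, by positivity, fun f hf s ε η hs hs1 hε hη hηs x y => ?_⟩
  have hsα : 0 < s ^ (-α) := by positivity
  set W := regBound d α φ s with hW
  set F : Rd d → ℝ≥0∞ := fun h => midJumps f ε η x (x + h) with hF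
  have mF : Measurable F :=
    (measurable_midJumps hf.measurable).of_uncurry_left.comp (measurable_const_add x)
  have mW : Measurable W := measurable_regBound hφ
  have e1 : ∫⁻ z, midJumps f ε η x z * W (z - y) = ∫⁻ h, F h * W (x - y + h) := by
    rw [← lintegral_add_left_eq_self _ x]
    refine lintegral_congr fun h => ?_
    rw [show x + h - y = x - y + h by abel]
  have e2 : ∫⁻ z, midJumps f ε η x z = ∫⁻ h, F h := (lintegral_add_left_eq_self _ x).symm
  have hF0 : ∀ h, ¬ ‖h‖ ≤ 1 / 2 * s → F h = 0 := by
    intro h hh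
    simp only [hF, midJumps]
    refine indicator_of_notMem (fun hc => hh ?_) _
    have := hc.2
    rw [add_sub_cancel_left] at this
    linarith
  rw [e1, e2]
  set w := x - y
  rcases hf.balanced with hbal | hα1
  -- averaging over `h` and `-h` leaves a second difference
  · have hFneg : ∀ h, F (-h) = F h := by
      intro h
      simp only [hF, midJumps, indicator_apply, mem_ofPred_eq, add_sub_cancel_left, norm_neg]
      rw [hbal x h, sub_eq_add_neg]
    have e3 : ∫⁻ h, F h * W (w - h) = ∫⁻ h, F h * W (w + h) := by
      rw [← lintegral_neg_eq_self]
      refine lintegral_congr fun h => ?_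
      rw [hFneg, sub_neg_eq_add]
    have mA : Measurable fun h => F h * W (w + h) :=
      mF.fun_mul (mW.comp (measurable_const_add w))
    have key : 2 * ∫⁻ h, F h * W (w + h)
        ≤ 2 * (((∫⁻ h, F h) + ENNReal.ofReal ((D₁ + D₂) * s ^ (-α))) * W w) := by
      calc 2 * ∫⁻ h, F h * W (w + h)
          = ∫⁻ h, (F h * W (w + h) + F h * W (w - h)) := by
            rw [lintegral_add_left mA, e3, two_mul]
        _ ≤ ∫⁻ h, (F h * (2 * W w) + F h * ENNReal.ofReal (K * (‖h‖ / s) ^ 2) * W w) := by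
            refine lintegral_mono fun h => ?_
            by_cases hh : ‖h‖ ≤ 1 / 2 * s
            · rw [← mul_add, mul_assoc, ← mul_add]
              exact mul_le_mul' le_rfl (hdiff s hs hs1 w h hh).1
            · simp [hF0 h hh]
        _ = (∫⁻ h, F h) * (2 * W w)
            + (∫⁻ h, F h * ENNReal.ofReal (K * (‖h‖ / s) ^ 2)) * W w := by
            have m3 : Measurable fun h => F h * ENNReal.ofReal (K * (‖h‖ / s) ^ 2) :=
              mF.fun_mul (by fun_prop)
            rw [lintegral_add_left (mF.mul_const _), lintegral_mul_const _ mF,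
              lintegral_mul_const _ m3]
        _ ≤ (∫⁻ h, F h) * (2 * W w)
            + (2 * ENNReal.ofReal ((D₁ + D₂) * s ^ (-α))) * W w := by
            gcongr
            refine (h2 f hf s ε η hs hε hη (by linarith) x).trans ?_
            refine le_trans (ENNReal.ofReal_le_ofReal ?_) (le_mul_of_one_le_left zero_le
              one_le_two)
            gcongr
            linarith
        _ = _ := by ring
    exact (ENNReal.mul_le_mul_iff_right two_ne_zero ENNReal.ofNat_ne_top).1 key
  -- first moments of short jumps are finite for `α < 1`
  · calc ∫⁻ h, F h * W (w + h)
        ≤ ∫⁻ h, (F h * W w + F h * ENNReal.ofReal (K * (‖h‖ / s)) * W w) := by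
          refine lintegral_mono fun h => ?_
          by_cases hh : ‖h‖ ≤ 1 / 2 * s
          · rw [mul_assoc, ← mul_add]
            exact mul_le_mul' le_rfl (hdiff s hs hs1 w h hh).2
          · simp [hF0 h hh]
      _ = (∫⁻ h, F h) * W w + (∫⁻ h, F h * ENNReal.ofReal (K * (‖h‖ / s))) * W w := by
          have m3 : Measurable fun h => F h * ENNReal.ofReal (K * (‖h‖ / s)) :=
            mF.fun_mul (by fun_prop)
          rw [lintegral_add_left (mF.mul_const _), lintegral_mul_const _ mF,
            lintegral_mul_const _ m3]
      _ ≤ (∫⁻ h, F h) * W w + ENNReal.ofReal ((D₁ + D₂) * s ^ (-α)) * W w := by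
          gcongr
          refine (h1 hα1 f hf s ε η hs hε hη (by linarith) x).trans ?_
          refine ENNReal.ofReal_le_ofReal ?_
          gcongr
          linarith
      _ = _ := by ring

lemma exists_longJumps_le (hα : 0 < α) (hφ : IsProfile d α φ) (hM : 0 < M)
    (c₄ : ℝ) {κ : ℝ} (hκ : 0 < κ) (hκ1 : κ ≤ 1) :
    ∃ D : ℝ, 0 < D ∧ ∀ f : Rd d → Rd d → ℝ≥0∞, IsJumpKernel d α φ M c₄ f → ∀ s, 0 < s →
      s ≤ 1 → ∀ x y,
      longJumps f (κ * s) x y ≤ ENNReal.ofReal (D * s ^ (-α)) * regBound d α φ s (x - y) := by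
  obtain ⟨C, hC, h⟩ := exists_le_regBound hα hφ
  refine ⟨M * (1 / κ) ^ (α + d) * C, by positivity, fun f hf s hs hs1 x y => ?_⟩
  have hκs : 0 < κ * s := by positivity
  simp only [longJumps, indicator_apply, mem_ofPred_eq]
  split_ifs with hy
  · refine (hf.upper x y (ne_of_lt_norm_sub hκs hy)).trans ?_
    set r := ‖y - x‖ with hr
    have hr0 : 0 < r := hκs.trans hy
    have hm : 0 < max s r := lt_max_of_lt_left hs
    have h1 := rpow_max_le (a := r) (b := max s r) (c := 1 / κ) (n := α + d) hr0 (by positivity)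
      (by positivity) (by
        rw [one_div, inv_mul_eq_div, le_div_iff₀ hκ]
        rcases max_choice s r with e | e <;> rw [e] <;> nlinarith) hm
    have hp := hφ.pos r hr0.le
    have hsα : s ^ (-α) * s ^ α = 1 := by rw [← Real.rpow_add hs]; simp
    have h2 : M * (φ r / r ^ (α + d))
        ≤ M * (1 / κ) ^ (α + d) * s ^ (-α) * scaledBound d α φ s r := by
      unfold scaledBound
      calc M * (φ r / r ^ (α + d)) = M * φ r * (1 / r ^ (α + d)) := by ring
        _ ≤ M * φ r * ((1 / κ) ^ (α + d) * (1 / max s r ^ (α + d))) := by gcongr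
        _ = M * φ r * ((1 / κ) ^ (α + d) * (1 / max s r ^ (α + d))) * (s ^ (-α) * s ^ α) := by
          rw [hsα, mul_one]
        _ = _ := by ring
    calc ENNReal.ofReal (M * (φ r / r ^ (α + d)))
        ≤ ENNReal.ofReal (M * (1 / κ) ^ (α + d) * s ^ (-α) * scaledBound d α φ s r) :=
          ENNReal.ofReal_le_ofReal h2
      _ ≤ ENNReal.ofReal (M * (1 / κ) ^ (α + d) * s ^ (-α))
          * (ENNReal.ofReal C * regBound d α φ s (x - y)) := by
          rw [ENNReal.ofReal_mul (by positivity)]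
          gcongr
          rw [hr, norm_sub_rev]
          exact h s hs hs1 _
      _ = _ := by
          rw [← mul_assoc, ← ENNReal.ofReal_mul (by positivity)]
          congr 2
          ring
  · exact zero_le

lemma exists_regBound_convolution_le (hα : 0 < α) (hφ : IsProfile d α φ) :
    ∃ C : ℝ, 0 < C ∧ ∀ s, 0 < s → s ≤ 1 → ∀ x y : Rd d,
      ∫⁻ z, regBound d α φ s (x - z) * regBound d α φ s (z - y)
        ≤ ENNReal.ofReal C * regBound d α φ s (x - y) := by
  obtain ⟨C₁, hC₁, h1⟩ := exists_regBound_le hα hφ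
  obtain ⟨C₂, hC₂, h2⟩ := exists_le_regBound hα hφ
  obtain ⟨C₃, hC₃, h3⟩ := exists_scaledBound_convolution_le hα hφ
  refine ⟨C₁ * C₁ * C₃ * C₂, by positivity, fun s hs hs1 x y => ?_⟩
  calc ∫⁻ z, regBound d α φ s (x - z) * regBound d α φ s (z - y)
      ≤ ∫⁻ z, ENNReal.ofReal (C₁ * C₁) * (ENNReal.ofReal (scaledBound d α φ s ‖z - x‖)
          * ENNReal.ofReal (scaledBound d α φ s ‖z - y‖)) := by
        refine lintegral_mono fun z => ?_
        refine (mul_le_mul' (h1 s hs hs1 _) (h1 s hs hs1 _)).trans (le_of_eq ?_)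
        rw [ENNReal.ofReal_mul hC₁.le, ENNReal.ofReal_mul hC₁.le, ENNReal.ofReal_mul hC₁.le,
          norm_sub_rev x z]
        ring
    _ ≤ ENNReal.ofReal (C₁ * C₁) * (ENNReal.ofReal C₃ * (ENNReal.ofReal C₂
          * regBound d α φ s (x - y))) := by
        rw [lintegral_const_mul' _ _ ENNReal.ofReal_ne_top]
        gcongr
        refine (h3 s hs hs1 x y).trans ?_
        rw [ENNReal.ofReal_mul hC₃.le]
        gcongr
        exact h2 s hs hs1 _
    _ = _ := by
        rw [← mul_assoc, ← mul_assoc, ← ENNReal.ofReal_mul (by positivity),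
          ← ENNReal.ofReal_mul (by positivity)]

end Jumps

/-! ### Superharmonicity of the regularized kernel -/

section Superharmonic

variable {d : ℕ} {α : ℝ} {φ : ℝ → ℝ} {M c₄ : ℝ} {f : Rd d → Rd d → ℝ≥0∞} {s ε η : ℝ}

/-- With `Λ` at least the total rate of the jumps longer than `ε`, the operator with kernel
`longJumps f ε` and diagonal part `holdRate f ε Λ` is `Λ` plus the generator of these jumps. -/
def holdRate (f : Rd d → Rd d → ℝ≥0∞) (ε Λ : ℝ) (x : Rd d) : ℝ≥0∞ :=
  ENNReal.ofReal Λ - longRate f ε x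

lemma measurable_holdRate (hf : Measurable (Function.uncurry f)) {Λ : ℝ} :
    Measurable (holdRate f ε Λ) :=
  measurable_const.sub (measurable_longRate hf)

lemma lintegral_midJumps_add_longRate (hf : Measurable (Function.uncurry f)) (h : ε ≤ η)
    (x : Rd d) : (∫⁻ y, midJumps f ε η x y) + longRate f η x = longRate f ε x := by
  unfold longRate
  rw [← lintegral_add_right _ (measurable_longJumps hf).of_uncurry_left]
  exact lintegral_congr fun y => congrFun (congrFun (midJumps_add_longJumps h) x) y

/-- Removing the jumps longer than `η` from the operator leaves a defect equal to their rate. -/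
lemma lintegral_midJumps_add_holdRate_le (hf : Measurable (Function.uncurry f)) (h : ε ≤ η)
    {Λ b : ℝ} (hb : 0 ≤ b) (hΛ : ∀ x, longRate f ε x ≤ ENNReal.ofReal Λ)
    (hbη : ∀ x, ENNReal.ofReal b ≤ longRate f η x) (x : Rd d) :
    (∫⁻ y, midJumps f ε η x y) + holdRate f ε Λ x ≤ ENNReal.ofReal (Λ - b) := by
  have e := lintegral_midJumps_add_longRate hf h x
  have h1 := hΛ x
  have hfin : longRate f ε x ≠ ∞ := (h1.trans_lt ENNReal.ofReal_lt_top).ne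
  unfold holdRate
  rw [← e] at h1 hfin ⊢
  have hmid : ∫⁻ y, midJumps f ε η x y ≠ ∞ := fun h => hfin (by rw [h, top_add])
  have h2 : (∫⁻ y, midJumps f ε η x y) ≤ ENNReal.ofReal Λ - longRate f η x :=
    ENNReal.le_sub_of_add_le_right (fun h => hfin (by rw [h, add_top])) h1
  rw [add_comm _ (longRate f η x), ← tsub_tsub, add_tsub_cancel_of_le h2, ENNReal.ofReal_sub _ hb]
  exact tsub_le_tsub_left (hbη x) _

/-- Superharmonicity at scale `s`. The kernel `longJumps f ε` is split at `κ s`. The full operator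
multiplies the regularized kernel by at most `Λ + D s^{-α}`. Without the jumps longer than `κ s`
the operator multiplies both the regularized kernel and the constants by at most `Λ - b s^{-α}`,
where `b` is at our disposal: for small `κ` the killing rate `κ^{-α} s^{-α}` of the missing jumps
outweighs the contribution of the short ones. -/
lemma exists_superharmonic (hd : 1 ≤ d) (hα : α ∈ Ioo (0 : ℝ) 2) (hφ : IsProfile d α φ)
    (hM : 0 < M) (hc₄ : 0 < c₄) {b : ℝ} (hb : 0 < b) :
    ∃ κ s₀ D : ℝ, 0 < κ ∧ 0 < s₀ ∧ s₀ ≤ 1 ∧ 0 < D ∧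
      ∀ f : Rd d → Rd d → ℝ≥0∞, IsJumpKernel d α φ M c₄ f → ∀ s, 0 < s → s ≤ s₀ →
      (∀ x y, longJumps f (κ * s) x y
        ≤ ENNReal.ofReal (D * s ^ (-α)) * regBound d α φ s (x - y)) ∧
      ∀ ε, 0 < ε → ε ≤ κ * s → ∀ Λ, 0 ≤ Λ → (∀ x, longRate f ε x ≤ ENNReal.ofReal Λ) →
        b * s ^ (-α) ≤ Λ ∧
        (∀ x y, kernelOp volume (longJumps f ε) (holdRate f ε Λ)
          (fun z => regBound d α φ s (z - y)) x
            ≤ ENNReal.ofReal (Λ + D * s ^ (-α)) * regBound d α φ s (x - y)) ∧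
        (∀ x y, kernelOp volume (midJumps f ε (κ * s)) (holdRate f ε Λ)
          (fun z => regBound d α φ s (z - y)) x
            ≤ ENNReal.ofReal (Λ - b * s ^ (-α)) * regBound d α φ s (x - y)) ∧
        ∀ x, kernelOp volume (midJumps f ε (κ * s)) (holdRate f ε Λ) (fun _ => 1) x
            ≤ ENNReal.ofReal (Λ - b * s ^ (-α)) := by
  obtain ⟨D₀, hD₀, hmid⟩ := exists_midJumps_regBound_le hd hα hφ hM c₄
  obtain ⟨η₀, hη₀, hrate⟩ := exists_le_longRate hα.1 hφ hM hc₄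
  obtain ⟨C, hC, hconv⟩ := exists_regBound_convolution_le hα.1 hφ
  -- The rate of the jumps longer than `κ s` has to exceed the contribution `D₀` of the short ones
  -- by `b`.
  obtain ⟨κ, hκ, hκ1, hκb⟩ : ∃ κ : ℝ, 0 < κ ∧ κ ≤ 1 / 2 ∧ D₀ + b ≤ c₄ / 2 * κ ^ (-α) := by
    set c : ℝ := 2 * (D₀ + b) / c₄ with hc
    have hc0 : 0 < c := by positivity
    refine ⟨min (1 / 2) (c ^ (-α⁻¹)), by positivity, min_le_left _ _, ?_⟩
    have := Real.rpow_le_rpow_of_nonpos (by positivity) (min_le_right (1 / 2) (c ^ (-α⁻¹)))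
      (by linarith [hα.1] : -α ≤ 0)
    rw [← Real.rpow_mul hc0.le, neg_mul_neg, inv_mul_cancel₀ hα.1.ne', Real.rpow_one, hc,
      div_le_iff₀ hc₄] at this
    linarith
  obtain ⟨D₁, hD₁, hlong⟩ := exists_longJumps_le hα.1 hφ hM c₄ hκ (by linarith)
  refine ⟨κ, min 1 η₀, D₁ * (C + 1), hκ, by positivity, min_le_left _ _, by positivity,
    fun f hf s hs hs₀ => ?_⟩
  have hs1 : s ≤ 1 := hs₀.trans (min_le_left _ _)
  have hsη : s ≤ η₀ := hs₀.trans (min_le_right _ _)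
  have hκs : 0 < κ * s := by positivity
  have hsα : 0 < s ^ (-α) := by positivity
  set W := regBound d α φ s with hW
  have mW : Measurable W := measurable_regBound hφ
  have hl : ∀ x y, longJumps f (κ * s) x y ≤ ENNReal.ofReal (D₁ * s ^ (-α)) * W (x - y) :=
    hlong f hf s hs hs1
  refine ⟨fun x y => (hl x y).trans ?_, fun ε hε hεs Λ hΛ0 hΛ => ?_⟩
  · gcongr
    nlinarith
  have hη : ∀ x, ENNReal.ofReal ((D₀ + b) * s ^ (-α)) ≤ longRate f (κ * s) x := by
    intro x
    refine le_trans (ENNReal.ofReal_le_ofReal ?_) (hrate f hf (κ * s) hκs (by nlinarith) x)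
    rw [Real.mul_rpow hκ.le hs.le, ← mul_assoc]
    gcongr
  have hΛb : (D₀ + b) * s ^ (-α) ≤ Λ := by
    have h1 := (hη 0).trans ((le_add_self.trans_eq
      (lintegral_midJumps_add_longRate hf.measurable hεs 0)).trans (hΛ 0))
    exact (ENNReal.ofReal_le_ofReal_iff hΛ0).1 h1
  have hdef := lintegral_midJumps_add_holdRate_le hf.measurable hεs
    (b := (D₀ + b) * s ^ (-α)) (by positivity) hΛ hη
  have hsmall : ∀ x y, kernelOp volume (midJumps f ε (κ * s)) (holdRate f ε Λ)
      (fun z => W (z - y)) x ≤ ENNReal.ofReal (Λ - b * s ^ (-α)) * W (x - y) := by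
    intro x y
    calc kernelOp volume (midJumps f ε (κ * s)) (holdRate f ε Λ) (fun z => W (z - y)) x
        ≤ ((∫⁻ z, midJumps f ε (κ * s) x z) + ENNReal.ofReal (D₀ * s ^ (-α))) * W (x - y)
          + holdRate f ε Λ x * W (x - y) := by
          refine add_le_add_left (hmid f hf s ε (κ * s) hs hs1 hε hκs ?_ x y) _
          gcongr
      _ = ((∫⁻ z, midJumps f ε (κ * s) x z) + holdRate f ε Λ x
            + ENNReal.ofReal (D₀ * s ^ (-α))) * W (x - y) := by ring
      _ ≤ (ENNReal.ofReal (Λ - (D₀ + b) * s ^ (-α)) + ENNReal.ofReal (D₀ * s ^ (-α)))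
            * W (x - y) := by
          gcongr
          exact hdef x
      _ = _ := by
          rw [← ENNReal.ofReal_add (by linarith) (by positivity)]
          congr 2
          ring
  refine ⟨by nlinarith, fun x y => ?_, hsmall, fun x => ?_⟩
  · have mWy : Measurable fun z => W (z - y) := mW.comp (measurable_id.sub_const y)
    rw [← midJumps_add_longJumps hεs,
      kernelOp_add_kernel (measurable_midJumps hf.measurable) mWy]
    calc _ ≤ ENNReal.ofReal (Λ - b * s ^ (-α)) * W (x - y)
          + ENNReal.ofReal (D₁ * s ^ (-α)) * (ENNReal.ofReal C * W (x - y)) := by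
          refine add_le_add (hsmall x y) ?_
          calc ∫⁻ z, longJumps f (κ * s) x z * W (z - y)
              ≤ ∫⁻ z, ENNReal.ofReal (D₁ * s ^ (-α)) * (W (x - z) * W (z - y)) := by
                refine lintegral_mono fun z => ?_
                rw [← mul_assoc]
                exact mul_le_mul' (hl x z) le_rfl
            _ ≤ _ := by
                rw [lintegral_const_mul' _ _ ENNReal.ofReal_ne_top]
                gcongr
                exact hconv s hs hs1 x y
      _ = ENNReal.ofReal (Λ - b * s ^ (-α) + D₁ * s ^ (-α) * C) * W (x - y) := by
          rw [← mul_assoc, ← add_mul, ← ENNReal.ofReal_mul (by positivity),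
            ← ENNReal.ofReal_add (by nlinarith) (by positivity)]
      _ ≤ _ := by
          refine mul_le_mul' (ENNReal.ofReal_le_ofReal ?_) le_rfl
          nlinarith [mul_pos hb hsα, mul_pos hD₁ hsα]
  · unfold kernelOp
    simp only [mul_one]
    refine (hdef x).trans (ENNReal.ofReal_le_ofReal ?_)
    nlinarith

end Superharmonic

/-! ### The truncated operators on `C₀` -/

section C0

variable {Y : Type*} [TopologicalSpace Y]

lemma abs_apply_le_norm (u : C₀(Y, ℝ)) (x : Y) : |u x| ≤ ‖u‖ := by
  rw [← ZeroAtInftyContinuousMap.norm_toBCF_eq_norm]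
  exact u.toBCF.norm_coe_le_norm x

lemma norm_le_of_forall_abs_le {u : C₀(Y, ℝ)} {C : ℝ} (hC : 0 ≤ C) (h : ∀ x, |u x| ≤ C) :
    ‖u‖ ≤ C := by
  rw [← ZeroAtInftyContinuousMap.norm_toBCF_eq_norm]
  exact (BoundedContinuousFunction.norm_le hC).2 h

end C0

section TruncatedOperator

variable {d : ℕ} {α : ℝ} {φ : ℝ → ℝ} {M c₄ : ℝ} {f : Rd d → Rd d → ℝ≥0∞} {ε : ℝ}

lemma measurable_toReal_longJumps (hf : IsJumpKernel d α φ M c₄ f) (x : Rd d) :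
    Measurable fun y => (longJumps f ε x y).toReal :=
  (measurable_longJumps hf.measurable).of_uncurry_left.ennreal_toReal

/-- An integrable majorant of `longJumps f ε x`, uniform for `x` in a ball of radius `ε / 2`. -/
lemma exists_longJumps_majorant (hα : 0 < α) (hφ : IsProfile d α φ) (hM : 0 < M)
    (hf : IsJumpKernel d α φ M c₄ f) (hε : 0 < ε) :
    ∃ g : Rd d → ℝ, Integrable g ∧ (∀ h, 0 ≤ g h) ∧ ∀ x₀ x y, ‖x - x₀‖ ≤ ε / 2 →
      longJumps f ε x y ≤ ENNReal.ofReal (g (y - x₀)) := by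
  -- `1 + ‖y - x₀‖ ≤ 1 + ‖y - x‖ + ε / 2 ≤ c ‖y - x‖` when `‖y - x‖ > ε`
  set c : ℝ := (5 / 2) / min 1 ε with hc
  have hm : 0 < min 1 ε := lt_min one_pos hε
  have hc0 : 0 < c := by positivity
  refine ⟨fun h => M * c ^ (α + d) * (1 + ‖h‖) ^ (-(α + d)),
    (integrable_one_add_norm (by simp [hα])).const_mul _, fun h => by positivity,
    fun x₀ x y hx => ?_⟩
  simp only [longJumps, indicator_apply, mem_ofPred_eq]
  split_ifs with hy
  · refine (hf.le_stable hφ hM (ne_of_lt_norm_sub hε hy)).trans (ENNReal.ofReal_le_ofReal ?_)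
    have hr : 0 < ‖y - x‖ := hε.trans hy
    have h1 : ‖y - x₀‖ ≤ ‖y - x‖ + ‖x - x₀‖ := norm_sub_le_norm_sub_add_norm_sub y x x₀
    have h2 : 1 + ‖y - x₀‖ ≤ c * ‖y - x‖ := by
      rw [hc, div_mul_eq_mul_div, le_div_iff₀ hm]
      have h3 : min 1 ε ≤ 1 := min_le_left _ _
      have h4 : min 1 ε ≤ ε := min_le_right _ _
      nlinarith [norm_nonneg (y - x₀)]
    have h3 := rpow_max_le (n := α + d) hr hc0 (by positivity) h2 (by positivity)
    rw [Real.rpow_neg (by positivity), ← one_div, mul_assoc]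
    gcongr
  · exact zero_le

lemma longJumps_ne_top (hf : IsJumpKernel d α φ M c₄ f) (hε : 0 < ε) (x y : Rd d) :
    longJumps f ε x y ≠ ∞ := by
  simp only [longJumps, indicator_apply, mem_ofPred_eq]
  split_ifs with hy
  · exact ((hf.upper x y (ne_of_lt_norm_sub hε hy)).trans_lt ENNReal.ofReal_lt_top).ne
  · exact ENNReal.zero_ne_top

lemma integrable_mul_longJumps (hα : 0 < α) (hφ : IsProfile d α φ) (hM : 0 < M)
    (hf : IsJumpKernel d α φ M c₄ f) (hε : 0 < ε) {u : Rd d → ℝ} (hu : Measurable u) {C : ℝ}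
    (hC : ∀ y, |u y| ≤ C) (x : Rd d) :
    Integrable fun y => u y * (longJumps f ε x y).toReal := by
  obtain ⟨g, hg, hg0, h⟩ := exists_longJumps_majorant hα hφ hM hf hε
  refine ((hg.comp_sub_right x).const_mul C).mono'
    (hu.mul (measurable_toReal_longJumps hf x)).aestronglyMeasurable (ae_of_all _ fun y => ?_)
  have h1 : (longJumps f ε x y).toReal ≤ g (y - x) :=
    ENNReal.toReal_le_of_le_ofReal (hg0 _) (h x x y (by simp; positivity))
  rw [norm_mul, Real.norm_eq_abs, Real.norm_of_nonneg ENNReal.toReal_nonneg]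
  exact mul_le_mul (hC y) h1 ENNReal.toReal_nonneg ((abs_nonneg _).trans (hC y))

lemma continuous_integral_longJumps (hα : 0 < α) (hφ : IsProfile d α φ) (hM : 0 < M)
    (hf : IsJumpKernel d α φ M c₄ f) (hε : 0 < ε) {u : Rd d → ℝ} (hu : Measurable u) {C : ℝ}
    (hC : ∀ y, |u y| ≤ C) :
    Continuous fun x => ∫ y, u y * (longJumps f ε x y).toReal := by
  obtain ⟨g, hg, hg0, h⟩ := exists_longJumps_majorant hα hφ hM hf hε
  rw [continuous_iff_continuousAt]
  intro x₀
  refine continuousAt_of_dominated (bound := fun y => C * g (y - x₀))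
    (Eventually.of_forall fun x =>
      (hu.mul (measurable_toReal_longJumps hf x)).aestronglyMeasurable) ?_
    ((hg.comp_sub_right x₀).const_mul C) ?_
  · filter_upwards [Metric.closedBall_mem_nhds x₀ (half_pos hε)] with x hx
    refine ae_of_all _ fun y => ?_
    rw [Metric.mem_closedBall, dist_eq_norm] at hx
    have h1 : (longJumps f ε x y).toReal ≤ g (y - x₀) :=
      ENNReal.toReal_le_of_le_ofReal (hg0 _) (h x₀ x y hx)
    rw [norm_mul, Real.norm_eq_abs, Real.norm_of_nonneg ENNReal.toReal_nonneg]
    exact mul_le_mul (hC y) h1 ENNReal.toReal_nonneg ((abs_nonneg _).trans (hC y))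
  · -- The truncation is continuous at `x₀` unless `y` lies on the sphere of radius `ε` about `x₀`.
    have h0 : ∀ᵐ y : Rd d, y ∉ Metric.sphere x₀ ε :=
      measure_eq_zero_iff_ae_notMem.1 (Measure.addHaar_sphere_of_ne_zero _ _ hε.ne')
    filter_upwards [h0] with y hy
    rw [Metric.mem_sphere, dist_eq_norm] at hy
    refine continuousAt_const.mul ?_
    have hcont : ContinuousAt (fun x => ‖y - x‖) x₀ := by fun_prop
    rcases lt_or_gt_of_ne hy with hlt | hgt
    · refine (continuousAt_const (y := (0 : ℝ))).congr ?_
      filter_upwards [hcont.eventually (gt_mem_nhds hlt)] with x hx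
      simp [longJumps, not_lt.2 hx.le]
    · have hne : x₀ ∈ ({y}ᶜ : Set (Rd d)) := fun h => ne_of_lt_norm_sub hε hgt h.symm
      have h2 : ContinuousAt (fun x => f x y) x₀ :=
        (hf.continuousOn y).continuousAt (isOpen_compl_singleton.mem_nhds hne)
      have hfin : f x₀ y ≠ ∞ := by
        simpa [longJumps, hgt] using longJumps_ne_top hf hε x₀ y
      refine ContinuousAt.congr ((ENNReal.tendsto_toReal hfin).comp h2) ?_
      filter_upwards [hcont.eventually (lt_mem_nhds hgt)] with x hx
      simp [longJumps, hx]

lemma tendsto_integral_longJumps_cocompact (hα : 0 < α) (hφ : IsProfile d α φ) (hM : 0 < M)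
    (hf : IsJumpKernel d α φ M c₄ f) (hε : 0 < ε) (u : C₀(Rd d, ℝ)) :
    Tendsto (fun x => ∫ y, u y * (longJumps f ε x y).toReal) (cocompact (Rd d)) (𝓝 0) := by
  obtain ⟨g, hg, hg0, h⟩ := exists_longJumps_majorant hα hφ hM hf hε
  have : IsCountablyGenerated (cocompact (Rd d)) := by
    rw [← Metric.cobounded_eq_cocompact, ← comap_norm_atTop]
    infer_instance
  have hu : Measurable u := u.continuous.measurable
  have e : ∀ x, ∫ y, u y * (longJumps f ε x y).toReal
      = ∫ h, u (x + h) * (longJumps f ε x (x + h)).toReal := fun x =>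
    (integral_add_left_eq_self (fun y => u y * (longJumps f ε x y).toReal) x).symm
  simp only [e]
  have hb : ∀ x h, (longJumps f ε x (x + h)).toReal ≤ g h := fun x y =>
    ENNReal.toReal_le_of_le_ofReal (hg0 _) (by
      simpa using h x x (x + y) (by simp; positivity))
  have h0 := tendsto_integral_filter_of_dominated_convergence (μ := (volume : Measure (Rd d)))
    (l := cocompact (Rd d)) (F := fun x h => u (x + h) * (longJumps f ε x (x + h)).toReal)
    (f := fun _ => 0) (fun h => ‖u‖ * g h) ?_ ?_ (hg.const_mul _) ?_
  · simpa using h0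
  · refine Eventually.of_forall fun x => Measurable.aestronglyMeasurable ?_
    exact (hu.comp (measurable_const_add x)).mul
      ((measurable_toReal_longJumps hf x).comp (measurable_const_add x))
  · refine Eventually.of_forall fun x => ae_of_all _ fun h => ?_
    rw [norm_mul, Real.norm_eq_abs, Real.norm_of_nonneg ENNReal.toReal_nonneg]
    exact mul_le_mul (abs_apply_le_norm u _) (hb x h) ENNReal.toReal_nonneg (norm_nonneg _)
  · refine ae_of_all _ fun h => ?_
    have h1 : Tendsto (fun x => u (x + h)) (cocompact (Rd d)) (𝓝 0) :=
      (zero_at_infty u).comp (Homeomorph.addRight h).isClosedEmbedding.tendsto_cocompact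
    refine squeeze_zero_norm (a := fun x => |u (x + h)| * g h) (fun x => ?_) ?_
    · rw [norm_mul, Real.norm_eq_abs, Real.norm_of_nonneg ENNReal.toReal_nonneg]
      exact mul_le_mul_of_nonneg_left (hb x h) (abs_nonneg _)
    · simpa using h1.abs.mul_const (g h)

/-- The bounded positive operator `T` on `C₀` for which `T - Λ` is the generator of the jumps longer
than `ε`. Continuity of `T u` is where the continuity of `f` in its first variable enters. -/
lemma exists_truncatedOperator (hα : 0 < α) (hφ : IsProfile d α φ) (hM : 0 < M)
    (hf : IsJumpKernel d α φ M c₄ f) (hε : 0 < ε) {Λ : ℝ} (hΛ0 : 0 ≤ Λ)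
    (hΛ : ∀ x, longRate f ε x ≤ ENNReal.ofReal Λ) :
    ∃ T : C₀(Rd d, ℝ) →L[ℝ] C₀(Rd d, ℝ), ‖T‖ ≤ Λ ∧
      (∀ u x, T u x - Λ * u x = ∫ y in {y | ε < ‖y - x‖}, jumpIntegrand f u x y) ∧
      ∀ u : C₀(Rd d, ℝ), (∀ x, 0 ≤ u x) → ∀ x, 0 ≤ T u x ∧
        ENNReal.ofReal (T u x)
          = kernelOp volume (longJumps f ε) (holdRate f ε Λ) (fun y => ENNReal.ofReal (u y)) x := by
  have hint : ∀ (u : C₀(Rd d, ℝ)) x, Integrable fun y => u y * (longJumps f ε x y).toReal :=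
    fun u => integrable_mul_longJumps hα hφ hM hf hε u.continuous.measurable (abs_apply_le_norm u)
  have hint1 : ∀ x, Integrable fun y => (longJumps f ε x y).toReal := by
    intro x
    simpa using integrable_mul_longJumps hα hφ hM hf hε (u := fun _ => 1) measurable_const
      (C := 1) (by simp) x
  set r : Rd d → ℝ := fun x => ∫ y, (longJumps f ε x y).toReal with hr
  have hrate : ∀ x, longRate f ε x = ENNReal.ofReal (r x) := by
    intro x
    rw [hr, ofReal_integral_eq_lintegral_ofReal (hint1 x)
      (ae_of_all _ fun _ => ENNReal.toReal_nonneg)]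
    exact lintegral_congr fun y => (ENNReal.ofReal_toReal (longJumps_ne_top hf hε x y)).symm
  have hr0 : ∀ x, 0 ≤ r x := fun x => integral_nonneg fun _ => ENNReal.toReal_nonneg
  have hrΛ : ∀ x, r x ≤ Λ := fun x =>
    (ENNReal.ofReal_le_ofReal_iff hΛ0).1 ((hrate x).symm.le.trans (hΛ x))
  have hrc : Continuous r := by
    simpa using continuous_integral_longJumps hα hφ hM hf hε (u := fun _ => 1) measurable_const
      (C := 1) (by simp)
  let T₀ : C₀(Rd d, ℝ) →ₗ[ℝ] C₀(Rd d, ℝ) :=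
    { toFun := fun u =>
        { toFun := fun x => (∫ y, u y * (longJumps f ε x y).toReal) + (Λ - r x) * u x
          continuous_toFun := (continuous_integral_longJumps hα hφ hM hf hε u.continuous.measurable
            (abs_apply_le_norm u)).add ((continuous_const.sub hrc).mul u.continuous)
          zero_at_infty' := by
            have h1 := tendsto_integral_longJumps_cocompact hα hφ hM hf hε u
            have h2 : Tendsto (fun x => (Λ - r x) * u x) (cocompact (Rd d)) (𝓝 0) := by
              refine squeeze_zero_norm (a := fun x => Λ * |u x|) (fun x => ?_) ?_
              · rw [norm_mul, Real.norm_of_nonneg (by linarith [hrΛ x]), Real.norm_eq_abs]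
                gcongr
                linarith [hr0 x]
              · simpa using (zero_at_infty u).abs.const_mul Λ
            simpa using h1.add h2 }
      map_add' := by
        intro u v
        ext x
        simp only [ZeroAtInftyContinuousMap.coe_add, Pi.add_apply, add_mul,
          ZeroAtInftyContinuousMap.coe_mk]
        rw [integral_add (hint u x) (hint v x)]
        ring
      map_smul' := by
        intro c u
        ext x
        simp only [ZeroAtInftyContinuousMap.coe_smul, Pi.smul_apply, smul_eq_mul, RingHom.id_apply,
          ZeroAtInftyContinuousMap.coe_mk, mul_assoc]
        rw [integral_const_mul]
        ring }
  have hT₀ : ∀ u x, T₀ u x = (∫ y, u y * (longJumps f ε x y).toReal) + (Λ - r x) * u x :=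
    fun u x => rfl
  have hbound : ∀ u, ‖T₀ u‖ ≤ Λ * ‖u‖ := by
    intro u
    refine norm_le_of_forall_abs_le (by positivity) fun x => ?_
    rw [hT₀]
    have h1 : |∫ y, u y * (longJumps f ε x y).toReal| ≤ ‖u‖ * r x := by
      rw [← Real.norm_eq_abs, hr, ← integral_const_mul]
      refine norm_integral_le_of_norm_le ((hint1 x).const_mul _) (ae_of_all _ fun y => ?_)
      rw [norm_mul, Real.norm_eq_abs, Real.norm_of_nonneg ENNReal.toReal_nonneg]
      exact mul_le_mul_of_nonneg_right (abs_apply_le_norm u y) ENNReal.toReal_nonneg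
    have h2 : |(Λ - r x) * u x| ≤ (Λ - r x) * ‖u‖ := by
      rw [abs_mul, abs_of_nonneg (by linarith [hrΛ x])]
      exact mul_le_mul_of_nonneg_left (abs_apply_le_norm u x) (by linarith [hrΛ x])
    calc _ ≤ _ := abs_add_le _ _
      _ ≤ ‖u‖ * r x + (Λ - r x) * ‖u‖ := add_le_add h1 h2
      _ = _ := by ring
  refine ⟨T₀.mkContinuous Λ hbound, T₀.mkContinuous_norm_le hΛ0 hbound, fun u x => ?_,
    fun u hu x => ?_⟩
  · rw [LinearMap.mkContinuous_apply, hT₀]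
    have hS : MeasurableSet {y : Rd d | ε < ‖y - x‖} :=
      measurableSet_lt measurable_const (measurable_id.sub_const x).norm
    rw [← integral_indicator hS]
    have e : ∀ y, {y : Rd d | ε < ‖y - x‖}.indicator (jumpIntegrand f u x) y
        = u y * (longJumps f ε x y).toReal - (longJumps f ε x y).toReal * u x := by
      intro y
      simp only [longJumps, indicator_apply, mem_ofPred_eq, jumpIntegrand]
      split_ifs
      · ring
      · simp
    simp only [e]
    rw [integral_sub (hint u x) ((hint1 x).mul_const _), integral_mul_const]
    ring
  · rw [LinearMap.mkContinuous_apply, hT₀]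
    have p1 : 0 ≤ ∫ y, u y * (longJumps f ε x y).toReal :=
      integral_nonneg fun y => mul_nonneg (hu y) ENNReal.toReal_nonneg
    have p2 : 0 ≤ (Λ - r x) * u x := mul_nonneg (by linarith [hrΛ x]) (hu x)
    refine ⟨add_nonneg p1 p2, ?_⟩
    rw [ENNReal.ofReal_add p1 p2, kernelOp, holdRate, hrate, ← ENNReal.ofReal_sub _ (hr0 x),
      ENNReal.ofReal_mul (by linarith [hrΛ x]), ofReal_integral_eq_lintegral_ofReal (hint u x)
      (ae_of_all _ fun y => mul_nonneg (hu y) ENNReal.toReal_nonneg)]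
    congr 1
    refine lintegral_congr fun y => ?_
    rw [ENNReal.ofReal_mul (hu y), ENNReal.ofReal_toReal (longJumps_ne_top hf hε x y), mul_comm]

end TruncatedOperator

section Consistency

variable {d : ℕ} {α : ℝ} {φ : ℝ → ℝ} {M c₄ : ℝ} {f : Rd d → Rd d → ℝ≥0∞} {δ ε : ℝ}

lemma midJumps_ne_top (hf : IsJumpKernel d α φ M c₄ f) (hδ : 0 < δ) (x y : Rd d) :
    midJumps f δ ε x y ≠ ∞ := by
  simp only [midJumps, indicator_apply, mem_ofPred_eq]
  split_ifs with hy
  · exact ((hf.upper x y (ne_of_lt_norm_sub hδ hy.1)).trans_lt ENNReal.ofReal_lt_top).ne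
  · exact ENNReal.zero_ne_top

lemma exists_abs_integral_midJumps_le (hd : 1 ≤ d) (hφ : IsProfile d α φ) (hM : 0 < M)
    (hf : IsJumpKernel d α φ M c₄ f) {p : ℕ} (hp : α < p) {K : ℝ} (hK : 0 < K) :
    ∃ D : ℝ, 0 < D ∧ ∀ δ ε, 0 < δ → 0 < ε → ∀ (x : Rd d) (g : Rd d → ℝ),
      (∀ h, |g h| ≤ K * ‖h‖ ^ p * (midJumps f δ ε x (x + h)).toReal) →
      |∫ h, g h| ≤ D * ε ^ (p - α) := by
  obtain ⟨D, hD, hmom⟩ := exists_midJumps_moment_le hd hφ hM c₄ hp hK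
  refine ⟨D, hD, fun δ ε hδ hε x g hg => ?_⟩
  refine (ENNReal.ofReal_le_ofReal_iff (by positivity)).1 ?_
  calc ENNReal.ofReal |∫ h, g h| = ‖∫ h, g h‖ₑ := by
        rw [← Real.norm_eq_abs, ofReal_norm]
    _ ≤ ∫⁻ h, ‖g h‖ₑ := enorm_integral_le_lintegral_enorm g
    _ ≤ ∫⁻ h, ENNReal.ofReal (ε ^ p)
          * (midJumps f δ ε x (x + h) * ENNReal.ofReal (K * (‖h‖ / ε) ^ p)) := by
        refine lintegral_mono fun h => ?_
        rw [← ofReal_norm, Real.norm_eq_abs]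
        refine (ENNReal.ofReal_le_ofReal (hg h)).trans (le_of_eq ?_)
        rw [ENNReal.ofReal_mul (by positivity), ENNReal.ofReal_toReal (midJumps_ne_top hf hδ _ _),
          mul_left_comm, ← ENNReal.ofReal_mul (by positivity), mul_comm]
        congr 2
        rw [div_pow]
        field_simp
    _ ≤ ENNReal.ofReal (ε ^ p) * ENNReal.ofReal (D * ε ^ (-α)) := by
        rw [lintegral_const_mul' _ _ ENNReal.ofReal_ne_top]
        gcongr
        exact hmom f hf ε δ ε hε hδ hε le_rfl x
    _ = _ := by
        rw [← ENNReal.ofReal_mul (by positivity), sub_eq_add_neg, Real.rpow_add hε,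
          Real.rpow_natCast]
        congr 1
        ring

/-- On `C²_c` the truncated operators converge uniformly, with a rate. -/
lemma exists_truncation_error (hd : 1 ≤ d) (hα : α ∈ Ioo (0 : ℝ) 2) (hφ : IsProfile d α φ)
    (hM : 0 < M) (hf : IsJumpKernel d α φ M c₄ f) {w : C₀(Rd d, ℝ) × C₀(Rd d, ℝ)}
    (hw : w ∈ nonlocalGraph f) :
    ∃ C q : ℝ, 0 < C ∧ 0 < q ∧ ∀ ε, 0 < ε → ∀ x,
      |w.2 x - ∫ y in {y | ε < ‖y - x‖}, jumpIntegrand f w.1 x y| ≤ C * ε ^ q := by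
  obtain ⟨hu, hc, hlim⟩ := hw
  obtain ⟨u, v⟩ := w
  simp only at hu hc hlim ⊢
  obtain ⟨K, hK, hK1, hK2⟩ := exists_difference_bound hu hc
  have hS : ∀ (x : Rd d) (ε : ℝ), MeasurableSet {y : Rd d | ε < ‖y - x‖} := fun x ε =>
    measurableSet_lt measurable_const (measurable_id.sub_const x).norm
  have hA : ∀ (x : Rd d) (δ ε : ℝ), MeasurableSet {y : Rd d | δ < ‖y - x‖ ∧ ‖y - x‖ ≤ ε} :=
    fun x δ ε => (hS x δ).inter
      (measurableSet_le (measurable_id.sub_const x).norm measurable_const)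
  set g : ℝ → ℝ → Rd d → Rd d → ℝ := fun δ ε x h =>
    (u (x + h) - u x) * (midJumps f δ ε x (x + h)).toReal with hg
  have hshift : ∀ δ ε x, (fun h => {y : Rd d | δ < ‖y - x‖ ∧ ‖y - x‖ ≤ ε}.indicator
      (jumpIntegrand f u x) (x + h)) = g δ ε x := by
    intro δ ε x
    funext h
    simp only [hg, midJumps, jumpIntegrand, indicator_apply]
    split_ifs
    · rfl
    · simp
  have hgint : ∀ δ ε x, 0 < δ → Integrable (g δ ε x) := by
    intro δ ε x hδ
    rw [← hshift]
    exact Integrable.comp_add_left (((integrable_indicator_iff (hA x δ ε)).2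
      (((hlim x).1 δ hδ).mono_set fun y hy => hy.1))) x
  have hdiff : ∀ δ ε x, 0 < δ → δ < ε → (∫ y in {y | δ < ‖y - x‖}, jumpIntegrand f u x y)
      - ∫ y in {y | ε < ‖y - x‖}, jumpIntegrand f u x y = ∫ h, g δ ε x h := by
    intro δ ε x hδ hε
    have e : {y : Rd d | δ < ‖y - x‖}
        = {y | δ < ‖y - x‖ ∧ ‖y - x‖ ≤ ε} ∪ {y | ε < ‖y - x‖} := by
      ext y
      simp only [mem_ofPred_eq, mem_union]
      constructor
      · intro h
        rcases le_or_gt ‖y - x‖ ε with h1 | h1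
        · exact Or.inl ⟨h, h1⟩
        · exact Or.inr h1
      · rintro (h | h)
        · exact h.1
        · exact hε.trans h
    have hdisj : Disjoint {y : Rd d | δ < ‖y - x‖ ∧ ‖y - x‖ ≤ ε} {y | ε < ‖y - x‖} := by
      rw [Set.disjoint_left]
      intro y hy hy'
      exact absurd hy.2 (not_le.2 hy')
    rw [e, setIntegral_union hdisj (hS x ε)
      (((hlim x).1 δ hδ).mono_set fun y hy => hy.1) ((hlim x).1 ε (hδ.trans hε)),
      add_sub_cancel_right, ← integral_indicator (hA x δ ε), ← integral_add_left_eq_self _ x,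
      hshift]
  have key : ∃ C q : ℝ, 0 < C ∧ 0 < q ∧ ∀ δ ε, 0 < δ → 0 < ε → ∀ x,
      |∫ h, g δ ε x h| ≤ C * ε ^ q := by
    rcases hf.balanced with hbal | hα1
    -- symmetrizing in `h` gives a second difference, and second moments of short jumps are finite
    · obtain ⟨D, hD, hb⟩ := exists_abs_integral_midJumps_le hd hφ hM hf (p := 2)
        (by simpa using hα.2) hK
      refine ⟨D, ((2 : ℕ) : ℝ) - α, hD, ?_, fun δ ε hδ hε x => ?_⟩
      rotate_left
      · have hneg : ∀ h, (midJumps f δ ε x (x + -h)).toReal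
            = (midJumps f δ ε x (x + h)).toReal := by
          intro h
          simp only [midJumps, indicator_apply, mem_ofPred_eq, add_sub_cancel_left, norm_neg]
          rw [hbal x h, sub_eq_add_neg]
        have e : ∫ h, (g δ ε x h + g δ ε x (-h)) = 2 * ∫ h, g δ ε x h := by
          rw [integral_add (hgint δ ε x hδ) (hgint δ ε x hδ).comp_neg, integral_neg_eq_self,
            two_mul]
        have h1 := hb δ ε hδ hε x (fun h => g δ ε x h + g δ ε x (-h)) (fun h => by
          simp only [hg, hneg]
          rw [← add_mul, abs_mul, abs_of_nonneg (ENNReal.toReal_nonneg (a := midJumps f δ ε x _))]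
          refine mul_le_mul_of_nonneg_right ?_ ENNReal.toReal_nonneg
          refine le_trans (le_of_eq ?_) (hK2 x h)
          congr 1
          rw [← sub_eq_add_neg x h]
          ring)
        rw [e, abs_mul, abs_two] at h1
        linarith [abs_nonneg (∫ h, g δ ε x h)]
      · simpa using hα.2
    · obtain ⟨D, hD, hb⟩ := exists_abs_integral_midJumps_le hd hφ hM hf (p := 1)
        (by simpa using hα1) hK
      refine ⟨D, ((1 : ℕ) : ℝ) - α, hD, ?_, fun δ ε hδ hε x => hb δ ε hδ hε x _ fun h => ?_⟩
      · simpa using hα1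
      · simp only [hg]
        rw [abs_mul, abs_of_nonneg (ENNReal.toReal_nonneg (a := midJumps f δ ε x _)), pow_one]
        exact mul_le_mul_of_nonneg_right (hK1 x h) ENNReal.toReal_nonneg
  obtain ⟨C, q, hC, hq, hb⟩ := key
  refine ⟨C, q, hC, hq, fun ε hε x => ?_⟩
  have ht : Tendsto (fun δ : ℝ => |(∫ y in {y | δ < ‖y - x‖}, jumpIntegrand f u x y)
      - ∫ y in {y | ε < ‖y - x‖}, jumpIntegrand f u x y|) (𝓝[>] 0)
      (𝓝 |v x - ∫ y in {y | ε < ‖y - x‖}, jumpIntegrand f u x y|) :=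
    ((hlim x).2.sub_const _).abs
  refine le_of_tendsto ht ?_
  filter_upwards [Ioo_mem_nhdsGT hε] with δ hδ
  rw [hdiff δ ε x hδ.1 hδ.2]
  exact hb δ ε hδ.1 hε x

end Consistency

/-! ### Semigroups with bounded generators -/

section BoundedGenerator

variable {X : Type*} [NormedAddCommGroup X] [NormedSpace ℝ X] {T : X →L[ℝ] X} {Λ t r : ℝ}

/-- The semigroup `e^{t (T - Λ)}` of a bounded operator `T`. -/
def expSemigroup (T : X →L[ℝ] X) (Λ t : ℝ) : X →L[ℝ] X :=
  Real.exp (-(Λ * t)) • NormedSpace.exp (t • T)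

lemma expSemigroup_zero : expSemigroup T Λ 0 = 1 := by simp [expSemigroup]

lemma norm_pow_apply_le (hT : ‖T‖ ≤ Λ) (n : ℕ) (u : X) : ‖(T ^ n) u‖ ≤ Λ ^ n * ‖u‖ := by
  have hΛ : 0 ≤ Λ := (norm_nonneg T).trans hT
  induction n with
  | zero => simp
  | succ n ih =>
    rw [pow_succ', mul_apply_eq_comp]
    calc ‖T ((T ^ n) u)‖ ≤ ‖T‖ * ‖(T ^ n) u‖ := T.le_opNorm _
      _ ≤ Λ * (Λ ^ n * ‖u‖) := by gcongr
      _ = _ := by ring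

variable [CompleteSpace X]

lemma hasSum_expSemigroup (T : X →L[ℝ] X) (Λ t : ℝ) (u : X) :
    HasSum (fun n : ℕ => Real.exp (-(Λ * t)) • (t ^ n / n.factorial) • (T ^ n) u)
      (expSemigroup T Λ t u) := by
  have h := (NormedSpace.exp_series_hasSum_exp' (𝕂 := ℝ) (t • T)).mapL
    (ContinuousLinearMap.apply ℝ X u)
  have h2 := h.const_smul (Real.exp (-(Λ * t)))
  convert! h2 using 1
  funext n
  simp only [ContinuousLinearMap.apply_apply, smul_pow, smul_apply]
  rw [smul_smul ((n.factorial : ℝ)⁻¹), div_eq_inv_mul]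

lemma norm_expSemigroup_le (hT : ‖T‖ ≤ Λ) (ht : 0 ≤ t) : ‖expSemigroup T Λ t‖ ≤ 1 := by
  refine ContinuousLinearMap.opNorm_le_bound _ zero_le_one fun u => ?_
  have h : HasSum (fun n : ℕ => Real.exp (-(Λ * t)) * ((t * Λ) ^ n / n.factorial * ‖u‖))
      (Real.exp (-(Λ * t)) * (Real.exp (t * Λ) * ‖u‖)) := by
    have := NormedSpace.expSeries_div_hasSum_exp (t * Λ)
    rw [← Real.exp_eq_exp_ℝ] at this
    exact (this.mul_right _).mul_left _
  have h1 := (hasSum_expSemigroup T Λ t u)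
  rw [← h1.tsum_eq]
  refine (tsum_of_norm_bounded h fun n => ?_).trans (le_of_eq ?_)
  · rw [norm_smul, norm_smul, Real.norm_of_nonneg (Real.exp_pos _).le,
      Real.norm_of_nonneg (by positivity), mul_pow]
    have := norm_pow_apply_le hT n u
    calc _ ≤ Real.exp (-(Λ * t)) * (t ^ n / n.factorial * (Λ ^ n * ‖u‖)) := by gcongr
      _ = _ := by ring
  · rw [← mul_assoc, ← Real.exp_add]
    simp [mul_comm]

lemma expSemigroup_add (t r : ℝ) :
    expSemigroup T Λ (t + r) = expSemigroup T Λ t * expSemigroup T Λ r := by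
  let _ : NormedAlgebra ℚ (X →L[ℝ] X) := NormedAlgebra.restrictScalars ℚ ℝ _
  unfold expSemigroup
  rw [add_smul, NormedSpace.exp_add_of_commute ((Commute.refl T).smul_left t |>.smul_right r),
    smul_mul_smul_comm, ← Real.exp_add]
  congr 2
  ring

lemma hasDerivAt_expSemigroup (t : ℝ) :
    HasDerivAt (expSemigroup T Λ) (expSemigroup T Λ t * (T - Λ • 1)) t := by
  have h1 : HasDerivAt (fun t : ℝ => Real.exp (-(Λ * t))) (Real.exp (-(Λ * t)) * -Λ) t := by
    have := ((hasDerivAt_id t).const_mul Λ).neg.exp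
    simpa using this
  have h2 := h1.smul (hasDerivAt_exp_smul_const (𝕂 := ℝ) T t)
  refine h2.congr_deriv ?_
  unfold expSemigroup
  rw [mul_sub, smul_mul_assoc, mul_smul_comm, mul_one, smul_smul, mul_neg, neg_smul,
    mul_comm Λ (Real.exp _)]
  abel

/-- The resolvent at `1` of `T - Λ`. It is a contraction because `‖T‖ ≤ Λ`. -/
lemma exists_resolvent (hT : ‖T‖ ≤ Λ) : ∃ R : X →L[ℝ] X, ‖R‖ ≤ 1 ∧
    R * (1 - (T - Λ • 1)) = 1 ∧ (1 - (T - Λ • 1)) * R = 1 := by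
  have hΛ : 0 ≤ Λ := (norm_nonneg T).trans hT
  have h1 : IsUnit (1 - (1 + Λ)⁻¹ • T) := by
    refine isUnit_one_sub_of_norm_lt_one ?_
    rw [norm_smul, norm_inv, Real.norm_of_nonneg (by linarith), inv_mul_lt_iff₀ (by linarith)]
    linarith
  have e : (1 - (T - Λ • 1) : X →L[ℝ] X) = (1 + Λ) • (1 - (1 + Λ)⁻¹ • T) := by
    rw [smul_sub, smul_smul, mul_inv_cancel₀ (by linarith), add_smul, one_smul, one_smul]
    abel
  have h2 : IsUnit (1 - (T - Λ • 1) : X →L[ℝ] X) := by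
    rw [e]
    exact h1.smul (Units.mk0 (1 + Λ) (by linarith))
  obtain ⟨v, hv⟩ := h2
  refine ⟨↑v⁻¹, ContinuousLinearMap.opNorm_le_bound _ zero_le_one fun w => ?_, ?_, ?_⟩
  · set u := (↑v⁻¹ : X →L[ℝ] X) w with hu
    have h3 : w = (1 + Λ) • u - T u := by
      have : (v : X →L[ℝ] X) u = w := by
        rw [hu, ← mul_apply_eq_comp, v.mul_inv]
        rfl
      rw [← this, hv]
      simp [add_smul]
      abel
    have h4 : (1 + Λ) * ‖u‖ - Λ * ‖u‖ ≤ ‖w‖ := by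
      rw [h3]
      refine le_trans ?_ (norm_sub_norm_le _ _)
      rw [norm_smul, Real.norm_of_nonneg (by linarith)]
      have := (T.le_opNorm u).trans (mul_le_mul_of_nonneg_right hT (norm_nonneg u))
      linarith
    linarith
  · rw [← hv, v.inv_mul]
  · rw [← hv, v.mul_inv]

end BoundedGenerator

/-! ### Strongly continuous contraction semigroups -/

section Semigroup

variable {X : Type*} [NormedAddCommGroup X] [NormedSpace ℝ X] {P : ℝ → X →L[ℝ] X}

/-- Strong convergence of uniformly bounded operators may be tested near each point. -/
lemma tendsto_of_approx {E F : Type*} [NormedAddCommGroup E] [NormedSpace ℝ E]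
    [NormedAddCommGroup F] [NormedSpace ℝ F] {ι : Type*} {l : Filter ι} {A : ι → E →L[ℝ] F}
    {B : E →L[ℝ] F} {C : ℝ} (hC : 0 < C) (hA : ∀ i, ‖A i‖ ≤ C) (hB : ‖B‖ ≤ C) {g : E}
    (h : ∀ η, 0 < η → ∃ w, ‖g - w‖ < η ∧ Tendsto (fun i => A i w) l (𝓝 (B w))) :
    Tendsto (fun i => A i g) l (𝓝 (B g)) := by
  rw [Metric.tendsto_nhds]
  intro η hη
  obtain ⟨w, hw, hlim⟩ := h (η / (3 * C)) (by positivity)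
  rw [lt_div_iff₀ (by positivity)] at hw
  filter_upwards [(Metric.tendsto_nhds.1 hlim) (η / 3) (by positivity)] with i hi
  rw [dist_eq_norm] at hi ⊢
  have h1 : ‖A i (g - w)‖ ≤ C * ‖g - w‖ :=
    ((A i).le_opNorm _).trans (mul_le_mul_of_nonneg_right (hA i) (norm_nonneg _))
  have h2 : ‖B (g - w)‖ ≤ C * ‖g - w‖ :=
    (B.le_opNorm _).trans (mul_le_mul_of_nonneg_right hB (norm_nonneg _))
  calc ‖A i g - B g‖ = ‖A i (g - w) + (A i w - B w) - B (g - w)‖ := by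
        rw [map_sub, map_sub]; congr 1; abel
    _ ≤ ‖A i (g - w)‖ + ‖A i w - B w‖ + ‖B (g - w)‖ :=
        (norm_sub_le _ _).trans (add_le_add_left (norm_add_le _ _) _)
    _ < η := by linarith

lemma IsContractionSemigroup.norm_apply_le (hP : IsContractionSemigroup P) {t : ℝ} (ht : 0 ≤ t)
    (u : X) : ‖P t u‖ ≤ ‖u‖ := by
  have := (P t).le_opNorm u
  have h1 := hP.contraction t ht
  nlinarith [norm_nonneg u]

lemma IsContractionSemigroup.norm_sub_le (hP : IsContractionSemigroup P) {t r : ℝ} (ht : 0 ≤ t)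
    (hr : 0 ≤ r) (u : X) : ‖P t u - P r u‖ ≤ ‖P |t - r| u - u‖ := by
  wlog h : r ≤ t generalizing t r
  · rw [norm_sub_rev, abs_sub_comm]
    exact this hr ht (le_of_not_ge h)
  rw [abs_of_nonneg (sub_nonneg.2 h)]
  have e : P t u = P r (P (t - r) u) := by
    rw [← ContinuousLinearMap.comp_apply, ← hP.add r (t - r) hr (sub_nonneg.2 h),
      add_sub_cancel]
  rw [e, ← map_sub]
  exact hP.norm_apply_le hr _

/-- Orbits, extended evenly to negative times, are continuous. -/
lemma IsContractionSemigroup.continuous_abs (hP : IsContractionSemigroup P) (u : X) :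
    Continuous fun t : ℝ => P |t| u := by
  have h0 : Tendsto (fun t : ℝ => P |t| u) (𝓝 0) (𝓝 u) := by
    have h1 : Tendsto (fun t => P t u) (𝓝[≥] 0) (𝓝 u) := by
      have h2 : ContinuousWithinAt (fun t => P t u) (Ici 0) 0 := by
        rw [← continuousWithinAt_Ioi_iff_Ici]
        have := hP.strongly_continuous u
        rwa [ContinuousWithinAt, hP.zero, ContinuousLinearMap.id_apply]
      have h3 := h2.tendsto
      rwa [hP.zero, ContinuousLinearMap.id_apply] at h3
    refine h1.comp (tendsto_nhdsWithin_iff.2 ⟨?_, Eventually.of_forall fun t => abs_nonneg t⟩)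
    simpa using (_root_.continuous_abs.tendsto (0 : ℝ))
  rw [continuous_iff_continuousAt]
  intro t
  rw [ContinuousAt, tendsto_iff_norm_sub_tendsto_zero]
  have h1 : Tendsto (fun r : ℝ => ‖P |(|r| - |t|)| u - u‖) (𝓝 t) (𝓝 0) := by
    have h2 : Tendsto (fun r : ℝ => |r| - |t|) (𝓝 t) (𝓝 0) := by
      have := ((_root_.continuous_abs.tendsto t).sub_const |t|)
      simpa using this
    have h3 := ((h0.comp h2).sub_const u).norm
    simpa using h3
  exact squeeze_zero (fun _ => norm_nonneg _)
    (fun r => hP.norm_sub_le (abs_nonneg r) (abs_nonneg t) u) h1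

lemma IsContractionSemigroup.generator_orbit (hP : IsContractionSemigroup P) {u v : X}
    (h : (u, v) ∈ generatorGraph P) {s : ℝ} (hs : 0 ≤ s) :
    (P s u, P s v) ∈ generatorGraph P := by
  have h1 : Tendsto (fun t : ℝ => P s (t⁻¹ • (P t u - u))) (𝓝[>] 0) (𝓝 (P s v)) :=
    ((P s).continuous.tendsto v).comp h
  refine h1.congr' ?_
  filter_upwards [self_mem_nhdsWithin] with t ht
  change 0 < t at ht
  rw [map_smul, map_sub, ← ContinuousLinearMap.comp_apply, ← hP.add s t hs ht.le, add_comm,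
    hP.add t s ht.le hs, ContinuousLinearMap.comp_apply]

lemma IsContractionSemigroup.hasDerivWithinAt_orbit (hP : IsContractionSemigroup P) {u v : X}
    (h : (u, v) ∈ generatorGraph P) {s : ℝ} (hs : 0 ≤ s) :
    HasDerivWithinAt (fun t => P t u) (P s v) (Ioi s) s := by
  rw [hasDerivWithinAt_iff_tendsto_slope' (by simp)]
  have h1 := hP.generator_orbit h hs
  have h2 : Tendsto (fun r : ℝ => r - s) (𝓝[>] s) (𝓝[>] 0) := by
    refine tendsto_nhdsWithin_iff.2 ⟨?_, ?_⟩
    · have : Tendsto (fun r : ℝ => r - s) (𝓝 s) (𝓝 (s - s)) := by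
        exact (continuous_id.sub continuous_const).tendsto s
      rw [sub_self] at this
      exact this.mono_left nhdsWithin_le_nhds
    · filter_upwards [self_mem_nhdsWithin] with r hr
      exact sub_pos.2 (mem_Ioi.1 hr)
  refine (Tendsto.comp h1 h2).congr' ?_
  filter_upwards [self_mem_nhdsWithin] with r hr
  change s < r at hr
  simp only [Function.comp_apply, slope_def_module]
  rw [← ContinuousLinearMap.comp_apply, ← hP.add (r - s) s (by linarith) hs, sub_add_cancel]

variable [CompleteSpace X]

lemma IsContractionSemigroup.tendsto_average (hP : IsContractionSemigroup P) (g : X) {τ : ℝ}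
    (hτ : 0 ≤ τ) :
    Tendsto (fun t : ℝ => t⁻¹ • ((∫ s in (0 : ℝ)..(τ + t), P |s| g) - ∫ s in (0 : ℝ)..τ, P |s| g))
      (𝓝[>] 0) (𝓝 (P τ g)) := by
  have h := (hP.continuous_abs g).integral_hasStrictDerivAt 0 τ |>.hasDerivAt
  rw [hasDerivAt_iff_tendsto_slope_zero, abs_of_nonneg hτ] at h
  exact h.mono_left (nhdsWithin_mono _ fun t ht => ne_of_gt ht)

/-- Time averages of an orbit lie in the domain of the generator. -/
lemma IsContractionSemigroup.integral_mem_generatorGraph (hP : IsContractionSemigroup P) (g : X)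
    {τ : ℝ} (hτ : 0 ≤ τ) :
    (∫ s in (0 : ℝ)..τ, P |s| g, P τ g - g) ∈ generatorGraph P := by
  have hc := hP.continuous_abs g
  have h0 := hP.tendsto_average g le_rfl
  simp only [zero_add, intervalIntegral.integral_same, sub_zero, hP.zero,
    ContinuousLinearMap.id_apply] at h0
  refine ((hP.tendsto_average g hτ).sub h0).congr' ?_
  filter_upwards [self_mem_nhdsWithin] with t ht
  change 0 < t at ht
  rw [← smul_sub]
  congr 1
  have e1 : P t (∫ s in (0 : ℝ)..τ, P |s| g) = ∫ s in t..(τ + t), P |s| g := by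
    rw [← ContinuousLinearMap.intervalIntegral_comp_comm _ (hc.intervalIntegrable _ _)]
    have := intervalIntegral.integral_comp_add_right (a := 0) (b := τ) (fun s => P |s| g) t
    rw [zero_add] at this
    rw [← this]
    refine intervalIntegral.integral_congr fun s hs => ?_
    rw [uIcc_of_le hτ] at hs
    rw [abs_of_nonneg hs.1, abs_of_nonneg (by linarith [hs.1]), add_comm, hP.add t s ht.le hs.1]
    rfl
  have e2 := intervalIntegral.integral_add_adjacent_intervals
    (hc.intervalIntegrable (μ := volume) 0 t) (hc.intervalIntegrable t (τ + t))
  rw [e1, ← e2]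
  abel

lemma IsContractionSemigroup.exists_generator_approx (hP : IsContractionSemigroup P) (g : X)
    {η : ℝ} (hη : 0 < η) :
    ∃ τ : ℝ, 0 < τ ∧ ‖g - τ⁻¹ • ∫ s in (0 : ℝ)..τ, P |s| g‖ < η := by
  have h0 := hP.tendsto_average g le_rfl
  simp only [zero_add, intervalIntegral.integral_same, sub_zero, hP.zero,
    ContinuousLinearMap.id_apply] at h0
  have h1 := (Metric.tendsto_nhds.1 h0 η hη).and self_mem_nhdsWithin
  obtain ⟨τ, hτ, hτ0⟩ := h1.exists
  refine ⟨τ, hτ0, ?_⟩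
  rwa [dist_comm, dist_eq_norm] at hτ

/-- The domain of the square of the generator is dense. -/
lemma IsContractionSemigroup.exists_generator_sq_approx (hP : IsContractionSemigroup P) (g : X)
    {η : ℝ} (hη : 0 < η) :
    ∃ w u v : X, ‖g - w‖ < η ∧ (w, w - u) ∈ generatorGraph P ∧ (u, v) ∈ generatorGraph P := by
  obtain ⟨τ, hτ, h1⟩ := hP.exists_generator_approx g (half_pos hη)
  set u₀ := τ⁻¹ • ∫ s in (0 : ℝ)..τ, P |s| g with hu₀
  have m₀ : (u₀, τ⁻¹ • (P τ g - g)) ∈ generatorGraph P :=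
    (generatorGraph P).smul_mem τ⁻¹ (hP.integral_mem_generatorGraph g hτ.le)
  obtain ⟨σ, hσ, h2⟩ := hP.exists_generator_approx u₀ (half_pos hη)
  set w := σ⁻¹ • ∫ s in (0 : ℝ)..σ, P |s| u₀ with hw
  have m₁ : (w, σ⁻¹ • (P σ u₀ - u₀)) ∈ generatorGraph P :=
    (generatorGraph P).smul_mem σ⁻¹ (hP.integral_mem_generatorGraph u₀ hσ.le)
  have m₂ := (generatorGraph P).sub_mem m₁ ((generatorGraph P).smul_mem σ⁻¹
    ((generatorGraph P).sub_mem (hP.generator_orbit m₀ hσ.le) m₀))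
  refine ⟨w, w - σ⁻¹ • (P σ u₀ - u₀), _, ?_, by simpa using m₁, m₂⟩
  calc ‖g - w‖ = ‖(g - u₀) + (u₀ - w)‖ := by congr 1; abel
    _ ≤ ‖g - u₀‖ + ‖u₀ - w‖ := norm_add_le _ _
    _ < η := by linarith

end Semigroup

/-! ### Convergence of semigroups from convergence of generators on a core -/

section Approximation

variable {X : Type*} [NormedAddCommGroup X] [NormedSpace ℝ X] {P : ℝ → X →L[ℝ] X}
  {D : Set (X × X)} {T R : ℕ → X →L[ℝ] X} {Λ : ℕ → ℝ}

/-- Convergence of generators on `D` gives convergence of resolvents on `(1 - A) u` whenever `(u, A u)`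
lies in the closure of `D`. -/
lemma tendsto_resolvent (hR : ∀ k, ‖R k‖ ≤ 1) (hRT : ∀ k, R k * (1 - (T k - Λ k • 1)) = 1)
    (hD : ∀ w ∈ D, Tendsto (fun k => T k w.1 - Λ k • w.1) atTop (𝓝 w.2)) {w : X × X}
    (hw : w ∈ closure D) :
    Tendsto (fun k => R k (w.1 - w.2)) atTop (𝓝 w.1) := by
  refine tendsto_of_approx (C := 2)
    (A := fun k => (R k).comp (ContinuousLinearMap.fst ℝ X X - ContinuousLinearMap.snd ℝ X X))
    (B := ContinuousLinearMap.fst ℝ X X) two_pos (fun k => ?_) ?_ (g := w) fun η hη => ?_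
  · refine ContinuousLinearMap.opNorm_le_bound _ two_pos.le fun z => ?_
    have h1 := (R k).le_of_opNorm_le (hR k) (z.1 - z.2)
    have h2 := _root_.norm_sub_le z.1 z.2
    have h3 := norm_fst_le z
    have h4 := norm_snd_le z
    change ‖R k (z.1 - z.2)‖ ≤ _
    linarith
  · exact (ContinuousLinearMap.norm_fst_le ℝ X X).trans one_le_two
  · obtain ⟨z, hz, hwz⟩ := Metric.mem_closure_iff.1 hw η hη
    refine ⟨z, by rwa [← dist_eq_norm], ?_⟩
    change Tendsto (fun k => R k (z.1 - z.2)) atTop (𝓝 z.1)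
    have h1 : Tendsto (fun k => R k ((T k z.1 - Λ k • z.1) - z.2)) atTop (𝓝 0) := by
      refine squeeze_zero_norm (fun k => (R k).le_of_opNorm_le (hR k) _) ?_
      simpa using ((hD z hz).sub_const z.2).norm
    have h2 := h1.const_add z.1
    rw [add_zero] at h2
    refine h2.congr fun k => ?_
    have h3 : R k (z.1 - (T k z.1 - Λ k • z.1)) = z.1 := by
      have := congrArg (fun A : X →L[ℝ] X => A z.1) (hRT k)
      simpa using this
    calc _ = R k (z.1 - (T k z.1 - Λ k • z.1)) + R k ((T k z.1 - Λ k • z.1) - z.2) := by rw [h3]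
      _ = _ := by
        rw [← map_add]
        congr 1
        abel

variable [CompleteSpace X]

lemma continuous_expSemigroup_sub (T : X →L[ℝ] X) (Λ t : ℝ) :
    Continuous fun s => expSemigroup T Λ (t - s) := by
  let _ : NormedAlgebra ℚ (X →L[ℝ] X) := NormedAlgebra.restrictScalars ℚ ℝ _
  unfold expSemigroup
  have h : Continuous fun s : ℝ => t - s := continuous_const.sub continuous_id
  exact (Real.continuous_exp.comp (h.const_mul Λ).neg).smul
    (NormedSpace.exp_continuous.comp (h.smul continuous_const))

/-- The derivative in `s` of `S (t - s) R (P s u)`, with `S` the semigroup generated by `T - Λ` and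
`R` the resolvent of `T - Λ`, is `S (t - s)` applied to the error made by `R` on `P s u`. -/
lemma IsContractionSemigroup.resolvent_sub_resolvent_eq (hP : IsContractionSemigroup P)
    {T R : X →L[ℝ] X} {Λ : ℝ} (hTR : (1 - (T - Λ • 1)) * R = 1) {u v : X}
    (h : (u, v) ∈ generatorGraph P) {t : ℝ} (ht : 0 ≤ t) :
    R (P t u) - expSemigroup T Λ t (R u)
      = ∫ s in (0 : ℝ)..t,
          expSemigroup T Λ (t - s) (P |s| u - R (P |s| u - P |s| v)) := by
  have hSt := continuous_expSemigroup_sub T Λ t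
  have hu := hP.continuous_abs u
  have hv := hP.continuous_abs v
  have hR : (T - Λ • 1) * R = R - 1 := by
    rw [sub_mul, one_mul] at hTR
    exact eq_sub_of_add_eq' (sub_eq_iff_eq_add.1 hTR).symm
  have key := intervalIntegral.integral_eq_sub_of_hasDeriv_right (a := 0) (b := t)
    (f := fun s => (expSemigroup T Λ (t - s) * R) (P |s| u))
    (f' := fun s => expSemigroup T Λ (t - s) (P |s| u - R (P |s| u - P |s| v)))
    ((hSt.mul continuous_const).clm_apply hu).continuousOn ?_
    ((hSt.clm_apply (hu.sub (R.continuous.comp (hu.sub hv)))).intervalIntegrable _ _)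
  · rw [key]
    simp [hP.zero, abs_of_nonneg ht, expSemigroup_zero]
  · intro s hs
    rw [min_eq_left ht, max_eq_right ht] at hs
    have h1 : HasDerivWithinAt (fun r => P |r| u) (P |s| v) (Ioi s) s := by
      rw [abs_of_pos hs.1]
      refine (hP.hasDerivWithinAt_orbit h hs.1.le).congr (fun r hr => ?_) ?_
      · rw [abs_of_pos (hs.1.trans hr)]
      · rw [abs_of_pos hs.1]
    have h2 : HasDerivAt (fun r => expSemigroup T Λ (t - r) * R)
        (-(expSemigroup T Λ (t - s) * (T - Λ • 1)) * R) s := by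
      have h3 : HasDerivAt (expSemigroup T Λ) _ (t - s) := hasDerivAt_expSemigroup (t - s)
      have h4 := h3.comp_const_sub t s
      exact h4.mul_const R
    refine (h2.hasDerivWithinAt.clm_apply h1).congr_deriv ?_
    rw [neg_mul, mul_assoc, hR, mul_sub, mul_one]
    simp only [neg_apply, sub_apply, mul_apply_eq_comp,
      map_sub]
    abel

/-- The Trotter–Kato theorem for bounded approximating generators, which need to converge only on a
core. -/
theorem IsContractionSemigroup.tendsto_expSemigroup (hP : IsContractionSemigroup P)
    (hT : ∀ k, ‖T k‖ ≤ Λ k) (hcore : (generatorGraph P : Set (X × X)) ⊆ closure D)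
    (hD : ∀ w ∈ D, Tendsto (fun k => T k w.1 - Λ k • w.1) atTop (𝓝 w.2)) {t : ℝ} (ht : 0 ≤ t)
    (g : X) :
    Tendsto (fun k => expSemigroup (T k) (Λ k) t g) atTop (𝓝 (P t g)) := by
  choose R hR hRT hTR using fun k => exists_resolvent (hT k)
  have hres : ∀ {u v : X}, (u, v) ∈ generatorGraph P →
      Tendsto (fun k => R k (u - v)) atTop (𝓝 u) := fun h =>
    tendsto_resolvent hR hRT hD (hcore h)
  have hSk : ∀ k s, 0 ≤ s → ∀ x, ‖expSemigroup (T k) (Λ k) s x‖ ≤ ‖x‖ := by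
    intro k s hs x
    simpa using (expSemigroup (T k) (Λ k) s).le_of_opNorm_le (norm_expSemigroup_le (hT k) hs) x
  have hRk : ∀ k x, ‖R k x‖ ≤ ‖x‖ := by
    intro k x
    simpa using (R k).le_of_opNorm_le (hR k) x
  have hcomm : ∀ {u v : X}, (u, v) ∈ generatorGraph P →
      Tendsto (fun k => R k (P t u) - expSemigroup (T k) (Λ k) t (R k u)) atTop (𝓝 0) := by
    intro u v h
    have hu := hP.continuous_abs u
    have hv := hP.continuous_abs v
    have key := intervalIntegral.tendsto_integral_filter_of_dominated_convergence
      (μ := volume) (a := 0) (b := t) (l := atTop) (f := fun _ => (0 : X))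
      (F := fun k s =>
        expSemigroup (T k) (Λ k) (t - s) (P |s| u - R k (P |s| u - P |s| v)))
      (fun _ => 2 * ‖u‖ + ‖v‖) ?_ ?_ (by simp) ?_
    · rw [intervalIntegral.integral_zero] at key
      exact key.congr fun k => (hP.resolvent_sub_resolvent_eq (hTR k) h ht).symm
    · refine Eventually.of_forall fun k => ?_
      exact ((continuous_expSemigroup_sub (T k) (Λ k) t).clm_apply
        (hu.sub ((R k).continuous.comp (hu.sub hv)))).aestronglyMeasurable
    · refine Eventually.of_forall fun k => ae_of_all _ fun s hs => ?_
      rw [uIoc_of_le ht] at hs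
      refine (hSk k _ (sub_nonneg.2 hs.2) _).trans ?_
      have h1 := _root_.norm_sub_le (P |s| u) (R k (P |s| u - P |s| v))
      have h2 := hRk k (P |s| u - P |s| v)
      have h3 := _root_.norm_sub_le (P |s| u) (P |s| v)
      have h4 := hP.norm_apply_le (abs_nonneg s) u
      have h5 := hP.norm_apply_le (abs_nonneg s) v
      linarith
    · refine ae_of_all _ fun s hs => ?_
      rw [uIoc_of_le ht] at hs
      have h1 := hres (hP.generator_orbit h (abs_nonneg s))
      have h2 := (h1.const_sub (P |s| u)).norm
      rw [sub_self, norm_zero] at h2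
      exact squeeze_zero_norm (fun k => hSk k _ (sub_nonneg.2 hs.2) _) h2
  refine tendsto_of_approx one_pos (fun k => norm_expSemigroup_le (hT k) ht) (hP.contraction t ht)
    fun η hη => ?_
  -- Here `u = (1 - A) w` with `A` the generator, so `R u → w`, and
  -- `S w - P w = S (w - R u) + (S R u - R P u) + (R P u - P w)`.
  obtain ⟨w, u, v, hw, hwu, huv⟩ := hP.exists_generator_sq_approx g hη
  refine ⟨w, hw, ?_⟩
  have h1 : Tendsto (fun k => R k u) atTop (𝓝 w) := by simpa using hres hwu
  have h2 : Tendsto (fun k => R k (P t u)) atTop (𝓝 (P t w)) := by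
    simpa using hres (hP.generator_orbit hwu ht)
  have h3 : Tendsto (fun k => expSemigroup (T k) (Λ k) t (w - R k u)) atTop (𝓝 0) := by
    have := (h1.const_sub w).norm
    rw [sub_self, norm_zero] at this
    exact squeeze_zero_norm (fun k => hSk k _ ht _) this
  have h4 := (h3.sub (hcomm huv)).add h2
  rw [sub_zero, zero_add] at h4
  refine h4.congr fun k => ?_
  rw [map_sub]
  abel

end Approximation

/-! ### Doubling the time for kernel semigroups -/

section Doubling

variable {X : Type*} [MeasurableSpace X] {μ : Measure X} [SFinite μ] {k j W : X → X → ℝ≥0∞}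
  {a u : X → ℝ≥0∞}

lemma measurable_expSum (hk : Measurable (Function.uncurry k)) (ha : Measurable a)
    (hu : Measurable u) (Λ t : ℝ) : Measurable (expSum (kernelOp μ k a) Λ t u) := by
  unfold expSum
  exact (Measurable.tsum fun n =>
    (measurable_iterate_kernelOp hk ha hu n).const_mul _).const_mul _

/-- Symmetry moves the superharmonicity of `W` to the function it is integrated against. -/
lemma potential_expSum_le (hk : Measurable (Function.uncurry k)) (hsymm : ∀ x y, k x y = k y x)
    (ha : Measurable a) (hW : Measurable (Function.uncurry W)) (hWsymm : ∀ x y, W x y = W y x)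
    (hu : Measurable u) {c t Λ : ℝ} (ht : 0 ≤ t) (hc : 0 ≤ c)
    (h : ∀ x y, kernelOp μ k a (fun z => W z y) x ≤ ENNReal.ofReal c * W x y) (x : X) :
    ∫⁻ y, W x y * expSum (kernelOp μ k a) Λ t u y ∂μ
      ≤ ENNReal.ofReal (Real.exp ((c - Λ) * t)) * ∫⁻ y, W x y * u y ∂μ := by
  have hWx : Measurable fun y => W x y := hW.comp measurable_prodMk_left
  have hm := fun n => measurable_iterate_kernelOp (μ := μ) hk ha hu n
  unfold expSum
  calc _ = ENNReal.ofReal (Real.exp (-(Λ * t))) * ∑' n : ℕ, ENNReal.ofReal (t ^ n / n.factorial)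
          * ∫⁻ y, W x y * (kernelOp μ k a)^[n] u y ∂μ := by
        simp_rw [← ENNReal.tsum_mul_left]
        rw [lintegral_tsum fun n =>
          (hWx.fun_mul (((hm n).const_mul _).const_mul _)).aemeasurable]
        refine tsum_congr fun n => ?_
        rw [← lintegral_const_mul _ (hWx.fun_mul (hm n)),
          ← lintegral_const_mul _ ((hWx.fun_mul (hm n)).const_mul _)]
        exact lintegral_congr fun y => by ring
    _ ≤ ENNReal.ofReal (Real.exp (-(Λ * t))) * ∑' n : ℕ, ENNReal.ofReal (t ^ n / n.factorial)
          * (ENNReal.ofReal c ^ n * ∫⁻ y, W x y * u y ∂μ) := by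
        gcongr with n
        exact potential_iterate_kernelOp_le hk hsymm ha hW hWsymm hu h n x
    _ = _ := by
        simp only [← mul_assoc]
        rw [ENNReal.tsum_mul_right, tsum_ofReal_exp ht hc, ← mul_assoc,
          ← ENNReal.ofReal_mul (by positivity), ← Real.exp_add]
        congr 3
        ring

/-- If the solution at time `τ` is at most `B W u + m`, then at time `2 τ` the constants `B` and `m`
are reduced by the factor `e^{-β τ}`, at the expense of a term that does not depend on them. -/
lemma expSum_doubling_le (hk : Measurable (Function.uncurry k))
    (hj : Measurable (Function.uncurry j)) (hks : ∀ x y, k x y = k y x)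
    (hjs : ∀ x y, j x y = j y x) (ha : Measurable a)
    (hW : Measurable (Function.uncurry W)) (hWs : ∀ x y, W x y = W y x) (hu : Measurable u)
    {D τ Λ β : ℝ} (hτ : 0 ≤ τ) (hD : 0 ≤ D) (hΛ : 0 ≤ Λ) (hβ : β ≤ Λ)
    (hjW : ∀ x y, j x y ≤ ENNReal.ofReal D * W x y)
    (hc : ∀ x y, kernelOp μ (fun x y => k x y + j x y) a (fun z => W z y) x
      ≤ ENNReal.ofReal (Λ + D) * W x y)
    (hb : ∀ x y, kernelOp μ k a (fun z => W z y) x ≤ ENNReal.ofReal (Λ - β) * W x y)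
    (h1 : ∀ x, kernelOp μ k a (fun _ => 1) x ≤ ENNReal.ofReal (Λ - β))
    {v : X → ℝ≥0∞} (hvu : ∀ x, v x = expSum (kernelOp μ (fun x y => k x y + j x y) a) Λ τ u x)
    {B m : ℝ≥0∞} (hv : ∀ x, v x ≤ B * (∫⁻ y, W x y * u y ∂μ) + m) (x : X) :
    expSum (kernelOp μ (fun x y => k x y + j x y) a) Λ τ v x
      ≤ ENNReal.ofReal (Real.exp (-(β * τ))) * (B * (∫⁻ y, W x y * u y ∂μ) + m)
        + ENNReal.ofReal (τ * D * Real.exp (2 * (τ * D))) * ∫⁻ y, W x y * u y ∂μ := by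
  have hkj : Measurable (Function.uncurry fun x y => k x y + j x y) := hk.add hj
  have hvm : Measurable v := by
    rw [funext hvu]
    exact measurable_expSum hkj ha hu Λ τ
  have hWu : Measurable fun x => ∫⁻ y, W x y * u y ∂μ :=
    Measurable.lintegral_prod_right' (f := fun p : X × X => W p.1 p.2 * u p.2)
      (hW.fun_mul (hu.comp measurable_snd))
  have hh : ∀ x, kernelOp μ k a (fun z => B * (∫⁻ y, W z y * u y ∂μ) + m) x
      ≤ ENNReal.ofReal (Λ - β) * (B * (∫⁻ y, W x y * u y ∂μ) + m) := by
    intro x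
    rw [kernelOp_add hk (hWu.const_mul B), kernelOp_const_mul hk hWu]
    have e : kernelOp μ k a (fun _ => m) x = m * kernelOp μ k a (fun _ => 1) x := by
      simpa using kernelOp_const_mul (μ := μ) (a := a) (c := m) hk
        (measurable_const (a := (1 : ℝ≥0∞))) x
    rw [e]
    calc _ ≤ B * (ENNReal.ofReal (Λ - β) * ∫⁻ y, W x y * u y ∂μ) + m * ENNReal.ofReal (Λ - β) := by
          gcongr
          · exact kernelOp_potential_le hk hW hu hb x
          · exact h1 x
      _ = _ := by ring
  have key := expSum_add_kernel_le hk hj hks ha hW hWs (D := D) (t := τ) (Λ := Λ) (c := Λ + D)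
    (b := Λ - β) hτ (by positivity) (sub_nonneg.2 hβ) hjW hc hvm
    ((hWu.const_mul B).add_const m) hv hh x
  refine key.trans ?_
  have e1 : (Λ - β - Λ) * τ = -(β * τ) := by ring
  rw [e1]
  refine add_le_add le_rfl ?_
  have hpot : ∫⁻ y, W x y * v y ∂μ
      ≤ ENNReal.ofReal (Real.exp ((Λ + D - Λ) * τ)) * ∫⁻ y, W x y * u y ∂μ := by
    simp_rw [hvu]
    refine potential_expSum_le hkj (fun x y => ?_) ha hW hWs hu hτ (by positivity) hc x
    rw [hks, hjs]
  refine (mul_le_mul' le_rfl hpot).trans (le_of_eq ?_)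
  rw [← mul_assoc, ← ENNReal.ofReal_mul (by positivity), ← ENNReal.ofReal_mul (by positivity)]
  congr 2
  have e2 : Real.exp (2 * (τ * D)) = Real.exp ((Λ + D - Λ) * τ) * Real.exp ((Λ + D - Λ) * τ) := by
    rw [← Real.exp_add]
    congr 1
    ring
  rw [e2]
  ring

end Doubling

/-! ### Positivity of the truncated semigroups -/

section TruncatedSemigroup

variable {d : ℕ} {k : Rd d → Rd d → ℝ≥0∞} {a : Rd d → ℝ≥0∞} {T : C₀(Rd d, ℝ) →L[ℝ] C₀(Rd d, ℝ)}
  {Λ t : ℝ}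

/-- On nonnegative functions, the semigroup of a bounded operator on `C₀` given by a positive kernel
agrees with the series for the kernel. -/
lemma expSemigroup_eq_expSum
    (hT : ∀ u : C₀(Rd d, ℝ), (∀ x, 0 ≤ u x) → ∀ x, 0 ≤ T u x ∧
      ENNReal.ofReal (T u x) = kernelOp volume k a (fun y => ENNReal.ofReal (u y)) x)
    (ht : 0 ≤ t) {u : C₀(Rd d, ℝ)} (hu : ∀ x, 0 ≤ u x) (x : Rd d) :
    0 ≤ expSemigroup T Λ t u x ∧
      ENNReal.ofReal (expSemigroup T Λ t u x)
        = expSum (kernelOp volume k a) Λ t (fun y => ENNReal.ofReal (u y)) x := by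
  have hpow : ∀ n : ℕ, ∀ x, 0 ≤ (T ^ n) u x ∧
      ENNReal.ofReal ((T ^ n) u x)
        = (kernelOp volume k a)^[n] (fun y => ENNReal.ofReal (u y)) x := by
    intro n
    induction n with
    | zero => intro x; simpa using hu x
    | succ n ih =>
      intro x
      rw [pow_succ', mul_apply_eq_comp, Function.iterate_succ_apply']
      obtain ⟨h1, h2⟩ := hT ((T ^ n) u) (fun y => (ih y).1) x
      refine ⟨h1, h2.trans ?_⟩
      congr 1
      exact funext fun y => (ih y).2
  let ev : C₀(Rd d, ℝ) →L[ℝ] ℝ := LinearMap.mkContinuous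
    { toFun := fun u => u x, map_add' := fun _ _ => rfl, map_smul' := fun _ _ => rfl } 1
    fun u => by simpa using abs_apply_le_norm u x
  have hs : HasSum (fun n : ℕ => Real.exp (-(Λ * t)) * (t ^ n / n.factorial * (T ^ n) u x))
      (expSemigroup T Λ t u x) := by
    have := (hasSum_expSemigroup T Λ t u).mapL ev
    exact this
  have h0 : ∀ n : ℕ, 0 ≤ Real.exp (-(Λ * t)) * (t ^ n / n.factorial * (T ^ n) u x) := by
    intro n
    have := (hpow n x).1
    positivity
  rw [← hs.tsum_eq]
  refine ⟨tsum_nonneg h0, ?_⟩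
  rw [ENNReal.ofReal_tsum_of_nonneg h0 hs.summable]
  unfold expSum
  rw [← ENNReal.tsum_mul_left]
  refine tsum_congr fun n => ?_
  rw [ENNReal.ofReal_mul (by positivity), ENNReal.ofReal_mul (by positivity), (hpow n x).2]

end TruncatedSemigroup

/-! ### Uniform bounds for the truncated semigroups -/

section UniformBound

variable {d : ℕ} {α : ℝ} {φ : ℝ → ℝ} {M c₄ : ℝ} {f : Rd d → Rd d → ℝ≥0∞} {s ε η : ℝ}

lemma scaledBound_mul_le (hα : 0 < α) (hφ : IsProfile d α φ) {ρ r : ℝ} (hρ : 0 < ρ) (hρ1 : ρ ≤ 1)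
    (hs : 0 < s) (hr : 0 ≤ r) :
    scaledBound d α φ (s * ρ) r ≤ (ρ⁻¹) ^ (α + d) * scaledBound d α φ s r := by
  have hφr := hφ.pos r hr
  have h1 : s * ρ ≤ s := mul_le_of_le_one_right hs.le hρ1
  have hm : 0 < max s r := lt_max_of_lt_left hs
  have hm' : 0 < max (s * ρ) r := lt_max_of_lt_left (by positivity)
  have h2 : max s r ≤ ρ⁻¹ * max (s * ρ) r := by
    rw [inv_mul_eq_div, le_div_iff₀ hρ]
    rcases le_total s r with h | h
    · rw [max_eq_right h]
      exact (mul_le_of_le_one_right hr hρ1).trans (le_max_right _ _)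
    · rw [max_eq_left h]
      exact le_max_left _ _
  have h3 := rpow_max_le (n := α + d) hm' (by positivity : 0 < ρ⁻¹) (by positivity) h2 hm
  unfold scaledBound
  calc _ = (s * ρ) ^ α * φ r * (1 / max (s * ρ) r ^ (α + d)) := by ring
    _ ≤ s ^ α * φ r * ((ρ⁻¹) ^ (α + d) * (1 / max s r ^ (α + d))) := by gcongr
    _ = _ := by ring

lemma exists_regBound_mul_le (hα : 0 < α) (hφ : IsProfile d α φ) {ρ : ℝ} (hρ : 0 < ρ)
    (hρ1 : ρ ≤ 1) :
    ∃ A : ℝ, 1 ≤ A ∧ ∀ s, 0 < s → s ≤ 1 → ∀ x : Rd d,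
      regBound d α φ (s * ρ) x ≤ ENNReal.ofReal A * regBound d α φ s x := by
  obtain ⟨C, hC, h1⟩ := exists_regBound_le hα hφ
  obtain ⟨C', hC', h2⟩ := exists_le_regBound hα hφ
  refine ⟨max 1 (C * (ρ⁻¹) ^ (α + d) * C'), le_max_left _ _, fun s hs hs1 x => ?_⟩
  calc _ ≤ ENNReal.ofReal (C * scaledBound d α φ (s * ρ) ‖x‖) :=
        h1 _ (by positivity) (mul_le_one₀ hs1 hρ.le hρ1) x
    _ ≤ ENNReal.ofReal (C * ((ρ⁻¹) ^ (α + d) * scaledBound d α φ s ‖x‖)) := by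
        gcongr
        exact scaledBound_mul_le hα hφ hρ hρ1 hs (norm_nonneg x)
    _ = ENNReal.ofReal (C * (ρ⁻¹) ^ (α + d)) * ENNReal.ofReal (scaledBound d α φ s ‖x‖) := by
        rw [← mul_assoc, ENNReal.ofReal_mul (by positivity)]
    _ ≤ ENNReal.ofReal (C * (ρ⁻¹) ^ (α + d)) * (ENNReal.ofReal C' * regBound d α φ s x) := by
        gcongr
        exact h2 s hs hs1 x
    _ = ENNReal.ofReal (C * (ρ⁻¹) ^ (α + d) * C') * regBound d α φ s x := by
        rw [← mul_assoc, ← ENNReal.ofReal_mul (by positivity)]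
    _ ≤ _ := by
        gcongr
        exact le_max_right _ _

/-- `T` represents the jumps longer than `ε` on `C₀`: it is the bounded positive operator for which
`T - Λ` is their generator. -/
structure IsTruncatedOperator (f : Rd d → Rd d → ℝ≥0∞) (ε Λ : ℝ)
    (T : C₀(Rd d, ℝ) →L[ℝ] C₀(Rd d, ℝ)) : Prop where
  rate_le : ∀ x, longRate f ε x ≤ ENNReal.ofReal Λ
  norm_le : ‖T‖ ≤ Λ
  apply_of_nonneg : ∀ u : C₀(Rd d, ℝ), (∀ x, 0 ≤ u x) → ∀ x, 0 ≤ T u x ∧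
    ENNReal.ofReal (T u x)
      = kernelOp volume (longJumps f ε) (holdRate f ε Λ) (fun y => ENNReal.ofReal (u y)) x

lemma IsTruncatedOperator.nonneg {Λ : ℝ} {T : C₀(Rd d, ℝ) →L[ℝ] C₀(Rd d, ℝ)}
    (hT : IsTruncatedOperator f ε Λ T) : 0 ≤ Λ := (norm_nonneg T).trans hT.norm_le

lemma longJumps_symm (hf : ∀ x y, f x y = f y x) (x y : Rd d) :
    longJumps f ε x y = longJumps f ε y x := by
  simp only [longJumps, indicator_apply, mem_ofPred_eq, norm_sub_rev x y, hf x y]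

/-- Doubling the time repeatedly, starting from the trivial bound by `‖u‖`. -/
lemma exists_truncated_bound (hd : 1 ≤ d) (hα : α ∈ Ioo (0 : ℝ) 2) (hφ : IsProfile d α φ)
    (hM : 0 < M) (hc₄ : 0 < c₄) :
    ∃ κ s₀ D K ρ : ℝ, 0 < κ ∧ 0 < s₀ ∧ s₀ ≤ 1 ∧ 0 < D ∧ 0 < K ∧ 0 < ρ ∧
      ∀ f : Rd d → Rd d → ℝ≥0∞, IsJumpKernel d α φ M c₄ f → ∀ ε, 0 < ε →
      ∀ Λ T, IsTruncatedOperator f ε Λ T → ∀ (n : ℕ) s, 0 < s → s ≤ s₀ → ε ≤ κ * s * ρ ^ n →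
      (∀ x y, kernelOp volume (longJumps f ε) (holdRate f ε Λ)
          (fun z => regBound d α φ s (z - y)) x
            ≤ ENNReal.ofReal (Λ + D * s ^ (-α)) * regBound d α φ s (x - y)) ∧
      ∀ u : C₀(Rd d, ℝ), (∀ x, 0 ≤ u x) → ∀ x,
        ENNReal.ofReal (expSemigroup T Λ (s ^ α) u x)
          ≤ ENNReal.ofReal K * (∫⁻ y, regBound d α φ s (x - y) * ENNReal.ofReal (u y))
            + ENNReal.ofReal ((1 / 2) ^ n * ‖u‖) := by
  have hα0 := hα.1
  set ρ : ℝ := (2 : ℝ)⁻¹ ^ (α⁻¹) with hρ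
  have hρ0 : 0 < ρ := by positivity
  have hρ1 : ρ ≤ 1 := Real.rpow_le_one (by norm_num) (by norm_num) (by positivity)
  have hρα : ρ ^ α = 2⁻¹ := Real.rpow_inv_rpow (by norm_num) hα0.ne'
  obtain ⟨A, hA1, hA⟩ := exists_regBound_mul_le hα0 hφ hρ0 hρ1
  -- the long jumps cut off have rate at least `b s^{-α}`, so that the decay over the time
  -- `s^α / 2` compensates the loss `A` and the factor `1/2`
  set b : ℝ := 2 * Real.log (2 * A) with hb
  have hb0 : 0 < b := by
    have := Real.log_pos (by linarith : 1 < 2 * A)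
    positivity
  have hexpb : Real.exp (-(b / 2)) * A = 1 / 2 := by
    have : b / 2 = Real.log (2 * A) := by rw [hb]; ring
    rw [this, Real.exp_neg, Real.exp_log (by linarith)]
    field_simp
  have hexpb1 : Real.exp (-(b / 2)) ≤ 1 / 2 := by
    rw [← hexpb]
    exact le_mul_of_one_le_right (Real.exp_pos _).le hA1
  obtain ⟨κ, s₀, D, hκ, hs₀, hs₀1, hD, hmain⟩ := exists_superharmonic hd hα hφ hM hc₄ hb0
  refine ⟨κ, s₀, D, D * Real.exp D, ρ, hκ, hs₀, hs₀1, hD, by positivity, hρ0, ?_⟩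
  intro f hf ε hε Λ T hT n
  have hΛ0 := hT.nonneg
  have hεs : ∀ (n : ℕ) (s : ℝ), 0 < s → ε ≤ κ * s * ρ ^ n → ε ≤ κ * s := fun n s hs h =>
    h.trans (mul_le_of_le_one_right (by positivity) (pow_le_one₀ hρ0.le hρ1))
  have hsuper : ∀ (n : ℕ) s, 0 < s → s ≤ s₀ → ε ≤ κ * s * ρ ^ n → _ := fun n s hs hs1 h =>
    (hmain f hf s hs hs1).2 ε hε (hεs n s hs h) Λ hΛ0 hT.rate_le
  induction n with
  | zero =>
    intro s hs hs1 h
    refine ⟨(hsuper 0 s hs hs1 h).2.1, fun u _ x => le_add_left (ENNReal.ofReal_le_ofReal ?_)⟩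
    have h1 := (expSemigroup T Λ (s ^ α)).le_of_opNorm_le
      (norm_expSemigroup_le hT.norm_le (by positivity)) u
    rw [pow_zero, one_mul]
    rw [one_mul] at h1
    exact (le_abs_self _).trans ((abs_apply_le_norm _ x).trans h1)
  | succ n ih =>
    intro s hs hs1 h
    obtain ⟨h1, h2, h3, h4⟩ := hsuper (n + 1) s hs hs1 h
    refine ⟨h2, fun u hu x => ?_⟩
    have hsα : 0 < s ^ α := by positivity
    have hsα' : s ^ α * s ^ (-α) = 1 := by rw [← Real.rpow_add hs]; simp
    set τ : ℝ := (s * ρ) ^ α with hτ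
    have hτs : τ = s ^ α / 2 := by rw [hτ, Real.mul_rpow hs.le hρ0.le, hρα, div_eq_mul_inv]
    have hτ0 : 0 ≤ τ := by rw [hτs]; positivity
    have hst : s ^ α = τ + τ := by rw [hτs]; ring
    set W : Rd d → Rd d → ℝ≥0∞ := fun x y => regBound d α φ s (x - y) with hW
    have hWm : Measurable (Function.uncurry W) :=
      (measurable_regBound hφ).comp (measurable_fst.sub measurable_snd)
    have hWs : ∀ x y, W x y = W y x := fun x y => by
      rw [hW]
      beta_reduce
      rw [← regBound_neg, neg_sub]
    have hum : Measurable fun y => ENNReal.ofReal (u y) :=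
      u.continuous.measurable.ennreal_ofReal
    set Q : Rd d → ℝ≥0∞ := fun x => ∫⁻ y, W x y * ENNReal.ofReal (u y) with hQ
    have hSu := fun x => expSemigroup_eq_expSum (Λ := Λ) hT.apply_of_nonneg hτ0 hu x
    have hSSu := expSemigroup_eq_expSum (Λ := Λ) hT.apply_of_nonneg hτ0 (fun x => (hSu x).1) x
    have hv : ∀ x, ENNReal.ofReal (expSemigroup T Λ τ u x)
        ≤ ENNReal.ofReal (D * Real.exp D * A) * Q x + ENNReal.ofReal ((1 / 2) ^ n * ‖u‖) := by
      intro x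
      refine ((ih (s * ρ) (by positivity) ((mul_le_of_le_one_right hs.le hρ1).trans hs1)
        (h.trans (le_of_eq (by ring)))).2 u hu x).trans ?_
      refine add_le_add ?_ le_rfl
      rw [ENNReal.ofReal_mul (p := D * Real.exp D) (by positivity), mul_assoc]
      refine mul_le_mul' le_rfl ?_
      have hWx : Measurable fun y => regBound d α φ s (x - y) :=
        (measurable_regBound hφ).comp (measurable_id.const_sub x)
      have hWu : Measurable fun y => regBound d α φ s (x - y) * ENNReal.ofReal (u y) :=
        hWx.fun_mul hum
      calc _ ≤ ∫⁻ y, ENNReal.ofReal A * (regBound d α φ s (x - y) * ENNReal.ofReal (u y)) := by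
            refine lintegral_mono fun y => ?_
            rw [← mul_assoc]
            exact mul_le_mul' (hA s hs (hs1.trans hs₀1) (x - y)) le_rfl
        _ = _ := lintegral_const_mul _ hWu
    have hker := midJumps_add_longJumps (f := f) (hεs (n + 1) s hs h)
    have key := expSum_doubling_le (μ := volume) (k := midJumps f ε (κ * s))
      (j := longJumps f (κ * s)) (a := holdRate f ε Λ) (W := W)
      (u := fun y => ENNReal.ofReal (u y)) (D := D * s ^ (-α)) (τ := τ) (Λ := Λ)
      (β := b * s ^ (-α)) (v := fun y => ENNReal.ofReal (expSemigroup T Λ τ u y))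
      (measurable_midJumps hf.measurable) (measurable_longJumps hf.measurable)
      (midJumps_symm hf.symm) (longJumps_symm hf.symm) (measurable_holdRate hf.measurable) hWm hWs
      hum hτ0
      (by positivity) hΛ0 h1 (hmain f hf s hs hs1).1 (by rw [hker]; exact h2) h3 h4
      (by rw [hker]; exact fun x => (hSu x).2) hv x
    rw [hker] at key
    rw [hst, expSemigroup_add, mul_apply_eq_comp, hSSu.2]
    refine key.trans ?_
    have e1 : b * s ^ (-α) * τ = b / 2 := by
      rw [hτs]
      linear_combination b / 2 * hsα'
    have e2 : τ * (D * s ^ (-α)) = D / 2 := by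
      rw [hτs]
      linear_combination D / 2 * hsα'
    rw [e1, e2]
    calc _ = (ENNReal.ofReal (Real.exp (-(b / 2)) * (D * Real.exp D * A))
            + ENNReal.ofReal (D / 2 * Real.exp (2 * (D / 2)))) * Q x
          + ENNReal.ofReal (Real.exp (-(b / 2)) * ((1 / 2) ^ n * ‖u‖)) := by
          rw [ENNReal.ofReal_mul (Real.exp_pos _).le, ENNReal.ofReal_mul (Real.exp_pos _).le]
          ring
      _ ≤ _ := by
          rw [← ENNReal.ofReal_add (by positivity) (by positivity)]
          refine add_le_add (mul_le_mul' (ENNReal.ofReal_le_ofReal (le_of_eq ?_)) le_rfl)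
            (ENNReal.ofReal_le_ofReal ?_)
          · have : 2 * (D / 2) = D := by ring
            rw [this]
            linear_combination D * Real.exp D * hexpb
          · calc _ ≤ 1 / 2 * ((1 / 2) ^ n * ‖u‖) := by gcongr
              _ = _ := by ring

lemma kernelOp_longJumps_one_le {Λ : ℝ}
    (hΛ : ∀ x, longRate f ε x ≤ ENNReal.ofReal Λ) (x : Rd d) :
    kernelOp volume (longJumps f ε) (holdRate f ε Λ) (fun _ => 1) x ≤ ENNReal.ofReal Λ := by
  unfold kernelOp holdRate
  simp only [mul_one]
  exact (add_tsub_cancel_of_le (hΛ x)).le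

/-- The bound for all times: beyond a fixed time, superharmonicity alone gives exponential
growth. -/
lemma exists_truncated_bound_all (hd : 1 ≤ d) (hα : α ∈ Ioo (0 : ℝ) 2) (hφ : IsProfile d α φ)
    (hM : 0 < M) (hc₄ : 0 < c₄) :
    ∃ κ s₀ D K ρ : ℝ, 0 < κ ∧ 0 < s₀ ∧ s₀ ≤ 1 ∧ 0 < D ∧ 0 < K ∧ 0 < ρ ∧
      ∀ f : Rd d → Rd d → ℝ≥0∞, IsJumpKernel d α φ M c₄ f → ∀ ε, 0 < ε →
      ∀ Λ T, IsTruncatedOperator f ε Λ T → ∀ (n : ℕ) t, 0 < t →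
      ε ≤ κ * min (t ^ α⁻¹) s₀ * ρ ^ n → ∀ u : C₀(Rd d, ℝ), (∀ x, 0 ≤ u x) → ∀ x,
        0 ≤ expSemigroup T Λ t u x ∧
        ENNReal.ofReal (expSemigroup T Λ t u x)
          ≤ ENNReal.ofReal (Real.exp (D * t)) * (ENNReal.ofReal K
              * (∫⁻ y, regBound d α φ (min (t ^ α⁻¹) s₀) (x - y) * ENNReal.ofReal (u y))
            + ENNReal.ofReal ((1 / 2) ^ n * ‖u‖)) := by
  have hα0 := hα.1
  obtain ⟨κ, s₀, D, K, ρ, hκ, hs₀, hs₀1, hD, hK, hρ, hmain⟩ :=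
    exists_truncated_bound hd hα hφ hM hc₄
  refine ⟨κ, s₀, D * s₀ ^ (-α), K, ρ, hκ, hs₀, hs₀1, by positivity, hK, hρ, ?_⟩
  intro f hf ε hε Λ T hT n t ht h u hu x
  refine ⟨(expSemigroup_eq_expSum hT.apply_of_nonneg ht.le hu x).1, ?_⟩
  obtain ⟨hsup, hbound⟩ := hmain f hf ε hε Λ T hT n (min (t ^ α⁻¹) s₀)
    (lt_min (by positivity) hs₀) (min_le_right _ _) h
  rcases le_total (t ^ α⁻¹) s₀ with hts | hts
  · rw [min_eq_left hts] at hbound ⊢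
    have e : (t ^ α⁻¹) ^ α = t := Real.rpow_inv_rpow ht.le hα0.ne'
    rw [e] at hbound
    refine (hbound u hu x).trans (le_mul_of_one_le_left' ?_)
    rw [ENNReal.one_le_ofReal]
    exact Real.one_le_exp (by positivity)
  · rw [min_eq_right hts] at hbound hsup ⊢
    set t₀ := s₀ ^ α with ht₀
    have ht₀0 : 0 < t₀ := by positivity
    have htt : t₀ ≤ t := by
      have := Real.rpow_le_rpow hs₀.le hts hα0.le
      rwa [Real.rpow_inv_rpow ht.le hα0.ne'] at this
    set Q : Rd d → ℝ≥0∞ := fun x => ∫⁻ y, regBound d α φ s₀ (x - y) * ENNReal.ofReal (u y) with hQ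
    have hWm : Measurable (Function.uncurry fun x y : Rd d => regBound d α φ s₀ (x - y)) :=
      (measurable_regBound hφ).comp (measurable_fst.sub measurable_snd)
    have hum : Measurable fun y => ENNReal.ofReal (u y) :=
      u.continuous.measurable.ennreal_ofReal
    have hQm : Measurable Q :=
      Measurable.lintegral_prod_right' (f := fun p : Rd d × Rd d =>
        regBound d α φ s₀ (p.1 - p.2) * ENNReal.ofReal (u p.2))
        (hWm.fun_mul (hum.comp measurable_snd))
    set m : ℝ≥0∞ := ENNReal.ofReal ((1 / 2) ^ n * ‖u‖) with hm
    have hlm := measurable_longJumps (ε := ε) hf.measurable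
    have hh : ∀ x, kernelOp volume (longJumps f ε) (holdRate f ε Λ)
        (fun z => ENNReal.ofReal K * Q z + m) x
          ≤ ENNReal.ofReal (Λ + D * s₀ ^ (-α)) * (ENNReal.ofReal K * Q x + m) := by
      intro x
      rw [kernelOp_add hlm (hQm.const_mul _), kernelOp_const_mul hlm hQm]
      have e : kernelOp volume (longJumps f ε) (holdRate f ε Λ) (fun _ => m) x
          = m * kernelOp volume (longJumps f ε) (holdRate f ε Λ) (fun _ => 1) x := by
        simpa using kernelOp_const_mul (μ := volume) (a := holdRate f ε Λ) (c := m) hlm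
          (measurable_const (a := (1 : ℝ≥0∞))) x
      rw [e]
      calc _ ≤ ENNReal.ofReal K * (ENNReal.ofReal (Λ + D * s₀ ^ (-α)) * Q x)
            + m * ENNReal.ofReal (Λ + D * s₀ ^ (-α)) := by
            gcongr
            · exact kernelOp_potential_le hlm hWm hum hsup x
            · refine (kernelOp_longJumps_one_le hT.rate_le x).trans ?_
              gcongr
              linarith [show 0 < D * s₀ ^ (-α) by positivity]
        _ = _ := by ring
    have hSu := fun x => expSemigroup_eq_expSum (Λ := Λ) hT.apply_of_nonneg ht₀0.le hu x
    have hSSu := expSemigroup_eq_expSum (Λ := Λ) hT.apply_of_nonneg (sub_nonneg.2 htt)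
      (fun x => (hSu x).1) x
    have hΛ0 := hT.nonneg
    have e : t = (t - t₀) + t₀ := by ring
    conv_lhs => rw [e, expSemigroup_add, mul_apply_eq_comp]
    rw [hSSu.2]
    refine (expSum_le (sub_nonneg.2 htt) (by positivity) hlm ((hQm.const_mul _).add_const m) hh
      (fun x => hbound u hu x) x).trans ?_
    refine mul_le_mul' (ENNReal.ofReal_le_ofReal (Real.exp_le_exp.2 ?_)) le_rfl
    rw [add_sub_cancel_left]
    gcongr
    linarith

/-! ### The bound for the semigroup -/

/-- Passage to the limit in the truncation. -/
lemma exists_semigroup_bound (hd : 1 ≤ d) (hα : α ∈ Ioo (0 : ℝ) 2) (hφ : IsProfile d α φ)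
    (hM : 0 < M) (hc₄ : 0 < c₄) :
    ∃ s₀ D K : ℝ, 0 < s₀ ∧ s₀ ≤ 1 ∧ 0 < D ∧ 0 < K ∧
      ∀ f : Rd d → Rd d → ℝ≥0∞, IsJumpKernel d α φ M c₄ f → (nonlocalOp f).IsClosable →
      ∀ P : ℝ → C₀(Rd d, ℝ) →L[ℝ] C₀(Rd d, ℝ), IsContractionSemigroup P →
      generator P = (nonlocalOp f).closure → ∀ t, 0 < t →
      ∀ u : C₀(Rd d, ℝ), (∀ x, 0 ≤ u x) → ∀ x,
        0 ≤ P t u x ∧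
        ENNReal.ofReal (P t u x) ≤ ENNReal.ofReal (Real.exp (D * t)) * (ENNReal.ofReal K
          * ∫⁻ y, regBound d α φ (min (t ^ α⁻¹) s₀) (x - y) * ENNReal.ofReal (u y)) := by
  have hα0 := hα.1
  obtain ⟨κ, s₀, D, K, ρ, hκ, hs₀, hs₀1, hD, hK, hρ, hmain⟩ :=
    exists_truncated_bound_all hd hα hφ hM hc₄
  obtain ⟨C, hC, hrate⟩ := exists_longRate_le (d := d) hα0 hφ hM c₄
  refine ⟨s₀, D, K, hs₀, hs₀1, hD, hK, ?_⟩
  intro f hf hcl P hP hgen t ht u hu x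
  set ε : ℕ → ℝ := fun k => 1 / ((k : ℝ) + 1) with hε
  have hε0 : ∀ k, 0 < ε k := fun k => by positivity
  have hεlim : Tendsto ε atTop (𝓝 0) := tendsto_one_div_add_atTop_nhds_zero_nat
  set Λ : ℕ → ℝ := fun k => C * ε k ^ (-α) with hΛ
  have hΛ0 : ∀ k, 0 ≤ Λ k := fun k => by have := hε0 k; positivity
  choose T hT1 hT2 hT3 using fun k => exists_truncatedOperator hα0 hφ hM hf (hε0 k) (hΛ0 k)
    (hrate f hf (ε k) (hε0 k))
  have hlim : Tendsto (fun k => expSemigroup (T k) (Λ k) t u) atTop (𝓝 (P t u)) := by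
    refine hP.tendsto_expSemigroup (D := (nonlocalGraph f : Set _)) hT1 ?_ (fun w hw => ?_) ht.le u
    · have h1 := hcl.graph_closure_eq_closure_graph
      rw [← hgen, generator_graph, nonlocalOp_graph] at h1
      rw [← h1]
      exact subset_rfl
    · obtain ⟨C', q, hC', hq, herr⟩ := exists_truncation_error hd hα hφ hM hf hw
      rw [tendsto_iff_norm_sub_tendsto_zero]
      have h2 : Tendsto (fun k => C' * ε k ^ q) atTop (𝓝 0) := by
        have := ((Real.continuousAt_rpow_const 0 q (Or.inr hq.le)).tendsto.comp hεlim).const_mul C'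
        simpa [Real.zero_rpow hq.ne'] using this
      refine squeeze_zero (fun _ => norm_nonneg _) (fun k => ?_) h2
      have := hε0 k
      refine norm_le_of_forall_abs_le (by positivity) fun y => ?_
      have h3 := herr (ε k) (hε0 k) y
      rw [← hT2 k w.1 y, abs_sub_comm] at h3
      exact h3
  have hlimx : Tendsto (fun k => expSemigroup (T k) (Λ k) t u x) atTop (𝓝 (P t u x)) := by
    rw [tendsto_iff_norm_sub_tendsto_zero] at hlim ⊢
    exact squeeze_zero (fun _ => norm_nonneg _)
      (fun k => abs_apply_le_norm (expSemigroup (T k) (Λ k) t u - P t u) x) hlim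
  have hmin : 0 < min (t ^ α⁻¹) s₀ := lt_min (by positivity) hs₀
  have hk : ∀ n : ℕ, ∀ᶠ k in atTop, _ := fun n => by
    have h4 : ∀ᶠ k in atTop, ε k ≤ κ * min (t ^ α⁻¹) s₀ * ρ ^ n :=
      hεlim.eventually_le_const (by positivity)
    exact h4.mono fun k hk => hmain f hf (ε k) (hε0 k) (Λ k) (T k)
      ⟨hrate f hf (ε k) (hε0 k), hT1 k, hT3 k⟩ n t ht hk u hu x
  refine ⟨ge_of_tendsto hlimx ((hk 0).mono fun k h => h.1), ?_⟩
  have h5 := fun n => le_of_tendsto (ENNReal.tendsto_ofReal hlimx) ((hk n).mono fun k h => h.2)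
  have h6 : Tendsto (fun n : ℕ => ENNReal.ofReal ((1 / 2) ^ n * ‖u‖)) atTop (𝓝 0) := by
    have : Tendsto (fun n : ℕ => (1 / 2 : ℝ) ^ n * ‖u‖) atTop (𝓝 (0 * ‖u‖)) :=
      (tendsto_pow_atTop_nhds_zero_of_lt_one (by norm_num) (by norm_num)).mul_const _
    simpa using ENNReal.tendsto_ofReal this
  have h7 := ENNReal.Tendsto.const_mul (a := ENNReal.ofReal (Real.exp (D * t)))
    (tendsto_const_nhds (x := ENNReal.ofReal K
      * ∫⁻ y, regBound d α φ (min (t ^ α⁻¹) s₀) (x - y) * ENNReal.ofReal (u y)) |>.add h6)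
    (Or.inr ENNReal.ofReal_ne_top)
  rw [add_zero] at h7
  exact ge_of_tendsto' h7 h5

end UniformBound

/-! ### Densities of dominated positive functionals -/

section Density

open scoped CompactlySupported

variable {d : ℕ}

/-- Replacing `u` by `u - max (min u δ) (-δ)` makes the support compact at the cost of `δ`. -/
lemma exists_compactSupport_approx (u : C₀(Rd d, ℝ)) {δ : ℝ} (hδ : 0 < δ) :
    ∃ v : C₀(Rd d, ℝ), HasCompactSupport (v : Rd d → ℝ) ∧ ‖u - v‖ ≤ δ := by
  have hc : IsCompact {x | δ ≤ |u x|} := by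
    have h1 : ∀ᶠ x in cocompact (Rd d), |u x| < δ := by
      have := (u.zero_at_infty').abs
      rw [abs_zero] at this
      exact this.eventually_lt_const hδ
    obtain ⟨K, hK, hKu⟩ := mem_cocompact.1 h1
    refine hK.of_isClosed_subset (isClosed_le continuous_const u.continuous.abs) fun x hx => ?_
    by_contra hxK
    exact not_lt.2 (mem_ofPred.1 hx) (hKu hxK)
  have hcont : Continuous fun x => u x - max (min (u x) δ) (-δ) :=
    u.continuous.sub ((u.continuous.min continuous_const).max continuous_const)
  have hsupp : HasCompactSupport fun x => u x - max (min (u x) δ) (-δ) := by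
    refine HasCompactSupport.intro hc fun x hx => ?_
    have hx' : |u x| < δ := not_le.1 hx
    rw [abs_lt] at hx'
    rw [min_eq_left hx'.2.le, max_eq_left hx'.1.le, sub_self]
  refine ⟨⟨⟨_, hcont⟩, hsupp.is_zero_at_infty⟩, hsupp, norm_le_of_forall_abs_le hδ.le fun x => ?_⟩
  change |u x - (u x - max (min (u x) δ) (-δ))| ≤ δ
  rw [sub_sub_cancel, abs_le]
  exact ⟨le_max_right _ _, max_le (min_le_right _ _) (by linarith)⟩

/-- A measure dominated on test functions by a measure with a density has a smaller density. -/
lemma exists_density (L : C₀(Rd d, ℝ) →L[ℝ] ℝ) (hpos : ∀ u : C₀(Rd d, ℝ), (∀ x, 0 ≤ u x) → 0 ≤ L u)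
    {H : Rd d → ℝ≥0∞} (hH : Measurable H) (hfin : ∫⁻ y, H y ≠ ∞) (htop : ∀ y, H y ≠ ∞)
    (h : ∀ u : C₀(Rd d, ℝ), (∀ x, 0 ≤ u x) →
      ENNReal.ofReal (L u) ≤ ∫⁻ y, H y * ENNReal.ofReal (u y)) :
    ∃ p : Rd d → ℝ, Measurable p ∧ (∀ y, 0 ≤ p y) ∧ (∀ y, p y ≤ (H y).toReal) ∧ Integrable p ∧
      ∀ u : C₀(Rd d, ℝ), L u = ∫ y, u y * p y := by
  let e : C_c(Rd d, ℝ) → C₀(Rd d, ℝ) := fun g =>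
    ⟨⟨g, g.continuous⟩, g.hasCompactSupport.is_zero_at_infty⟩
  let Λ : C_c(Rd d, ℝ) →ₚ[ℝ] ℝ :=
    { toFun := fun g => L (e g)
      map_add' := fun g g' => L.map_add (e g) (e g')
      map_smul' := fun c g => L.map_smul c (e g)
      monotone' := fun g g' hgg' => by
        rw [← sub_nonneg, ← map_sub]
        exact hpos _ fun x => sub_nonneg.2 (hgg' x) }
  set μ := RealRMK.rieszMeasure Λ with hμ
  set ν : Measure (Rd d) := volume.withDensity H with hν
  have hνfin : IsFiniteMeasure ν := isFiniteMeasure_withDensity hfin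
  -- The comparison of `μ` and `ν` passes from test functions to compact, open and arbitrary sets.
  have hcompact : ∀ K, IsCompact K → μ K ≤ ν K := by
    intro K hK
    rw [K.measure_eq_iInf_isOpen ν]
    refine le_iInf fun U => le_iInf fun hKU => le_iInf fun hU => ?_
    obtain ⟨f, hf1, hf2, hf3, hf4⟩ := exists_continuousMap_one_of_isCompact_subset_isOpen hK hU hKU
    let g : C_c(Rd d, ℝ) := ⟨f, hasCompactSupport_def.mpr hf2⟩
    calc μ K ≤ ENNReal.ofReal (Λ g) :=
          RealRMK.rieszMeasure_le_of_eq_one Λ (fun x => (hf4 x).1) hK fun x hx => hf1 hx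
      _ ≤ ∫⁻ y, H y * ENNReal.ofReal (f y) := h (e g) fun x => (hf4 x).1
      _ ≤ ∫⁻ y, U.indicator H y := by
          refine lintegral_mono fun y => ?_
          by_cases hy : y ∈ U
          · rw [indicator_of_mem hy]
            refine mul_le_of_le_one_right' ?_
            exact ENNReal.ofReal_le_one.2 (hf4 y).2
          · have : f y = 0 := image_eq_zero_of_notMem_tsupport fun h' => hy (hf3 h')
            simp [this]
      _ = ν U := by
          rw [lintegral_indicator hU.measurableSet, hν, withDensity_apply _ hU.measurableSet]
  have hopen : ∀ U, IsOpen U → μ U ≤ ν U := by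
    intro U hU
    rw [hU.measure_eq_iSup_isCompact μ]
    exact iSup_le fun K => iSup_le fun hKU => iSup_le fun hK =>
      (hcompact K hK).trans (measure_mono hKU)
  have hall : ∀ s, μ s ≤ ν s := by
    intro s
    rw [s.measure_eq_iInf_isOpen ν]
    exact le_iInf fun U => le_iInf fun hsU => le_iInf fun hU =>
      (measure_mono hsU).trans (hopen U hU)
  have hμfin : IsFiniteMeasure μ := ⟨(hall univ).trans_lt (measure_lt_top ν univ)⟩
  have hac : μ ≪ volume :=
    (Measure.absolutelyContinuous_of_le (Measure.le_iff'.2 hall)).trans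
      (withDensity_absolutelyContinuous _ _)
  set g := μ.rnDeriv volume with hg
  have hgm : Measurable g := Measure.measurable_rnDeriv μ volume
  have hgμ : volume.withDensity g = μ := Measure.withDensity_rnDeriv_eq μ volume hac
  have hgH : g ≤ᵐ[volume] H := by
    refine ae_le_of_forall_setLIntegral_le_of_sigmaFinite hgm fun s hs _ => ?_
    rw [← withDensity_apply _ hs, ← withDensity_apply _ hs, hgμ]
    exact hall s
  -- the minimum turns the bound almost everywhere into a pointwise one
  set p : Rd d → ℝ := fun y => (min (g y) (H y)).toReal with hp
  have hpm : Measurable p := (hgm.min hH).ennreal_toReal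
  have hpg : ∀ᵐ y, p y = (g y).toReal := by
    filter_upwards [hgH] with y hy
    rw [hp]
    simp only [min_eq_left hy]
  have hpi : Integrable p :=
    integrable_toReal_of_lintegral_ne_top (hgm.min hH).aemeasurable
      ((lintegral_mono fun y => min_le_right _ _).trans_lt hfin.lt_top).ne
  have hup : ∀ u : C₀(Rd d, ℝ), Integrable fun y => u y * p y := fun u =>
    hpi.bdd_mul u.continuous.aestronglyMeasurable (ae_of_all _ fun y => abs_apply_le_norm u y)
  have hcomp : ∀ u : C₀(Rd d, ℝ), HasCompactSupport (u : Rd d → ℝ) → L u = ∫ y, u y * p y := by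
    intro u hu
    have h1 := RealRMK.integral_rieszMeasure Λ ⟨⟨u, u.continuous⟩, hu⟩
    have h2 : L u = ∫ y, u y ∂μ := h1.symm
    rw [h2, ← hgμ, integral_withDensity_eq_integral_toReal_smul hgm
      (hgH.mono fun y hy => hy.trans_lt (htop y).lt_top)]
    refine integral_congr_ae (hpg.mono fun y hy => ?_)
    simp only [smul_eq_mul, hy, mul_comm]
  refine ⟨p, hpm, fun y => ENNReal.toReal_nonneg,
    fun y => ENNReal.toReal_mono (htop y) (min_le_right _ _), hpi, fun u => ?_⟩
  have hI0 : 0 ≤ ∫ y, p y := integral_nonneg fun y => ENNReal.toReal_nonneg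
  refine eq_of_forall_dist_le fun η hη => ?_
  obtain ⟨v, hv, huv⟩ := exists_compactSupport_approx u
    (show 0 < η / (‖L‖ + (∫ y, p y) + 1) by positivity)
  have h1 : L u - ∫ y, u y * p y = L (u - v) - ∫ y, (u - v) y * p y := by
    have h2 : ∫ y, (u - v) y * p y = (∫ y, u y * p y) - ∫ y, v y * p y := by
      rw [← integral_sub (hup u) (hup v)]
      exact integral_congr_ae (ae_of_all _ fun y => sub_mul _ _ _)
    rw [map_sub, h2, hcomp v hv]
    ring
  have h3 : ‖∫ y, (u - v) y * p y‖ ≤ ‖u - v‖ * ∫ y, p y := by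
    rw [← integral_const_mul]
    refine norm_integral_le_of_norm_le (hpi.const_mul _) (ae_of_all _ fun y => ?_)
    rw [norm_mul, Real.norm_of_nonneg (ENNReal.toReal_nonneg : 0 ≤ p y)]
    exact mul_le_mul_of_nonneg_right (abs_apply_le_norm _ y) ENNReal.toReal_nonneg
  rw [le_div_iff₀ (by positivity)] at huv
  rw [Real.dist_eq, h1]
  refine (abs_sub _ _).trans ?_
  have h4 := L.le_opNorm (u - v)
  rw [Real.norm_eq_abs] at h3 h4
  nlinarith [norm_nonneg (u - v)]

end Density

/-! ### The heat kernel -/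

section HeatKernel

variable {d : ℕ} {α : ℝ} {φ : ℝ → ℝ}

/-- After a fixed time the scale stays constant, and the powers of `t` in the bound are absorbed by
an exponential. -/
lemma scaledBound_le_heatBound (hα : 0 < α) (hφ : IsProfile d α φ) {s₀ t r : ℝ} (hs₀ : 0 < s₀)
    (hs₀1 : s₀ ≤ 1) (ht : 0 < t) (hr : 0 ≤ r) :
    scaledBound d α φ (min (t ^ α⁻¹) s₀) r
      ≤ s₀ ^ (-(d : ℝ)) * Real.exp (d / α * t) * heatBound d α φ t r := by
  have hφr := hφ.pos r hr
  have hφ1 := hφ.le_one r hr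
  set s := min (t ^ α⁻¹) s₀ with hs
  have ht' : 0 < t ^ α⁻¹ := by positivity
  have hs0 : 0 < s := lt_min ht' hs₀
  have hd0 : (0 : ℝ) ≤ d := Nat.cast_nonneg d
  have hc1 : 1 ≤ s₀ ^ (-(d : ℝ)) :=
    Real.one_le_rpow_of_pos_of_le_one_of_nonpos hs₀ hs₀1 (by linarith)
  have he1 : 1 ≤ Real.exp (d / α * t) := Real.one_le_exp (by positivity)
  have hce : 1 ≤ s₀ ^ (-(d : ℝ)) * Real.exp (d / α * t) := one_le_mul_of_one_le_of_one_le hc1 he1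
  have e : (t ^ α⁻¹) ^ α = t := Real.rpow_inv_rpow ht.le hα.ne'
  have e2 : (t ^ α⁻¹) ^ (-(d : ℝ)) = t ^ (-(d : ℝ) / α) := by
    rw [← Real.rpow_mul ht.le]
    congr 1
    ring
  have hm : 0 < max s r := lt_max_of_lt_left hs0
  have htd : 0 < t ^ (-(d : ℝ) / α) := by positivity
  have h1 : scaledBound d α φ s r
      ≤ s₀ ^ (-(d : ℝ)) * Real.exp (d / α * t) * t ^ (-(d : ℝ) / α) := by
    have h2 : scaledBound d α φ s r ≤ s ^ (-(d : ℝ)) := by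
      unfold scaledBound
      calc s ^ α * φ r / max s r ^ (α + d) ≤ s ^ α * 1 / s ^ (α + d) := by
            gcongr
            exact le_max_left _ _
        _ = s ^ (-(d : ℝ)) := by
            rw [mul_one, ← Real.rpow_sub hs0]
            congr 1
            ring
    refine h2.trans ?_
    rcases le_total (t ^ α⁻¹) s₀ with h | h
    · rw [hs, min_eq_left h, e2]
      exact le_mul_of_one_le_left htd.le hce
    · rw [hs, min_eq_right h, mul_assoc]
      refine le_mul_of_one_le_right (by positivity) ?_
      -- `t^{d/α} ≤ e^{(d/α) t}` because `log t ≤ t`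
      rw [Real.rpow_def_of_pos ht, ← Real.exp_add]
      refine Real.one_le_exp ?_
      have h3 := Real.log_le_sub_one_of_pos ht
      have h4 : (d : ℝ) / α * t + Real.log t * (-(d : ℝ) / α) = d / α * (t - Real.log t) := by ring
      rw [h4]
      have : 0 ≤ t - Real.log t := by linarith
      positivity
  unfold heatBound
  split_ifs with h0
  · exact h1
  · have hr0 : 0 < r := lt_of_le_of_ne hr (Ne.symm h0)
    rw [mul_min_of_nonneg _ _ (by positivity)]
    refine le_min h1 ?_
    have h2 : scaledBound d α φ s r ≤ t * φ r / r ^ (α + d) := by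
      unfold scaledBound
      gcongr
      · rw [← e]
        exact Real.rpow_le_rpow hs0.le (min_le_left _ _) hα.le
      · exact le_max_right _ _
    exact h2.trans (le_mul_of_one_le_left (by positivity) hce)

end HeatKernel

end StableDominated

end

theorem theorem2 (d : ℕ) (hd : 1 ≤ d) (α : ℝ) (hα : α ∈ Set.Ioo (0 : ℝ) 2)
    (φ : ℝ → ℝ) (hφ : StableDominated.IsProfile d α φ)
    (M : ℝ) (hM : 0 < M) (c₄ : ℝ) (hc₄ : 0 < c₄) :
    ∃ C₁ C₂ : ℝ, 0 < C₁ ∧ 0 < C₂ ∧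
      ∀ f : StableDominated.Rd d → StableDominated.Rd d → ℝ≥0∞,
        StableDominated.IsJumpKernel d α φ M c₄ f →
        (StableDominated.nonlocalOp f).IsClosable →
        ∀ P : ℝ → C₀(StableDominated.Rd d, ℝ) →L[ℝ] C₀(StableDominated.Rd d, ℝ),
          StableDominated.IsContractionSemigroup P →
          StableDominated.generator P = (StableDominated.nonlocalOp f).closure →
          ∃ p : ℝ → StableDominated.Rd d → StableDominated.Rd d → ℝ,
            (∀ t, 0 < t → ∀ x y, 0 ≤ p t x y) ∧
            (∀ t, 0 < t → ∀ x, Measurable (p t x) ∧ Integrable (p t x)) ∧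
            (∀ t, 0 < t → ∀ (u : C₀(StableDominated.Rd d, ℝ)) (x : StableDominated.Rd d),
              P t u x = ∫ y, u y * p t x y) ∧
            (∀ t, 0 < t → ∀ x y,
              p t x y ≤ C₁ * Real.exp (C₂ * t) *
                StableDominated.heatBound d α φ t ‖y - x‖) := by
  open StableDominated in
  have hα0 := hα.1
  obtain ⟨s₀, D, K, hs₀, hs₀1, hD, hK, hmain⟩ := exists_semigroup_bound hd hα hφ hM hc₄
  obtain ⟨C, hC, hreg⟩ := exists_regBound_le hα0 hφ
  obtain ⟨C', hC', hint⟩ := exists_lintegral_scaledBound_le hα0 hφ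
  have hd0 : (0 : ℝ) ≤ d := Nat.cast_nonneg d
  refine ⟨K * C * s₀ ^ (-(d : ℝ)), D + d / α, by positivity, by positivity, ?_⟩
  intro f hf hcl P hP hgen
  have hpt : ∀ t x, ∃ p : Rd d → ℝ, 0 < t → (∀ y, 0 ≤ p y) ∧ (Measurable p ∧ Integrable p) ∧
      (∀ u : C₀(Rd d, ℝ), P t u x = ∫ y, u y * p y) ∧
      ∀ y, p y ≤ K * C * s₀ ^ (-(d : ℝ)) * Real.exp ((D + d / α) * t)
        * heatBound d α φ t ‖y - x‖ := by
    intro t x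
    rcases le_or_gt t 0 with ht | ht
    · exact ⟨0, fun h => absurd h (not_lt.2 ht)⟩
    set s := min (t ^ α⁻¹) s₀ with hs
    have hs0 : 0 < s := lt_min (by positivity) hs₀
    have hs1 : s ≤ 1 := (min_le_right _ _).trans hs₀1
    set H : Rd d → ℝ≥0∞ := fun y =>
      ENNReal.ofReal (Real.exp (D * t) * (K * C)) * ENNReal.ofReal (scaledBound d α φ s ‖y - x‖)
      with hH
    have hsm : Measurable fun y => ENNReal.ofReal (scaledBound d α φ s ‖y - x‖) :=
      (measurable_scaledBound hφ (measurable_id.sub_const x)).ennreal_ofReal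
    have hHm : Measurable H := hsm.const_mul _
    let L : C₀(Rd d, ℝ) →L[ℝ] ℝ := (LinearMap.mkContinuous
      { toFun := fun u : C₀(Rd d, ℝ) => u x
        map_add' := fun _ _ => rfl
        map_smul' := fun _ _ => rfl } 1
      fun u => by simpa using abs_apply_le_norm u x).comp (P t)
    have hHfin : ∫⁻ y, H y ≠ ∞ := by
      rw [lintegral_const_mul _ hsm]
      exact ENNReal.mul_ne_top ENNReal.ofReal_ne_top
        ((hint s hs0 x).trans_lt ENNReal.ofReal_lt_top).ne
    have hLH : ∀ u : C₀(Rd d, ℝ), (∀ x, 0 ≤ u x) →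
        ENNReal.ofReal (L u) ≤ ∫⁻ y, H y * ENNReal.ofReal (u y) := by
      intro u hu
      refine (hmain f hf hcl P hP hgen t ht u hu x).2.trans ?_
      rw [← mul_assoc, ← ENNReal.ofReal_mul (by positivity)]
      have hWu : Measurable fun y => regBound d α φ s (x - y) * ENNReal.ofReal (u y) :=
        Measurable.fun_mul ((measurable_regBound hφ).comp (measurable_id.const_sub x))
          u.continuous.measurable.ennreal_ofReal
      rw [← lintegral_const_mul _ hWu]
      refine lintegral_mono fun y => ?_
      rw [← mul_assoc]
      refine mul_le_mul' ?_ le_rfl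
      have h1 := hreg s hs0 hs1 (x - y)
      rw [norm_sub_rev, ENNReal.ofReal_mul hC.le] at h1
      refine (mul_le_mul' le_rfl h1).trans (le_of_eq ?_)
      rw [← mul_assoc, ← ENNReal.ofReal_mul (by positivity), mul_assoc]
    obtain ⟨p, hp1, hp2, hp3, hp4, hp5⟩ := exists_density L
      (fun u hu => (hmain f hf hcl P hP hgen t ht u hu x).1) hHm hHfin
      (fun y => ENNReal.mul_ne_top ENNReal.ofReal_ne_top ENNReal.ofReal_ne_top) hLH
    refine ⟨p, fun _ => ⟨hp2, ⟨hp1, hp4⟩, hp5, fun y => (hp3 y).trans ?_⟩⟩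
    rw [hH]
    beta_reduce
    rw [← ENNReal.ofReal_mul (by positivity), ENNReal.toReal_ofReal
      (mul_nonneg (by positivity) (scaledBound_pos hφ hs0 (norm_nonneg _)).le)]
    have h1 := scaledBound_le_heatBound hα0 hφ hs₀ hs₀1 ht (norm_nonneg (y - x))
    calc _ ≤ Real.exp (D * t) * (K * C) * (s₀ ^ (-(d : ℝ)) * Real.exp (d / α * t)
            * heatBound d α φ t ‖y - x‖) := by gcongr
      _ = _ := by
          rw [add_mul, Real.exp_add]
          ring
  choose p hp using hpt
  exact ⟨p, fun t ht x => (hp t x ht).1, fun t ht x => (hp t x ht).2.1,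
    fun t ht u x => (hp t x ht).2.2.1 u, fun t ht x => (hp t x ht).2.2.2⟩
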